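/- Let $\nu>0$, $\beta>0$ and $0<\alpha<4$. Let $\vec u_0\in L^2(\mathbb R^3;\mathbb R^3)$ be divergence-free and let $\vec f\in L^2(\mathbb R^3;\mathbb R^3)\cap\dot H^{-\alpha/2}(\mathbb R^3)$ be divergence-free (in the sense of distributions) and independent of time. Here $(-\Delta)^{s/2}$ is the Fourier multiplier with symbol $|\xi|^{s}$ (for the Fourier transform with kernel $e^{-ix\cdot\xi}$) and $\|v\|_{\dot H^{s}}=\|(-\Delta)^{s/2}v\|_{L^2}$. Then there exists a function $$\vec u\in L^\infty_{loc}([0,+\infty),L^2(\mathbb R^3))\cap L^2_{loc}([0,+\infty),\dot H^{\alpha/2}(\mathbb R^3))$$ which is a global weak solution of the fractional damped Navier–Stokes equations $$\partial_t\vec u=-\nu(-\Delta)^{\alpha/2}\vec u-(\vec u\cdot\vec\nabla)\vec u-\vec\nabla p+\vec f-\beta\vec u,\qquad \mathrm{div}(\vec u)=0,\qquad \vec u(0,\cdot)=\vec u_0 .$$ This means: $t\mapsto\vec u(t,\cdot)$ is weakly continuous from $[0,+\infty)$ to $L^2(\mathbb R^3)$ with $\vec u(0,\cdot)=\vec u_0$;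 $\mathrm{div}\,\vec u(t,\cdot)=0$ in the sense of distributions for every $t\ge 0$; and there is a distribution $p\in\mathcal D'((0,+\infty)\times\mathbb R^3)$ such that, for every $\vec\varphi\in C^\infty_c((0,+\infty)\times\mathbb R^3;\mathbb R^3)$, $$\int_0^{\infty}\!\!\int_{\mathbb R^3}\Big(\vec u\cdot\partial_t\vec\varphi-\nu\,\vec u\cdot(-\Delta)^{\alpha/2}\vec\varphi+\sum_{i,j=1}^3u_iu_j\,\partial_j\varphi_i+\vec f\cdot\vec\varphi-\beta\,\vec u\cdot\vec\varphi\Big)\,dx\,dt+\langle p,\mathrm{div}\,\vec\varphi\rangle=0 .$$ Moreover, $\vec u$ satisfies the energy inequality: for every $t\ge 0$, $$\|\vec u(t,\cdot)\|_{L^2}^2\le\|\vec u_0\|_{L^2}^2-2\nu\int_0^t\|\vec u(s,\cdot)\|_{\dot H^{\alpha/2}}^2\,ds+2\int_0^t\!\int_{\mathbb R^3}\vec f\cdot\vec u(s,x)\,dx\,ds-2\beta\int_0^t\|\vec u(s,\cdot)\|_{L^2}^2\,ds .$$ -/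

import Mathlib

open MeasureTheory Set
open scoped ENNReal FourierTransform Distributions LineDeriv

noncomputable section

/-- The physical space `ℝ³` with its Euclidean norm. -/
abbrev R3 : Type := EuclideanSpace ℝ (Fin 3)

/-- The space `L²(ℝ³; ℝ³)` of square integrable vector fields. -/
abbrev L2Field : Type := Lp R3 2 (volume : Measure R3)

/-- The `i`-th component of a vector field, viewed as an element of `L²(ℝ³; ℂ)`. -/
def componentC (i : Fin 3) (v : L2Field) : Lp ℂ 2 (volume : Measure R3) :=
  (Complex.ofRealCLM.comp (EuclideanSpace.proj i : R3 →L[ℝ] ℝ)).compLp v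

/-- The squared homogeneous Sobolev norm `‖v‖²_{Ḣ^s} = ‖(-Δ)^{s/2} v‖²_{L²}`, possibly infinite, of
a vector field `v ∈ L²`. The Fourier transform is normalised with `exp (-2πi x·ξ)`, so the
symbol of `(-Δ)^{s/2}` is `(2π|ξ|)^s`. -/
def homSobolevSq (s : ℝ) (v : L2Field) : ℝ≥0∞ :=
  ∑ i : Fin 3, ∫⁻ ξ : R3, ENNReal.ofReal ((2 * Real.pi * ‖ξ‖) ^ (2 * s)) *
    ‖(𝓕 (componentC i v) : Lp ℂ 2 (volume : Measure R3)) ξ‖ₑ ^ 2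

/-- `v ∈ L²` belongs to `Ḣ^s`. -/
def MemHomSobolev (s : ℝ) (v : L2Field) : Prop := homSobolevSq s v < ⊤

/-- `div v = 0` in the sense of distributions. -/
def IsDivFree (v : L2Field) : Prop :=
  ∀ ψ : R3 → ℝ, ContDiff ℝ (⊤ : ℕ∞) ψ → HasCompactSupport ψ → ∫ x, fderiv ℝ ψ x (v x) = 0

/-- The fractional Laplacian `(-Δ)^{α/2} g`, with symbol `(2π|ξ|)^α` in the normalisation
`exp (-2πi x·ξ)`, of a smooth compactly supported (or Schwartz) real function `g`. The inverse
transform is then real valued, and taking the real part only changes the codomain. -/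
def fracLaplacian (α : ℝ) (g : R3 → ℝ) (x : R3) : ℝ :=
  (𝓕⁻ (fun ξ : R3 => (((2 * Real.pi * ‖ξ‖) ^ α : ℝ) : ℂ) *
    𝓕 (fun y : R3 => (g y : ℂ)) ξ) x).re

/-- The fractional Laplacian of a vector field, component by component. -/
def fracLaplacianVec (α : ℝ) (g : R3 → R3) (x : R3) : R3 :=
  WithLp.toLp 2 fun i => fracLaplacian α (fun y => g y i) x

/-- The open space-time domain `(0, ∞) × ℝ³`. -/
def spaceTime : TopologicalSpace.Opens (ℝ × R3) :=
  ⟨{z | 0 < z.1}, isOpen_lt continuous_const continuous_fst⟩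

/-- The spatial divergence `∑ i, ∂ᵢ φᵢ` of a vector valued test function on `(0, ∞) × ℝ³`. -/
def spaceDiv (φ : 𝓓(spaceTime, R3)) : 𝓓(spaceTime, ℝ) :=
  ∑ i : Fin 3, TestFunction.postcompCLM (EuclideanSpace.proj i : R3 →L[ℝ] ℝ)
    (∂_{((0 : ℝ), EuclideanSpace.single i (1 : ℝ))} φ)

/-- `u ∈ L^∞_loc([0, ∞), L²(ℝ³))`. -/
def MemLinftyLocL2 (u : ℝ → L2Field) : Prop :=
  ∀ T : ℝ, 0 < T → MemLp u ⊤ (volume.restrict (Icc 0 T))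

/-- `u ∈ L²_loc([0, ∞), Ḣ^s(ℝ³))`, for a curve `u` in `L²`. -/
def MemL2LocHomSobolev (s : ℝ) (u : ℝ → L2Field) : Prop :=
  ∀ T : ℝ, 0 < T → AEStronglyMeasurable u (volume.restrict (Icc 0 T)) ∧
    ∫⁻ t in Icc 0 T, homSobolevSq s (u t) < ⊤

/-- The equation
`∂ₜ u = -ν (-Δ)^{α/2} u - (u·∇) u - ∇p + f - β u` in the sense of distributions on
`(0, ∞) × ℝ³`, with a distribution `p` as pressure. For divergence-free `u` the term `(u·∇) u`
is `∑ j, ∂ⱼ (uⱼ u)`, whence the term `u · Dφ(u) = ∑ i j, uᵢ uⱼ ∂ⱼ φᵢ` below. -/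
def SatisfiesFracNS (ν α β : ℝ) (f : L2Field) (u : ℝ → L2Field) (p : 𝓓'(spaceTime, ℝ)) : Prop :=
  ∀ φ : 𝓓(spaceTime, R3),
    (∫ t in Ioi (0 : ℝ), ∫ x : R3,
      (inner ℝ (u t x) (deriv (fun s => φ (s, x)) t)
        - ν * inner ℝ (u t x) (fracLaplacianVec α (fun y => φ (t, y)) x)
        + inner ℝ (u t x) (fderiv ℝ (fun y => φ (t, y)) x (u t x))
        + inner ℝ (f x) (φ (t, x))
        - β * inner ℝ (u t x) (φ (t, x))))
      + p (spaceDiv φ) = 0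

/-- Global weak solutions of the fractional damped Navier-Stokes equations with initial
datum `u₀` and force `f`. The initial datum is attained in the sense of the weak continuity
of `t ↦ u(t)` in `L²`. -/
structure IsWeakSolution (ν α β : ℝ) (u₀ f : L2Field) (u : ℝ → L2Field) : Prop where
  memLinfty : MemLinftyLocL2 u
  memL2 : MemL2LocHomSobolev (α / 2) u
  divFree : ∀ t, 0 ≤ t → IsDivFree (u t)
  weakContinuous : ∀ w : L2Field, ContinuousOn (fun t => inner ℝ (u t) w) (Ici 0)
  initial : u 0 = u₀
  equation : ∃ p : 𝓓'(spaceTime, ℝ), SatisfiesFracNS ν α β f u p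

/-- The energy inequality, at every time `t ≥ 0`. -/
def EnergyInequality (ν α β : ℝ) (u₀ f : L2Field) (u : ℝ → L2Field) : Prop :=
  ∀ t : ℝ, 0 ≤ t →
    ‖u t‖ ^ 2 ≤ ‖u₀‖ ^ 2
      - 2 * ν * (∫⁻ s in Icc 0 t, homSobolevSq (α / 2) (u s)).toReal
      + 2 * (∫ s in (0 : ℝ)..t, ∫ x : R3, inner ℝ (f x) (u s x))
      - 2 * β * ∫ s in (0 : ℝ)..t, ‖u s‖ ^ 2

/-- The test function `spaceDiv φ` is pointwise the divergence in the space variable. -/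
theorem spaceDiv_apply (φ : 𝓓(spaceTime, R3)) (t : ℝ) (x : R3) :
    spaceDiv φ (t, x) =
      ∑ i : Fin 3, fderiv ℝ (fun y => φ (t, y)) x (EuclideanSpace.single i 1) i := by
  have hφ : DifferentiableAt ℝ φ (t, x) :=
    (φ.contDiff.differentiable (by simp)).differentiableAt
  have hd : HasFDerivAt (fun y => φ (t, y))
      ((fderiv ℝ φ (t, x)).comp (ContinuousLinearMap.inr ℝ ℝ R3)) x :=
    hφ.hasFDerivAt.comp x (hasFDerivAt_prodMk_right t x)
  have hsum : ∀ g : Fin 3 → 𝓓(spaceTime, ℝ), (∑ i, g i) (t, x) = ∑ i, g i (t, x) := by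
    intro g
    simp [Fin.sum_univ_three]
  rw [spaceDiv, hsum, hd.fderiv]
  refine Finset.sum_congr rfl fun i _ => ?_
  rw [TestFunction.postcompCLM_apply, TestFunction.lineDerivOp_eq_lineDerivCLM ℝ]
  simp [TestFunction.lineDerivCLM_apply, hφ.lineDeriv_eq_fderiv]

end

/-! The proof is a Galerkin scheme carried out in an abstract Hilbert space and then applied to
`L²`. All derivatives are put on the test vector: for a test field `W` the nonlinear term is `∫ u ·
(DW) u`, a quadratic form in `u` that is bounded on `L²` as soon as `DW` is bounded. Test fields are
therefore taken of the form `W = (1 - Δ/4π²)⁻² w` with `w` divergence-free in `L²`. This smoothing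
makes `DW` continuous, bounded and square integrable, it makes `(-Δ)^(α/2) W` an element of `L²`
because `α < 4`, and its range is dense in the divergence-free fields. `EnergyModel` records what
the argument uses.

On finite dimensional spaces of test fields the equation is an ODE. The nonlinear term vanishes when
`u` is tested with itself, so damping makes every ball of radius `ρ > ‖f‖/β` containing the datum
invariant; solutions exist for all times with a bound independent of the dimension. Tested with a
fixed vector the approximations are equi-Lipschitz in time, so compactness of a countable product of
intervals, followed by density in time and in the test vector, yields a subsequence converging
weakly in `L²` at every time `t ≥ 0`.

Weak convergence suffices for the linear terms, and lower semicontinuity with Fatou's lemma gives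
the energy inequality. In the nonlinear term one factor `u` is replaced by its low frequencies `S R
u`. For fixed `R`, `M w (S R ·)` turns weak into strong convergence: low-pass values at a point are
bounded linear functionals, and `DW` in `L²` provides a dominating function on the whole space. The
error is controlled by `‖u - S R u‖² ≤ δ R * q u`, with `δ R → 0` and `q` the dissipated energy,
whose time integral is bounded uniformly along the sequence. No compactness theorem in space-time is
needed.

A general test function is `smoothing` of another test function, and is split by the projection on
gradients. The gradient part is orthogonal to every divergence-free field, so it survives only in
the convective term. There it depends on `φ` through `div φ` alone, since the symbol of `∂ⱼ` of the
`i`-th component is `ξᵢ ξⱼ / |ξ|²` applied to the divergence; this defines the pressure. The main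
steps are `exists_galerkin`, `exists_weakTendsto`, `tendsto_integral_rhs`, `integral_test`,
`tendsto_entryL_lowPass`, `closure_range_smoothing` and `convection_gradProj_slice`. -/

noncomputable section

/-! ### Ordinary differential equations with an inward pointing field -/

section ODE

open Metric Filter Topology NNReal

/-- A `C¹` vector field which points inwards on a sphere has a solution that stays in the ball, on
every bounded time interval. -/
theorem exists_solution_of_inner_neg {E : Type*} [NormedAddCommGroup E] [InnerProductSpace ℝ E]
    [FiniteDimensional ℝ E] {F : E → E} (hF : ContDiff ℝ 1 F) {ρ : ℝ} (hρ : 0 < ρ)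
    (hin : ∀ x, ‖x‖ = ρ → inner ℝ x (F x) < 0) {x₀ : E} (hx₀ : ‖x₀‖ ≤ ρ) {T : ℝ} (hT : 0 < T) :
    ∃ α : ℝ → E, α 0 = x₀ ∧ (∀ t ∈ Icc 0 T, HasDerivWithinAt α (F (α t)) (Icc 0 T) t) ∧
      ∀ t ∈ Icc 0 T, ‖α t‖ ≤ ρ := by
  -- The cut-off makes the field bounded and globally Lipschitz, so Picard–Lindelöf applies on all
  -- of `[0, T]` at once; the field is unchanged on the ball of radius `ρ`, which the solution never
  -- leaves.
  let χ : ContDiffBump (0 : E) := ⟨ρ, ρ + 1, hρ, by linarith⟩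
  let G : E → E := fun x => χ x • F x
  have hG : ContDiff ℝ 1 G := χ.contDiff.smul hF
  have hGc : HasCompactSupport G := χ.hasCompactSupport.smul_right
  obtain ⟨K, hK⟩ := hG.lipschitzWith_of_hasCompactSupport hGc one_ne_zero
  obtain ⟨L, hL⟩ := hGc.exists_bound_of_continuous hG.continuous
  have hGF : ∀ x, ‖x‖ ≤ ρ → G x = F x := fun x hx => by
    have : χ x = 1 := χ.one_of_mem_closedBall (by simpa using hx)
    simp [G, this]
  have hL' : ∀ x, ‖G x‖ ≤ L.toNNReal := fun x => (hL x).trans (Real.le_coe_toNNReal L)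
  have hPL : IsPicardLindelof (fun _ => G) (tmin := 0) (tmax := T) ⟨0, le_rfl, hT.le⟩ x₀
      (L.toNNReal * T.toNNReal) 0 L.toNNReal K := by
    refine .of_time_independent (fun x _ => hL' x) hK.lipschitzOnWith ?_
    simp [max_eq_left hT.le]
  obtain ⟨α, hα₀, hα⟩ := hPL.exists_eq_forall_mem_Icc_hasDerivWithinAt₀
  have hbd : ∀ t ∈ Icc 0 T, ‖α t‖ ≤ ρ := by
    have hsq : ∀ t ∈ Icc 0 T,
        HasDerivWithinAt (fun t => ‖α t‖ ^ 2) (2 * inner ℝ (α t) (G (α t))) (Icc 0 T) t :=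
      fun t ht => (hα t ht).norm_sq
    -- Barrier argument: whenever `‖α t‖² = ρ²` its derivative is strictly negative, hence below the
    -- derivative of the constant barrier.
    have key := image_le_of_deriv_right_lt_deriv_boundary (f := fun t => ‖α t‖ ^ 2)
      (f' := fun t => 2 * inner ℝ (α t) (G (α t))) (a := 0) (b := T) (B := fun _ => ρ ^ 2)
      (B' := fun _ => 0) (fun t ht => (hsq t ht).continuousWithinAt)
      (fun t ht => (hsq t ⟨ht.1, ht.2.le⟩).mono_of_mem_nhdsWithin
        (Icc_mem_nhdsGE_of_mem ⟨ht.1, ht.2⟩))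
      (by rw [show α 0 = x₀ from hα₀]; gcongr) (fun _ => hasDerivAt_const _ _) ?_
    · intro t ht
      exact abs_le_of_sq_le_sq' (key ht) hρ.le |>.2
    · intro t _ h
      have h' : ‖α t‖ = ρ := by
        rwa [sq_eq_sq₀ (norm_nonneg _) hρ.le] at h
      rw [hGF _ h'.le]
      linarith [hin _ h']
  refine ⟨α, hα₀, fun t ht => ?_, hbd⟩
  rw [← hGF _ (hbd t ht)]
  exact hα t ht

end ODE

/-! ### The abstract evolution problem and its Galerkin approximations -/

/-- The structure of the evolution problem `∂ₜu = -ν A u + B(u, u) + f - β u`, in a weak form: `D` is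
a space of regular test vectors, embedded in the phase space `H` by `ι`, and `M w` is the operator
such that `⟪u, M w u⟫` is the nonlinear term tested with `w`. -/
structure EnergyModel (H D : Type*) [NormedAddCommGroup H] [InnerProductSpace ℝ H]
    [NormedAddCommGroup D] [NormedSpace ℝ D] where
  /-- the embedding of the test vectors -/
  ι : D →L[ℝ] H
  /-- the dissipative operator on test vectors -/
  A : D →L[ℝ] H
  /-- the nonlinear term -/
  M : D →L[ℝ] H →L[ℝ] H
  /-- the dissipated energy -/
  q : H → ℝ≥0∞
  /-- smoothing operators -/
  S : ℕ → H →L[ℝ] H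
  /-- the rate of approximation by the smoothing operators -/
  δ : ℕ → ℝ
  ι_injective : Function.Injective ι
  inner_M_self : ∀ w, inner ℝ (ι w) (M w (ι w)) = 0
  inner_A_nonneg : ∀ w, 0 ≤ inner ℝ (ι w) (A w)
  q_ι : ∀ w, q (ι w) = ENNReal.ofReal (inner ℝ (ι w) (A w))
  q_le_liminf : ∀ (v : ℕ → H) (u : H),
    (∀ h, Filter.Tendsto (fun n => inner ℝ (v n) h) Filter.atTop (nhds (inner ℝ u h))) →
      q u ≤ Filter.liminf (fun n => q (v n)) Filter.atTop
  -- Compactness: after smoothing of the argument, the nonlinear operator turns bounded weakly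
  -- convergent sequences into strongly convergent ones.
  tendsto_M_S : ∀ (w : D) (R : ℕ) (v : ℕ → H) (u : H) (C : ℝ), (∀ n, ‖v n‖ ≤ C) →
    (∀ h, Filter.Tendsto (fun n => inner ℝ (v n) h) Filter.atTop (nhds (inner ℝ u h))) →
      Filter.Tendsto (fun n => M w (S R (v n))) Filter.atTop (nhds (M w (S R u)))
  -- The dissipation pays for the smoothing error, at a rate that does not depend on the state.
  norm_sub_S_le : ∀ R u, ENNReal.ofReal (‖u - S R u‖ ^ 2) ≤ ENNReal.ofReal (δ R) * q u
  δ_nonneg : ∀ R, 0 ≤ δ R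
  tendsto_δ : Filter.Tendsto δ Filter.atTop (nhds 0)

namespace EnergyModel

open Filter Topology

variable {H D : Type*} [NormedAddCommGroup H] [InnerProductSpace ℝ H]
    [NormedAddCommGroup D] [NormedSpace ℝ D] (𝓜 : EnergyModel H D)

/-- The right hand side of the equation at the state `u`, tested with `w`. -/
def rhs (ν β : ℝ) (f u : H) (w : D) : ℝ :=
  -ν * inner ℝ u (𝓜.A w) + inner ℝ u (𝓜.M w u) + inner ℝ f (𝓜.ι w) - β * inner ℝ u (𝓜.ι w)

variable (ν β : ℝ) (f : H)

theorem rhs_add (u : H) (w w' : D) :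
    𝓜.rhs ν β f u (w + w') = 𝓜.rhs ν β f u w + 𝓜.rhs ν β f u w' := by
  simp only [rhs, map_add, inner_add_right, add_apply]; ring

theorem rhs_smul (u : H) (c : ℝ) (w : D) :
    𝓜.rhs ν β f u (c • w) = c * 𝓜.rhs ν β f u w := by
  simp only [rhs, map_smul, inner_smul_right, smul_apply]; ring

/-- The right hand side as a linear form of the test vector. -/
def rhsₗ (u : H) : D →ₗ[ℝ] ℝ where
  toFun := 𝓜.rhs ν β f u
  map_add' := 𝓜.rhs_add ν β f u
  map_smul' c w := by simp [rhs_smul]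

theorem rhs_sum {ι' : Type*} (s : Finset ι') (u : H) (c : ι' → ℝ) (w : ι' → D) :
    𝓜.rhs ν β f u (∑ i ∈ s, c i • w i) = ∑ i ∈ s, c i * 𝓜.rhs ν β f u (w i) := by
  refine (map_sum (𝓜.rhsₗ ν β f u) (fun i => c i • w i) s).trans
    (Finset.sum_congr rfl fun i _ => ?_)
  exact 𝓜.rhs_smul ν β f u (c i) (w i)

theorem rhs_sub (u : H) (w w' : D) :
    𝓜.rhs ν β f u (w - w') = 𝓜.rhs ν β f u w - 𝓜.rhs ν β f u w' :=
  map_sub (𝓜.rhsₗ ν β f u) w w'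

/-- A bound of the right hand side on a ball of radius `ρ`. -/
def rhsBound (ρ : ℝ) : ℝ :=
  |ν| * (ρ * ‖𝓜.A‖) + ρ * (‖𝓜.M‖ * ρ) + ‖f‖ * ‖𝓜.ι‖ + |β| * (ρ * ‖𝓜.ι‖)

theorem rhsBound_nonneg {ρ : ℝ} (hρ : 0 ≤ ρ) : 0 ≤ 𝓜.rhsBound ν β f ρ := by
  unfold rhsBound; positivity

/-- Only the norm of the state enters, all unbounded operators having been moved to `w`. This is the
source of the equicontinuity in time of the approximations. -/
theorem abs_rhs_le {ρ : ℝ} {u : H} (hu : ‖u‖ ≤ ρ) (w : D) :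
    |𝓜.rhs ν β f u w| ≤ 𝓜.rhsBound ν β f ρ * ‖w‖ := by
  have hρ : 0 ≤ ρ := (norm_nonneg u).trans hu
  have h1 : |inner ℝ u (𝓜.A w)| ≤ ρ * (‖𝓜.A‖ * ‖w‖) :=
    (abs_real_inner_le_norm _ _).trans (by gcongr; exact 𝓜.A.le_opNorm w)
  have h2 : |inner ℝ u (𝓜.M w u)| ≤ ρ * ((‖𝓜.M‖ * ‖w‖) * ρ) :=
    (abs_real_inner_le_norm _ _).trans (by
      gcongr
      exact ((𝓜.M w).le_opNorm u).trans (by gcongr; exact 𝓜.M.le_opNorm w))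
  have h3 : |inner ℝ f (𝓜.ι w)| ≤ ‖f‖ * (‖𝓜.ι‖ * ‖w‖) :=
    (abs_real_inner_le_norm _ _).trans (by gcongr; exact 𝓜.ι.le_opNorm w)
  have h4 : |inner ℝ u (𝓜.ι w)| ≤ ρ * (‖𝓜.ι‖ * ‖w‖) :=
    (abs_real_inner_le_norm _ _).trans (by gcongr; exact 𝓜.ι.le_opNorm w)
  calc |𝓜.rhs ν β f u w| ≤ |-ν * inner ℝ u (𝓜.A w)| + |inner ℝ u (𝓜.M w u)|
        + |inner ℝ f (𝓜.ι w)| + |β * inner ℝ u (𝓜.ι w)| := by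
        unfold rhs
        refine (abs_sub _ _).trans ?_
        gcongr
        exact abs_add_three _ _ _
    _ ≤ |ν| * (ρ * (‖𝓜.A‖ * ‖w‖)) + ρ * ((‖𝓜.M‖ * ‖w‖) * ρ) + ‖f‖ * (‖𝓜.ι‖ * ‖w‖)
        + |β| * (ρ * (‖𝓜.ι‖ * ‖w‖)) := by
        rw [abs_mul, abs_mul, abs_neg]
        gcongr
    _ = _ := by unfold rhsBound; ring

/-- The energy balance: the nonlinear term drops out by `inner_M_self`. -/
theorem rhs_self (w : D) : 𝓜.rhs ν β f (𝓜.ι w) w =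
    -ν * inner ℝ (𝓜.ι w) (𝓜.A w) + inner ℝ f (𝓜.ι w) - β * ‖𝓜.ι w‖ ^ 2 := by
  rw [rhs, 𝓜.inner_M_self, real_inner_self_eq_norm_sq]; ring

/-- The Galerkin approximation in a finite dimensional space of test vectors. -/
theorem exists_galerkin (hν : 0 ≤ ν) {u₀ : H} {ρ : ℝ} (hρ : 0 < ρ) (hu₀ : ‖u₀‖ ≤ ρ)
    (hf : ‖f‖ < β * ρ) (E : Submodule ℝ D) [FiniteDimensional ℝ E] {T : ℝ} (hT : 0 < T) :
    ∃ c : ℝ → D, Continuous c ∧ (∀ t, c t ∈ E) ∧ (∀ t, ‖𝓜.ι (c t)‖ ≤ ρ) ∧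
      ‖𝓜.ι (c 0)‖ ≤ ‖u₀‖ ∧ (∀ w ∈ E, inner ℝ (𝓜.ι (c 0)) (𝓜.ι w) = inner ℝ u₀ (𝓜.ι w)) ∧
      (∀ w ∈ E, ∀ t ∈ Icc 0 T, HasDerivWithinAt (fun t => inner ℝ (𝓜.ι (c t)) (𝓜.ι w))
        (𝓜.rhs ν β f (𝓜.ι (c t)) w) (Icc 0 T) t) ∧
      (∀ t ∈ Icc 0 T, HasDerivWithinAt (fun t => ‖𝓜.ι (c t)‖ ^ 2)
        (2 * 𝓜.rhs ν β f (𝓜.ι (c t)) (c t)) (Icc 0 T) t) := by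
  -- The ODE is posed in the image of `E`, with the inner product of `H`; injectivity of `ι` allows
  -- its solution to be lifted back to `D`.
  let V : Submodule ℝ H := E.map (𝓜.ι : D →ₗ[ℝ] H)
  let b := stdOrthonormalBasis ℝ V
  have hg : ∀ i, ∃ g ∈ E, 𝓜.ι g = (b i : H) := fun i =>
    Submodule.mem_map.1 (b i).2
  choose g hgE hg using hg
  let lift : V →L[ℝ] D := ∑ i, (innerSL ℝ (b i)).smulRight (g i)
  have lift_apply : ∀ x : V, lift x = ∑ i, inner ℝ (b i) x • g i := fun x => by
    simp [lift]
  have lift_mem : ∀ x, lift x ∈ E := fun x => by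
    rw [lift_apply]; exact E.sum_mem fun i _ => E.smul_mem _ (hgE i)
  have ι_lift : ∀ x : V, 𝓜.ι (lift x) = x := fun x => by
    conv_rhs => rw [← b.sum_repr' x]
    simp [lift_apply, hg]
  have lift_ι : ∀ w (hw : w ∈ E), lift ⟨𝓜.ι w, Submodule.mem_map_of_mem hw⟩ = w := fun w hw =>
    𝓜.ι_injective (ι_lift _)
  -- `F x` represents, in an orthonormal basis of `V`, the linear form `y ↦ rhs x (lift y)`.
  let F : V → V := fun x => ∑ i, 𝓜.rhs ν β f x (g i) • b i
  have hF : ContDiff ℝ 1 F := by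
    have h1 : ContDiff ℝ 1 (fun x : V => (x : H)) := V.subtypeL.contDiff
    have : ∀ i, ContDiff ℝ 1 fun x : V => 𝓜.rhs ν β f x (g i) := fun i => by
      unfold rhs
      have h2 : ContDiff ℝ 1 (fun x : V => 𝓜.M (g i) (x : H)) := (𝓜.M (g i)).contDiff.comp h1
      exact ((((contDiff_const.mul (h1.inner ℝ contDiff_const)).add (h1.inner ℝ h2)).add
        contDiff_const).sub (contDiff_const.mul (h1.inner ℝ contDiff_const)))
    exact ContDiff.sum fun i _ => (this i).smul contDiff_const
  have inner_F : ∀ x y : V, inner ℝ (F x) y = 𝓜.rhs ν β f x (lift y) := fun x y => by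
    rw [lift_apply, rhs_sum]
    simp only [F, sum_inner, real_inner_smul_left]
    exact Finset.sum_congr rfl fun i _ => mul_comm _ _
  -- On the sphere the dissipation has a favourable sign and the rest is at most `‖f‖ ρ - β ρ²`,
  -- negative by `hf`.
  have rhs_neg : ∀ x : V, ‖x‖ = ρ → inner ℝ x (F x) < 0 := fun x hx => by
    rw [real_inner_comm, inner_F]
    conv_lhs => rw [← ι_lift x]
    rw [rhs_self]
    have h1 := mul_nonneg hν (𝓜.inner_A_nonneg (lift x))
    have hx' : ‖𝓜.ι (lift x)‖ = ρ := by rw [ι_lift]; exact hx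
    have h2 := (le_abs_self _).trans (abs_real_inner_le_norm f (𝓜.ι (lift x)))
    rw [hx'] at h2 ⊢
    nlinarith
  let x₀ : V := V.orthogonalProjectionOnto u₀
  have hx₀ : ‖x₀‖ ≤ ‖u₀‖ := V.norm_orthogonalProjectionOnto_apply_le u₀
  obtain ⟨α, hα₀, hα, hbd⟩ := exists_solution_of_inner_neg hF hρ rhs_neg (hx₀.trans hu₀) hT
  -- Freezing the solution outside `[0, T]` gives a function that is continuous and bounded on the
  -- whole line.
  let π : ℝ → ℝ := fun t => projIcc 0 T hT.le t
  have hπ : ∀ t, π t ∈ Icc 0 T := fun t => (projIcc 0 T hT.le t).2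
  have hπ' : ∀ t ∈ Icc 0 T, π t = t := fun t ht => by simp [π, projIcc_of_mem hT.le ht]
  have hαc : Continuous fun t => α (π t) :=
    ContinuousOn.comp_continuous (fun t ht => (hα t ht).continuousWithinAt)
      (continuous_subtype_val.comp continuous_projIcc) hπ
  have hα' : ∀ t ∈ Icc 0 T, HasDerivWithinAt (fun t => α (π t)) (F (α (π t))) (Icc 0 T) t :=
    fun t ht => by
      rw [hπ' t ht]
      exact (hα t ht).congr (fun s hs => by rw [hπ' s hs]) (by rw [hπ' t ht])
  have h0 : α (π 0) = x₀ := by rw [hπ' 0 ⟨le_rfl, hT.le⟩, hα₀]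
  refine ⟨fun t => lift (α (π t)), lift.continuous.comp hαc, fun t => lift_mem _, fun t => ?_, ?_,
    fun w hw => ?_, fun w hw t ht => ?_, fun t ht => ?_⟩
  · rw [ι_lift]; exact hbd _ (hπ t)
  · rw [ι_lift, h0]; exact hx₀
  · rw [ι_lift, h0]
    exact V.inner_orthogonalProjectionOnto_eq_of_mem_right ⟨_, Submodule.mem_map_of_mem hw⟩ u₀
  · simp only [ι_lift]
    have := (hα' t ht).inner ℝ
      (hasDerivWithinAt_const t _ (⟨𝓜.ι w, Submodule.mem_map_of_mem hw⟩ : V))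
    simp only [inner_zero_right, zero_add, inner_F, lift_ι w hw] at this
    exact this
  · simp only [ι_lift]
    have := (hα' t ht).norm_sq
    rw [real_inner_comm, inner_F] at this
    exact this

end EnergyModel

end

noncomputable section

/-! ### Weak convergence, weak measurability and lower limits -/

section Preliminaries

open Filter Topology

/-- The common core of two density arguments below: from rational to real times, and from a dense
sequence of test vectors to the closure of their span. -/
theorem cauchySeq_of_forall_approx {x : ℕ → ℝ}
    (h : ∀ ε > 0, ∃ y : ℕ → ℝ, CauchySeq y ∧ ∀ᶠ n in atTop, |x n - y n| ≤ ε) : CauchySeq x := by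
  rw [Metric.cauchySeq_iff']
  intro ε hε
  obtain ⟨y, hy, hxy⟩ := h (ε / 4) (by linarith)
  obtain ⟨N, hN⟩ := Metric.cauchySeq_iff.1 hy (ε / 4) (by linarith)
  obtain ⟨N', hN'⟩ := eventually_atTop.1 hxy
  refine ⟨max N N', fun n hn => ?_⟩
  have h1 := hN' n ((le_max_right _ _).trans hn)
  have h2 := hN' (max N N') (le_max_right _ _)
  have h3 := hN n ((le_max_left _ _).trans hn) (max N N') (le_max_left _ _)
  rw [Real.dist_eq] at *
  rw [abs_le] at h1 h2
  rw [abs_lt] at h3 ⊢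
  constructor <;> linarith [h1.1, h1.2, h2.1, h2.2, h3.1, h3.2]

/-- Weakly measurable functions in a separable Hilbert space are strongly measurable. -/
theorem aestronglyMeasurable_of_inner {X H : Type*} [MeasurableSpace X] {μ : Measure X}
    [NormedAddCommGroup H] [InnerProductSpace ℝ H] [CompleteSpace H]
    [TopologicalSpace.SeparableSpace H] {u : X → H}
    (hu : ∀ h, AEStronglyMeasurable (fun x => inner ℝ (u x) h) μ) : AEStronglyMeasurable u μ := by
  let d := TopologicalSpace.denseSeq H
  let U : ℕ → Submodule ℝ H := fun n => Submodule.span ℝ (d '' Iio n)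
  have hfin : ∀ n, FiniteDimensional ℝ (U n) := fun n =>
    FiniteDimensional.span_of_finite ℝ ((finite_Iio n).image d)
  have hmono : Monotone U := fun m n hmn =>
    Submodule.span_mono (image_mono (Iio_subset_Iio hmn))
  have htop : ⊤ ≤ (⨆ n, U n).topologicalClosure := fun x _ => by
    refine closure_mono ?_ (TopologicalSpace.denseRange_denseSeq H x)
    rintro _ ⟨n, rfl⟩
    exact Submodule.mem_iSup_of_mem (n + 1) (Submodule.subset_span ⟨n, by simp, rfl⟩)
  -- Projections on an exhausting sequence of finite dimensional subspaces converge pointwise, and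
  -- their coordinates are the scalar functions assumed measurable.
  refine aestronglyMeasurable_of_tendsto_ae atTop
    (f := fun n x => (U n).starProjection (u x)) (fun n => ?_)
    (Eventually.of_forall fun x => Submodule.starProjection_tendsto_self U hmono (u x) htop)
  let b := stdOrthonormalBasis ℝ (U n)
  have : (fun x => (U n).starProjection (u x)) =
      fun x => ∑ i, inner ℝ (u x) (b i : H) • (b i : H) := by
    funext x
    rw [b.starProjection_eq_sum_rankOne]
    simp only [sum_apply, InnerProductSpace.rankOne_apply, real_inner_comm]
  rw [this]
  exact Finset.aestronglyMeasurable_fun_sum _ fun i _ => (hu _).smul_const _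

theorem ENNReal.add_le_liminf_add {a b : ℝ≥0∞} {x y : ℕ → ℝ≥0∞} (ha : a ≤ liminf x atTop)
    (hb : b ≤ liminf y atTop) : a + b ≤ liminf (fun n => x n + y n) atTop := by
  refine (add_le_add ha hb).trans ?_
  rw [liminf_eq_iSup_iInf_of_nat, liminf_eq_iSup_iInf_of_nat, liminf_eq_iSup_iInf_of_nat,
    ENNReal.iSup_add_iSup_of_monotone]
  · refine iSup_mono fun n => le_iInf₂ fun i hi => ?_
    exact add_le_add (iInf₂_le i hi) (iInf₂_le i hi)
  · exact fun m n hmn => le_iInf₂ fun i hi => iInf₂_le i (hmn.trans hi)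
  · exact fun m n hmn => le_iInf₂ fun i hi => iInf₂_le i (hmn.trans hi)

theorem ENNReal.mul_le_liminf_mul {a c : ℝ≥0∞} {x : ℕ → ℝ≥0∞}
    (ha : a ≤ liminf x atTop) : c * a ≤ liminf (fun n => c * x n) atTop := by
  refine (mul_le_mul_right ha c).trans ?_
  rw [liminf_eq_iSup_iInf_of_nat, liminf_eq_iSup_iInf_of_nat, ENNReal.mul_iSup]
  refine iSup_mono fun n => le_iInf₂ fun i hi => mul_le_mul_right (iInf₂_le i hi) c

/-- Weak convergence of a sequence in a Hilbert space. -/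
def WeakTendsto {H : Type*} [NormedAddCommGroup H] [InnerProductSpace ℝ H] (v : ℕ → H) (u : H) :
    Prop :=
  ∀ h, Tendsto (fun n => inner ℝ (v n) h) atTop (𝓝 (inner ℝ u h))

theorem WeakTendsto.norm_le {H : Type*} [NormedAddCommGroup H] [InnerProductSpace ℝ H]
    {v : ℕ → H} {u : H} (h : WeakTendsto v u) {ρ : ℝ} (hv : ∀ n, ‖v n‖ ≤ ρ) : ‖u‖ ≤ ρ := by
  have h1 : inner ℝ u u ≤ ρ * ‖u‖ := le_of_tendsto (h u) (Eventually.of_forall fun n =>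
    (real_inner_le_norm _ _).trans (by gcongr; exact hv n))
  rw [real_inner_self_eq_norm_sq] at h1
  by_contra! hlt
  have : 0 ≤ ρ := (norm_nonneg _).trans (hv 0)
  nlinarith

/-- From `‖v‖² ≥ 2⟪v, u⟫ - ‖u‖²`, whose right-hand side tends to `‖u‖²` along the sequence. -/
theorem WeakTendsto.enorm_sq_le_liminf {H : Type*} [NormedAddCommGroup H] [InnerProductSpace ℝ H]
    {v : ℕ → H} {u : H} (h : WeakTendsto v u) :
    ENNReal.ofReal (‖u‖ ^ 2) ≤ liminf (fun n => ENNReal.ofReal (‖v n‖ ^ 2)) atTop := by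
  have h1 : Tendsto (fun n => ENNReal.ofReal (2 * inner ℝ (v n) u - ‖u‖ ^ 2)) atTop
      (𝓝 (ENNReal.ofReal (2 * inner ℝ u u - ‖u‖ ^ 2))) :=
    ENNReal.tendsto_ofReal (((h u).const_mul 2).sub_const _)
  rw [real_inner_self_eq_norm_sq, two_mul, add_sub_cancel_right] at h1
  rw [← h1.liminf_eq]
  refine liminf_le_liminf (Eventually.of_forall fun n => ENNReal.ofReal_le_ofReal ?_)
  have := sq_nonneg ‖v n - u‖
  have e := norm_sub_sq_real (v n) u
  linarith [sq_nonneg ‖v n - u‖]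

end Preliminaries

/-! ### Extraction of a subsequence converging weakly at every time -/

namespace EnergyModel

open Filter Topology

variable {H D : Type*} [NormedAddCommGroup H] [InnerProductSpace ℝ H]
    [NormedAddCommGroup D] [NormedSpace ℝ D] (𝓜 : EnergyModel H D)

/-- A sequence of Galerkin approximations for the test vectors `d k`; the `n`-th one is a solution
on `[0, n]` when tested with `d k`, `k < n`. -/
structure IsGalerkinSeq (ν β : ℝ) (f u₀ : H) (ρ : ℝ) (d : ℕ → D) (c : ℕ → ℝ → D) : Prop where
  continuous : ∀ n, Continuous (c n)
  norm_le : ∀ n t, ‖𝓜.ι (c n t)‖ ≤ ρ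
  norm_zero_le : ∀ n, ‖𝓜.ι (c n 0)‖ ≤ ‖u₀‖
  inner_zero : ∀ k n : ℕ, k < n → inner ℝ (𝓜.ι (c n 0)) (𝓜.ι (d k)) = inner ℝ u₀ (𝓜.ι (d k))
  inner_sub : ∀ k n : ℕ, k < n → ∀ s t : ℝ, 0 ≤ s → s ≤ t → t ≤ n →
    inner ℝ (𝓜.ι (c n t)) (𝓜.ι (d k)) - inner ℝ (𝓜.ι (c n s)) (𝓜.ι (d k)) =
      ∫ r in s..t, 𝓜.rhs ν β f (𝓜.ι (c n r)) (d k)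
  energy : ∀ (n : ℕ) (t : ℝ), 0 ≤ t → t ≤ n → ‖𝓜.ι (c n t)‖ ^ 2 - ‖𝓜.ι (c n 0)‖ ^ 2 =
    ∫ r in (0 : ℝ)..t, 2 * 𝓜.rhs ν β f (𝓜.ι (c n r)) (c n r)

theorem continuous_rhs (ν β : ℝ) (f : H) {X : Type*} [TopologicalSpace X] {u : X → H} {w : X → D}
    (hu : Continuous u) (hw : Continuous w) : Continuous fun x => 𝓜.rhs ν β f (u x) (w x) := by
  unfold rhs
  have h1 : Continuous fun x => 𝓜.M (w x) (u x) := (𝓜.M.continuous.comp hw).clm_apply hu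
  fun_prop

theorem exists_galerkinSeq {ν β : ℝ} (hν : 0 ≤ ν) {f u₀ : H} {ρ : ℝ} (hρ : 0 < ρ)
    (hu₀ : ‖u₀‖ ≤ ρ) (hf : ‖f‖ < β * ρ) (d : ℕ → D) :
    ∃ c, 𝓜.IsGalerkinSeq ν β f u₀ ρ d c := by
  let E : ℕ → Submodule ℝ D := fun n => Submodule.span ℝ (d '' Iio n)
  have hfin : ∀ n, FiniteDimensional ℝ (E n) := fun n =>
    FiniteDimensional.span_of_finite ℝ ((finite_Iio n).image d)
  have hd : ∀ k n, k < n → d k ∈ E n := fun k n hkn => Submodule.subset_span ⟨k, hkn, rfl⟩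
  -- The horizon `n + 1` rather than `n` keeps the interval nondegenerate for `n = 0`.
  choose c hc hcE hb h0n h0 hw he using fun n : ℕ =>
    𝓜.exists_galerkin ν β f hν hρ hu₀ hf (E n) (T := n + 1) (by positivity)
  have ftc : ∀ (n : ℕ) (g g' : ℝ → ℝ), Continuous g' →
      (∀ t ∈ Icc (0 : ℝ) (n + 1), HasDerivWithinAt g (g' t) (Icc 0 (n + 1)) t) →
      ∀ s t : ℝ, 0 ≤ s → s ≤ t → t ≤ n → g t - g s = ∫ r in s..t, g' r := by
    intro n g g' hg' hg s t hs hst ht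
    rw [intervalIntegral.integral_eq_sub_of_hasDerivAt_of_le hst]
    · exact fun x hx => ((hg x ⟨hs.trans hx.1, by linarith [hx.2]⟩).mono
        (Icc_subset_Icc hs (by linarith))).continuousWithinAt
    · exact fun x hx => (hg x ⟨hs.trans hx.1.le, by linarith [hx.2]⟩).hasDerivAt
        (Icc_mem_nhds (by linarith [hx.1]) (by linarith [hx.2]))
    · exact hg'.intervalIntegrable _ _
  refine ⟨c, hc, hb, h0n, fun k n hkn => h0 n _ (hd k n hkn), fun k n hkn s t hs hst ht => ?_,
    fun n t h0t ht => ?_⟩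
  · exact ftc n _ _ (𝓜.continuous_rhs ν β f (𝓜.ι.continuous.comp (hc n)) continuous_const)
      (hw n _ (hd k n hkn)) s t hs hst ht
  · exact ftc n _ _ (continuous_const.mul
      (𝓜.continuous_rhs ν β f (𝓜.ι.continuous.comp (hc n)) (hc n))) (he n) 0 t le_rfl h0t ht

variable {𝓜} {ν β : ℝ} {f u₀ : H} {ρ : ℝ} {d : ℕ → D} {c : ℕ → ℝ → D}

/-- Along a subsequence `n ≤ φ n`, so spaces and time intervals only grow. -/
theorem IsGalerkinSeq.comp (h : 𝓜.IsGalerkinSeq ν β f u₀ ρ d c) {φ : ℕ → ℕ} (hφ : StrictMono φ) :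
    𝓜.IsGalerkinSeq ν β f u₀ ρ d (c ∘ φ) where
  continuous n := h.continuous _
  norm_le n := h.norm_le _
  norm_zero_le n := h.norm_zero_le _
  inner_zero k n hkn := h.inner_zero k _ (hkn.trans_le (hφ.id_le n))
  inner_sub k n hkn s t hs hst ht := h.inner_sub k _ (hkn.trans_le (hφ.id_le n)) s t hs hst
    (ht.trans (by exact_mod_cast hφ.id_le n))
  energy n t h0 ht := h.energy _ t h0 (ht.trans (by exact_mod_cast hφ.id_le n))

theorem IsGalerkinSeq.abs_inner_sub_le (h : 𝓜.IsGalerkinSeq ν β f u₀ ρ d c) {k n : ℕ} (hkn : k < n)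
    {s t : ℝ} (hs : 0 ≤ s) (hst : s ≤ t) (ht : t ≤ n) :
    |inner ℝ (𝓜.ι (c n t)) (𝓜.ι (d k)) - inner ℝ (𝓜.ι (c n s)) (𝓜.ι (d k))| ≤
      𝓜.rhsBound ν β f ρ * ‖d k‖ * (t - s) := by
  rw [h.inner_sub k n hkn s t hs hst ht]
  have := intervalIntegral.norm_integral_le_of_norm_le_const (a := s) (b := t)
    (f := fun r => 𝓜.rhs ν β f (𝓜.ι (c n r)) (d k)) (C := 𝓜.rhsBound ν β f ρ * ‖d k‖)
    (fun r _ => 𝓜.abs_rhs_le ν β f (h.norm_le n r) _)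
  rwa [Real.norm_eq_abs, abs_of_nonneg (sub_nonneg.2 hst)] at this

/-- Convergence is obtained for countably many pairs (test vector, rational time), then extended by
equicontinuity in time, by density of the test vectors in the closure of the range of `ι`, and to
all of `H` by projecting on that closure. -/
theorem IsGalerkinSeq.exists_weakTendsto [CompleteSpace H]
    (h : 𝓜.IsGalerkinSeq ν β f u₀ ρ d c) (hd : DenseRange d) :
    ∃ φ : ℕ → ℕ, StrictMono φ ∧ ∃ u : ℝ → H,
      ∀ t, 0 ≤ t → WeakTendsto (fun n => 𝓜.ι (c (φ n) t)) (u t) := by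
  have hρ : 0 ≤ ρ := (norm_nonneg _).trans (h.norm_le 0 0)
  -- A countable product of compact intervals is sequentially compact; this replaces a diagonal
  -- extraction.
  obtain ⟨x, -, φ, hφ, hx⟩ := IsCompact.tendsto_subseq
    (s := univ.pi fun p : ℕ × ℚ => Icc (-(ρ * ‖𝓜.ι (d p.1)‖)) (ρ * ‖𝓜.ι (d p.1)‖))
    (x := fun n p => inner ℝ (𝓜.ι (c n p.2)) (𝓜.ι (d p.1)))
    (isCompact_univ_pi fun p => isCompact_Icc) (fun n p _ => by
      rw [mem_Icc, ← abs_le]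
      exact (abs_real_inner_le_norm _ _).trans (by gcongr; exact h.norm_le n _))
  rw [tendsto_pi_nhds] at hx
  have h' := h.comp hφ
  refine ⟨φ, hφ, ?_⟩
  have step_time : ∀ k t, 0 ≤ t →
      CauchySeq fun n => inner ℝ (𝓜.ι (c (φ n) t)) (𝓜.ι (d k)) := by
    intro k t ht
    refine cauchySeq_of_forall_approx fun ε hε => ?_
    set C := 𝓜.rhsBound ν β f ρ * ‖d k‖ with hC
    have hC0 : 0 ≤ C := mul_nonneg (𝓜.rhsBound_nonneg ν β f hρ) (norm_nonneg _)
    -- A rational time so close to `t` that the Lipschitz bound `C` costs at most `ε`; the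
    -- denominator `C + 1` covers `C = 0`.
    obtain ⟨r, hr1, hr2⟩ := exists_rat_btwn (show t < t + ε / (C + 1) by
      have : 0 < ε / (C + 1) := by positivity
      linarith)
    refine ⟨_, (hx (k, r)).cauchySeq, ?_⟩
    filter_upwards [eventually_gt_atTop k, eventually_ge_atTop ⌈(r : ℝ)⌉₊] with n hn hn'
    have := h'.abs_inner_sub_le hn ht hr1.le (Nat.ceil_le.1 hn')
    rw [abs_sub_comm] at this
    refine this.trans ?_
    rw [← hC]
    have h2 : (r : ℝ) - t ≤ ε / (C + 1) := by linarith
    calc C * (r - t) ≤ C * (ε / (C + 1)) := by gcongr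
      _ ≤ (C + 1) * (ε / (C + 1)) := by gcongr; linarith
      _ = ε := by field_simp
  let K : Submodule ℝ H := (LinearMap.range (𝓜.ι : D →ₗ[ℝ] H)).topologicalClosure
  have hK : ∀ w, 𝓜.ι w ∈ K := fun w => Submodule.le_topologicalClosure _ ⟨w, rfl⟩
  have hKd : ∀ h ∈ K, h ∈ closure (range fun k => 𝓜.ι (d k)) := by
    intro h hh
    have h1 : closure (range 𝓜.ι) ⊆ closure (𝓜.ι '' range d) :=
      closure_minimal (𝓜.ι.continuous.range_subset_closure_image_dense hd) isClosed_closure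
    rw [← range_comp] at h1
    exact h1 hh
  have step_K : ∀ t, 0 ≤ t → ∀ y ∈ K, CauchySeq fun n => inner ℝ (𝓜.ι (c (φ n) t)) y := by
    intro t ht y hy
    refine cauchySeq_of_forall_approx fun ε hε => ?_
    obtain ⟨_, ⟨k, rfl⟩, hk⟩ := Metric.mem_closure_iff.1 (hKd y hy) (ε / (ρ + 1)) (by positivity)
    refine ⟨_, step_time k t ht, Eventually.of_forall fun n => ?_⟩
    rw [← inner_sub_right]
    rw [dist_eq_norm] at hk
    calc _ ≤ ‖𝓜.ι (c (φ n) t)‖ * ‖y - 𝓜.ι (d k)‖ := abs_real_inner_le_norm _ _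
      _ ≤ (ρ + 1) * (ε / (ρ + 1)) := by gcongr; linarith [h.norm_le (φ n) t]
      _ = ε := by field_simp
  have step_H : ∀ t, 0 ≤ t → ∀ y, CauchySeq fun n => inner ℝ (𝓜.ι (c (φ n) t)) y := by
    intro t ht y
    -- The approximations lie in `K`, so the pairing only sees the projection of `y`.
    have := step_K t ht (K.starProjection y) (K.starProjection_apply_mem y)
    simpa [← Submodule.inner_starProjection_left_eq_right, K.starProjection_eq_self_iff.2 (hK _)]
      using this
  have hlim : ∀ t, ∃ x : H, 0 ≤ t → WeakTendsto (fun n => 𝓜.ι (c (φ n) t)) x := by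
    intro t
    by_cases ht : 0 ≤ t
    · choose l hl using fun y => cauchySeq_tendsto_of_complete (step_H t ht y)
      -- The pointwise limit of the functionals is bounded by Banach–Steinhaus, and the weak limit
      -- is its Riesz representative.
      let L : H →L[ℝ] ℝ := continuousLinearMapOfTendsto (l := atTop)
        (fun n => innerSL ℝ (𝓜.ι (c (φ n) t))) (f := l) (tendsto_pi_nhds.2 hl)
      refine ⟨(InnerProductSpace.toDual ℝ H).symm L, fun _ y => ?_⟩
      rw [InnerProductSpace.toDual_symm_apply]
      exact hl y
    · exact ⟨0, fun h => absurd h ht⟩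
  choose u hu using hlim
  exact ⟨u, hu⟩

/-- A closed subspace is weakly closed, being its own double orthogonal. -/
theorem mem_closure_of_weakTendsto [CompleteSpace H] {v : ℕ → D} {u : H}
    (h : WeakTendsto (fun n => 𝓜.ι (v n)) u) :
    u ∈ (LinearMap.range (𝓜.ι : D →ₗ[ℝ] H)).topologicalClosure := by
  rw [← Submodule.orthogonal_orthogonal_eq_closure, Submodule.mem_orthogonal]
  intro y hy
  rw [real_inner_comm]
  refine tendsto_nhds_unique (h y) ?_
  simp only [(Submodule.mem_orthogonal _ y).1 hy (𝓜.ι _) ⟨_, rfl⟩, tendsto_const_nhds]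

end EnergyModel
end

noncomputable section

/-! ### Energy balance of the approximations and first properties of the limit -/

namespace EnergyModel

open Filter Topology

variable {H D : Type*} [NormedAddCommGroup H] [InnerProductSpace ℝ H]
    [NormedAddCommGroup D] [NormedSpace ℝ D] {𝓜 : EnergyModel H D}
    {ν β : ℝ} {f u₀ : H} {ρ : ℝ} {d : ℕ → D} {c : ℕ → ℝ → D} {u : ℝ → H}

theorem lintegral_ofReal_Icc {g : ℝ → ℝ} (hg : Continuous g) (h0 : ∀ r, 0 ≤ g r) {t : ℝ}
    (ht : 0 ≤ t) :
    ∫⁻ r in Icc 0 t, ENNReal.ofReal (g r) = ENNReal.ofReal (∫ r in (0 : ℝ)..t, g r) := by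
  rw [intervalIntegral.integral_of_le ht, ← integral_Icc_eq_integral_Ioc,
    ofReal_integral_eq_lintegral_ofReal hg.continuousOn.integrableOn_Icc
      (Eventually.of_forall h0)]

/-- Stated in `ℝ≥0∞` with all nonnegative terms on one side, so that lower limits can later be taken
term by term without discussing finiteness. -/
theorem IsGalerkinSeq.energy_eq (h : 𝓜.IsGalerkinSeq ν β f u₀ ρ d c) (hν : 0 ≤ ν) (hβ : 0 ≤ β)
    (n : ℕ) {t : ℝ} (h0 : 0 ≤ t) (ht : t ≤ n) :
    ENNReal.ofReal (‖𝓜.ι (c n t)‖ ^ 2) +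
      ENNReal.ofReal (2 * ν) * (∫⁻ r in Icc 0 t, 𝓜.q (𝓜.ι (c n r))) +
      ENNReal.ofReal (2 * β) * ∫⁻ r in Icc 0 t, ENNReal.ofReal (‖𝓜.ι (c n r)‖ ^ 2) =
    ENNReal.ofReal (‖𝓜.ι (c n 0)‖ ^ 2 + 2 * ∫ r in (0 : ℝ)..t, inner ℝ f (𝓜.ι (c n r))) := by
  have hc := h.continuous n
  have hv : Continuous fun r => 𝓜.ι (c n r) := 𝓜.ι.continuous.comp hc
  have ha : Continuous fun r => inner ℝ (𝓜.ι (c n r)) (𝓜.A (c n r)) :=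
    hv.inner (𝓜.A.continuous.comp hc)
  have hb : Continuous fun r => ‖𝓜.ι (c n r)‖ ^ 2 := hv.norm.pow 2
  have hg : Continuous fun r => inner ℝ f (𝓜.ι (c n r)) := continuous_const.inner hv
  simp only [𝓜.q_ι]
  rw [lintegral_ofReal_Icc ha (fun r => 𝓜.inner_A_nonneg _) h0,
    lintegral_ofReal_Icc hb (fun r => by positivity) h0, ← ENNReal.ofReal_mul (by positivity),
    ← ENNReal.ofReal_mul (by positivity), ← ENNReal.ofReal_add, ← ENNReal.ofReal_add]
  · congr 1
    have he := h.energy n t h0 ht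
    have : ∫ r in (0 : ℝ)..t, 2 * 𝓜.rhs ν β f (𝓜.ι (c n r)) (c n r) =
        -(2 * ν * ∫ r in (0 : ℝ)..t, inner ℝ (𝓜.ι (c n r)) (𝓜.A (c n r))) +
          2 * (∫ r in (0 : ℝ)..t, inner ℝ f (𝓜.ι (c n r))) -
          2 * β * ∫ r in (0 : ℝ)..t, ‖𝓜.ι (c n r)‖ ^ 2 := by
      simp only [rhs_self]
      rw [← intervalIntegral.integral_const_mul, ← intervalIntegral.integral_const_mul,
        ← intervalIntegral.integral_const_mul, ← intervalIntegral.integral_neg,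
        ← intervalIntegral.integral_add, ← intervalIntegral.integral_sub]
      · exact intervalIntegral.integral_congr fun r _ => by ring
      all_goals exact Continuous.intervalIntegrable (by fun_prop) _ _
    linarith
  · have := intervalIntegral.integral_nonneg (μ := volume) h0
      (fun r _ => 𝓜.inner_A_nonneg (c n r))
    positivity
  · have := intervalIntegral.integral_nonneg (μ := volume) h0
      (fun r _ => sq_nonneg ‖𝓜.ι (c n r)‖)
    positivity
  · positivity
  · have := intervalIntegral.integral_nonneg (μ := volume) h0
      (fun r _ => 𝓜.inner_A_nonneg (c n r))
    positivity

/-- The bound on the dissipation does not depend on `n`; it makes the smoothing error in the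
nonlinear term uniform. -/
theorem IsGalerkinSeq.lintegral_q_le (h : 𝓜.IsGalerkinSeq ν β f u₀ ρ d c) (hν : 0 < ν)
    (hβ : 0 ≤ β) (n : ℕ) {t : ℝ} (h0 : 0 ≤ t) (ht : t ≤ n) :
    ENNReal.ofReal (2 * ν) * ∫⁻ r in Icc 0 t, 𝓜.q (𝓜.ι (c n r)) ≤
      ENNReal.ofReal (ρ ^ 2 + 2 * (‖f‖ * ρ * t)) := by
  have h1 := h.energy_eq hν.le hβ n h0 ht
  refine le_trans (le_trans (by rw [add_assoc, add_left_comm]; exact le_self_add) h1.le)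
    (ENNReal.ofReal_le_ofReal ?_)
  have h2 : ‖∫ r in (0 : ℝ)..t, inner ℝ f (𝓜.ι (c n r))‖ ≤ ‖f‖ * ρ * |t - 0| :=
    intervalIntegral.norm_integral_le_of_norm_le_const fun r _ =>
      (abs_real_inner_le_norm _ _).trans (by gcongr; exact h.norm_le n r)
  rw [sub_zero, abs_of_nonneg h0] at h2
  have h3 := (le_abs_self _).trans h2
  have h4 : ‖𝓜.ι (c n 0)‖ ^ 2 ≤ ρ ^ 2 := by gcongr; exact h.norm_le n 0
  linarith

section Limit

theorem IsGalerkinSeq.limit_norm_le (h : 𝓜.IsGalerkinSeq ν β f u₀ ρ d c)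
    (hu : ∀ t, 0 ≤ t → WeakTendsto (fun n => 𝓜.ι (c n t)) (u t)) {t : ℝ} (ht : 0 ≤ t) : ‖u t‖ ≤ ρ :=
  (hu t ht).norm_le fun n => h.norm_le n t

theorem IsGalerkinSeq.limit_abs_inner_sub_le (h : 𝓜.IsGalerkinSeq ν β f u₀ ρ d c)
    (hu : ∀ t, 0 ≤ t → WeakTendsto (fun n => 𝓜.ι (c n t)) (u t)) (k : ℕ) {s t : ℝ} (hs : 0 ≤ s) (hst : s ≤ t) :
    |inner ℝ (u t) (𝓜.ι (d k)) - inner ℝ (u s) (𝓜.ι (d k))| ≤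
      𝓜.rhsBound ν β f ρ * ‖d k‖ * (t - s) := by
  refine le_of_tendsto ((hu t (hs.trans hst) _).sub (hu s hs _)).abs ?_
  filter_upwards [eventually_gt_atTop k, eventually_ge_atTop ⌈t⌉₊] with n hn hn'
  exact h.abs_inner_sub_le hn hs hst (Nat.ceil_le.1 hn')

theorem closure_range_ι_subset (𝓜 : EnergyModel H D) (hd : DenseRange d) :
    closure (range 𝓜.ι) ⊆ closure (range fun k => 𝓜.ι (d k)) := by
  have h1 : closure (range 𝓜.ι) ⊆ closure (𝓜.ι '' range d) :=
    closure_minimal (𝓜.ι.continuous.range_subset_closure_image_dense hd) isClosed_closure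
  rwa [← range_comp] at h1

theorem IsGalerkinSeq.limit_integral_inner (h : 𝓜.IsGalerkinSeq ν β f u₀ ρ d c)
    (hu : ∀ t, 0 ≤ t → WeakTendsto (fun n => 𝓜.ι (c n t)) (u t)) (y : H) {t : ℝ}
    (ht : 0 ≤ t) : Tendsto (fun n => ∫ r in (0 : ℝ)..t, inner ℝ y (𝓜.ι (c n r))) atTop
      (𝓝 (∫ r in (0 : ℝ)..t, inner ℝ y (u r))) := by
  refine intervalIntegral.tendsto_integral_filter_of_dominated_convergence (fun _ => ‖y‖ * ρ)
    (Eventually.of_forall fun n => ?_) (Eventually.of_forall fun n => ?_)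
    intervalIntegrable_const ?_
  · exact (continuous_const.inner (𝓜.ι.continuous.comp (h.continuous n))).aestronglyMeasurable
  · exact Eventually.of_forall fun r _ =>
      (abs_real_inner_le_norm _ _).trans (by gcongr; exact h.norm_le n r)
  · refine Eventually.of_forall fun r hr => ?_
    rw [uIoc_of_le ht] at hr
    simpa only [real_inner_comm] using hu r hr.1.le y

/-- The right-hand side converges, being linear in the state. Each term on the left passes to the
lower limit by weak lower semicontinuity, combined with Fatou's lemma for the time integrals. -/
theorem IsGalerkinSeq.limit_energy (h : 𝓜.IsGalerkinSeq ν β f u₀ ρ d c)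
    (hu : ∀ t, 0 ≤ t → WeakTendsto (fun n => 𝓜.ι (c n t)) (u t)) (hν : 0 ≤ ν) (hβ : 0 ≤ β)
    {t : ℝ} (ht : 0 ≤ t) :
    ENNReal.ofReal (‖u t‖ ^ 2) + ENNReal.ofReal (2 * ν) * (∫⁻ r in Icc 0 t, 𝓜.q (u r)) +
      ENNReal.ofReal (2 * β) * ∫⁻ r in Icc 0 t, ENNReal.ofReal (‖u r‖ ^ 2) ≤
    ENNReal.ofReal (‖u₀‖ ^ 2 + 2 * ∫ r in (0 : ℝ)..t, inner ℝ f (u r)) := by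
  have hR : Tendsto (fun n => ENNReal.ofReal
      (‖u₀‖ ^ 2 + 2 * ∫ r in (0 : ℝ)..t, inner ℝ f (𝓜.ι (c n r)))) atTop
      (𝓝 (ENNReal.ofReal (‖u₀‖ ^ 2 + 2 * ∫ r in (0 : ℝ)..t, inner ℝ f (u r)))) :=
    ENNReal.tendsto_ofReal (((h.limit_integral_inner hu f ht).const_mul 2).const_add _)
  have hq : ∫⁻ r in Icc 0 t, 𝓜.q (u r) ≤
      liminf (fun n => ∫⁻ r in Icc 0 t, 𝓜.q (𝓜.ι (c n r))) atTop := by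
    refine le_trans ?_ (lintegral_liminf_le' fun n => ?_)
    · exact setLIntegral_mono' measurableSet_Icc fun r hr => 𝓜.q_le_liminf _ _ (hu r hr.1)
    · simp only [𝓜.q_ι]
      exact ((𝓜.ι.continuous.comp (h.continuous n)).inner
        (𝓜.A.continuous.comp (h.continuous n))).measurable.ennreal_ofReal.aemeasurable
  have hb : ∫⁻ r in Icc 0 t, ENNReal.ofReal (‖u r‖ ^ 2) ≤
      liminf (fun n => ∫⁻ r in Icc 0 t, ENNReal.ofReal (‖𝓜.ι (c n r)‖ ^ 2)) atTop := by
    refine le_trans ?_ (lintegral_liminf_le' fun n => ?_)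
    · exact setLIntegral_mono' measurableSet_Icc fun r hr => (hu r hr.1).enorm_sq_le_liminf
    · exact ((𝓜.ι.continuous.comp (h.continuous n)).norm.pow
        2).measurable.ennreal_ofReal.aemeasurable
  refine (ENNReal.add_le_liminf_add (ENNReal.add_le_liminf_add (hu t ht).enorm_sq_le_liminf
    (ENNReal.mul_le_liminf_mul hq)) (ENNReal.mul_le_liminf_mul hb)).trans ?_
  rw [← hR.liminf_eq]
  refine liminf_le_liminf ?_
  filter_upwards [eventually_ge_atTop ⌈t⌉₊] with n hn
  rw [h.energy_eq hν hβ n ht (Nat.ceil_le.1 hn)]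
  refine ENNReal.ofReal_le_ofReal ?_
  gcongr
  exact h.norm_zero_le n

variable [CompleteSpace H]

/-- The limit is Lipschitz in time against each `d k`. Boundedness of `u` makes the approximation of
other vectors of `K` uniform in time, and `u` takes its values in `K`. -/
theorem IsGalerkinSeq.limit_weakContinuous (h : 𝓜.IsGalerkinSeq ν β f u₀ ρ d c)
    (hu : ∀ t, 0 ≤ t → WeakTendsto (fun n => 𝓜.ι (c n t)) (u t)) (hd : DenseRange d) (y : H) :
    ContinuousOn (fun t => inner ℝ (u t) y) (Ici 0) := by
  have hρ : 0 ≤ ρ := (norm_nonneg _).trans (h.norm_le 0 0)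
  let K : Submodule ℝ H := (LinearMap.range (𝓜.ι : D →ₗ[ℝ] H)).topologicalClosure
  have hk : ∀ k, ContinuousOn (fun t => inner ℝ (u t) (𝓜.ι (d k))) (Ici 0) := by
    intro k
    have hC : 0 ≤ 𝓜.rhsBound ν β f ρ * ‖d k‖ :=
      mul_nonneg (𝓜.rhsBound_nonneg ν β f hρ) (norm_nonneg _)
    refine (LipschitzOnWith.of_dist_le_mul (K := ⟨_, hC⟩) fun t ht s hs => ?_).continuousOn
    rw [Real.dist_eq, Real.dist_eq]
    rcases le_total s t with hst | hst
    · rw [abs_of_nonneg (sub_nonneg.2 hst)]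
      exact h.limit_abs_inner_sub_le hu k hs hst
    · rw [abs_sub_comm, abs_sub_comm t s, abs_of_nonneg (sub_nonneg.2 hst)]
      exact h.limit_abs_inner_sub_le hu k ht hst
  have hKc : ∀ y ∈ K, ContinuousOn (fun t => inner ℝ (u t) y) (Ici 0) := by
    intro y hy
    refine continuousOn_of_uniform_approx_of_continuousOn fun V hV => ?_
    obtain ⟨ε, hε, hεV⟩ := Metric.mem_uniformity_dist.1 hV
    obtain ⟨_, ⟨k, rfl⟩, hky⟩ := Metric.mem_closure_iff.1
      (closure_range_ι_subset 𝓜 hd hy) (ε / (ρ + 1)) (by positivity)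
    refine ⟨_, hk k, fun t ht => hεV ?_⟩
    rw [Real.dist_eq, ← inner_sub_right]
    rw [dist_eq_norm] at hky
    calc _ ≤ ‖u t‖ * ‖y - 𝓜.ι (d k)‖ := abs_real_inner_le_norm _ _
      _ ≤ ρ * ‖y - 𝓜.ι (d k)‖ := by gcongr; exact h.limit_norm_le hu ht
      _ ≤ (ρ + 1) * ‖y - 𝓜.ι (d k)‖ := by gcongr; linarith
      _ < (ρ + 1) * (ε / (ρ + 1)) := by gcongr
      _ = ε := by field_simp
  refine (hKc (K.starProjection y) (K.starProjection_apply_mem y)).congr fun t ht => ?_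
  beta_reduce
  rw [← Submodule.inner_starProjection_left_eq_right,
    K.starProjection_eq_self_iff.2 (mem_closure_of_weakTendsto (hu t ht))]

theorem IsGalerkinSeq.limit_aestronglyMeasurable (h : 𝓜.IsGalerkinSeq ν β f u₀ ρ d c)
    (hu : ∀ t, 0 ≤ t → WeakTendsto (fun n => 𝓜.ι (c n t)) (u t)) [TopologicalSpace.SeparableSpace H]
    (hd : DenseRange d) : AEStronglyMeasurable u (volume.restrict (Ici 0)) :=
  aestronglyMeasurable_of_inner fun y =>
    (h.limit_weakContinuous hu hd y).aestronglyMeasurable measurableSet_Ici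

/-- The approximations see the datum only through the test vectors. This determines it, since both
`u 0` and `u₀` lie in the closure of their span. -/
theorem IsGalerkinSeq.limit_zero (h : 𝓜.IsGalerkinSeq ν β f u₀ ρ d c)
    (hu : ∀ t, 0 ≤ t → WeakTendsto (fun n => 𝓜.ι (c n t)) (u t)) (hd : DenseRange d)
    (hu₀ : u₀ ∈ closure (range 𝓜.ι)) : u 0 = u₀ := by
  have hk : ∀ k, inner ℝ (u 0 - u₀) (𝓜.ι (d k)) = 0 := by
    intro k
    rw [inner_sub_left, sub_eq_zero]
    refine tendsto_nhds_unique (hu 0 le_rfl _) (tendsto_const_nhds.congr' ?_)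
    filter_upwards [eventually_gt_atTop k] with n hn
    exact (h.inner_zero k n hn).symm
  have hmem : u 0 - u₀ ∈ closure (range fun k => 𝓜.ι (d k)) :=
    closure_range_ι_subset 𝓜 hd (Submodule.sub_mem
      (LinearMap.range (𝓜.ι : D →ₗ[ℝ] H)).topologicalClosure
      (mem_closure_of_weakTendsto (hu 0 le_rfl)) hu₀)
  have : inner ℝ (u 0 - u₀) (u 0 - u₀) = 0 := by
    have hcl : IsClosed {y | inner ℝ (u 0 - u₀) y = 0} :=
      isClosed_eq (continuous_const.inner continuous_id) continuous_const
    exact closure_minimal (by rintro _ ⟨k, rfl⟩; exact hk k) hcl hmem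
  rw [inner_self_eq_zero, sub_eq_zero] at this
  exact this

end Limit

end EnergyModel
end

noncomputable section

/-! ### Passage to the limit in the nonlinear term -/

namespace EnergyModel

open Filter Topology

variable {H D : Type*} [NormedAddCommGroup H] [InnerProductSpace ℝ H]
    [NormedAddCommGroup D] [NormedSpace ℝ D] {𝓜 : EnergyModel H D}
    {ν β : ℝ} {f u₀ : H} {ρ : ℝ} {d : ℕ → D} {c : ℕ → ℝ → D} {u : ℝ → H}

/-- The right hand side with a smoothed argument in the nonlinear term. -/
def rhsS (𝓜 : EnergyModel H D) (ν β : ℝ) (f : H) (R : ℕ) (u : H) (w : D) : ℝ :=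
  -ν * inner ℝ u (𝓜.A w) + inner ℝ u (𝓜.M w (𝓜.S R u)) + inner ℝ f (𝓜.ι w)
    - β * inner ℝ u (𝓜.ι w)

theorem rhs_sub_rhsS (R : ℕ) (u : H) (w : D) :
    𝓜.rhs ν β f u w - 𝓜.rhsS ν β f R u w = inner ℝ u (𝓜.M w (u - 𝓜.S R u)) := by
  simp only [rhs, rhsS, map_sub, inner_sub_right]; ring

/-- The natural factor `√(q u)` is replaced by the cruder `1 + q u`, which is already known to be
integrable in time. -/
theorem enorm_sub_S_le (R : ℕ) (u : H) :
    ‖u - 𝓜.S R u‖ₑ ≤ ENNReal.ofReal √(𝓜.δ R) * (1 + 𝓜.q u) := by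
  rw [← ENNReal.pow_le_pow_left_iff two_ne_zero, mul_pow, ← ENNReal.ofReal_pow (by positivity),
    Real.sq_sqrt (𝓜.δ_nonneg R), ← ofReal_norm, ← ENNReal.ofReal_pow (by positivity)]
  refine (𝓜.norm_sub_S_le R u).trans ?_
  gcongr
  rw [sq]
  calc 𝓜.q u ≤ 1 + 𝓜.q u := le_add_self
    _ = 1 * (1 + 𝓜.q u) := (one_mul _).symm
    _ ≤ _ := by gcongr; exact le_self_add

theorem enorm_rhs_sub_rhsS_le (R : ℕ) {u : H} (hu : ‖u‖ ≤ ρ) (w : D) :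
    ‖𝓜.rhs ν β f u w - 𝓜.rhsS ν β f R u w‖ₑ ≤
      ENNReal.ofReal (ρ * ‖𝓜.M w‖) * ENNReal.ofReal √(𝓜.δ R) * (1 + 𝓜.q u) := by
  have hρ : 0 ≤ ρ := (norm_nonneg _).trans hu
  rw [rhs_sub_rhsS, mul_assoc]
  refine le_trans ?_ (mul_le_mul_right (𝓜.enorm_sub_S_le R u) _)
  rw [← ofReal_norm, ← ofReal_norm, ← ENNReal.ofReal_mul (by positivity)]
  refine ENNReal.ofReal_le_ofReal ((norm_inner_le_norm _ _).trans ?_)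
  rw [mul_assoc]
  gcongr
  exact (𝓜.M w).le_opNorm _

theorem aestronglyMeasurable_rhs {X : Type*} [MeasurableSpace X] {μ : Measure X} {x : X → H}
    (hx : AEStronglyMeasurable x μ) {w : X → D} (hw : AEStronglyMeasurable w μ) :
    AEStronglyMeasurable (fun r => 𝓜.rhs ν β f (x r) (w r)) μ :=
  (𝓜.continuous_rhs ν β f continuous_fst continuous_snd).comp_aestronglyMeasurable (hx.prodMk hw)

theorem continuous_rhsS (R : ℕ) (w : D) : Continuous fun x => 𝓜.rhsS ν β f R x w := by
  unfold rhsS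
  have h1 : Continuous fun x => 𝓜.M w (𝓜.S R x) :=
    (𝓜.M w).continuous.comp (𝓜.S R).continuous
  fun_prop

theorem abs_rhsS_le (R : ℕ) {x : H} (hx : ‖x‖ ≤ ρ) (w : D) : |𝓜.rhsS ν β f R x w| ≤
    |ν| * (ρ * ‖𝓜.A w‖) + ρ * (‖𝓜.M w‖ * (‖𝓜.S R‖ * ρ)) + ‖f‖ * ‖𝓜.ι w‖ +
      |β| * (ρ * ‖𝓜.ι w‖) := by
  have hρ : 0 ≤ ρ := (norm_nonneg x).trans hx
  have h1 : |inner ℝ x (𝓜.A w)| ≤ ρ * ‖𝓜.A w‖ :=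
    (abs_real_inner_le_norm _ _).trans (by gcongr)
  have h2 : |inner ℝ x (𝓜.M w (𝓜.S R x))| ≤ ρ * (‖𝓜.M w‖ * (‖𝓜.S R‖ * ρ)) :=
    (abs_real_inner_le_norm _ _).trans (by
      gcongr
      exact ((𝓜.M w).le_opNorm _).trans
        (by gcongr; exact ((𝓜.S R).le_opNorm x).trans (by gcongr)))
  have h4 : |inner ℝ x (𝓜.ι w)| ≤ ρ * ‖𝓜.ι w‖ :=
    (abs_real_inner_le_norm _ _).trans (by gcongr)
  unfold rhsS
  refine (abs_sub _ _).trans ?_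
  refine add_le_add ((abs_add_three _ _ _).trans ?_) ?_
  · rw [abs_mul, abs_neg]
    gcongr
    exact abs_real_inner_le_norm _ _
  · rw [abs_mul]; gcongr

theorem integrableOn_of_bound {g : ℝ → ℝ} {s t C : ℝ}
    (hg : AEStronglyMeasurable g (volume.restrict (Ioc s t))) (hC : ∀ r ∈ Ioc s t, |g r| ≤ C) :
    IntegrableOn g (Ioc s t) :=
  IntegrableOn.of_bound measure_Ioc_lt_top hg C
    ((ae_restrict_iff' measurableSet_Ioc).2 (Eventually.of_forall hC))

/-- The smoothing error is controlled by the total dissipation alone, so it is small with `δ R`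
uniformly over a family with bounded dissipation. It is applied to the approximations and to their
limit. -/
theorem enorm_integral_rhs_sub_le (R : ℕ) {x : ℝ → H} {s t : ℝ} (hs : 0 ≤ s) (hst : s ≤ t)
    (hx : AEStronglyMeasurable x (volume.restrict (Ici 0))) (hxρ : ∀ r, 0 ≤ r → ‖x r‖ ≤ ρ)
    (w : D) :
    ‖(∫ r in s..t, 𝓜.rhs ν β f (x r) w) - ∫ r in s..t, 𝓜.rhsS ν β f R (x r) w‖ₑ ≤
      ENNReal.ofReal (ρ * ‖𝓜.M w‖) * ENNReal.ofReal √(𝓜.δ R) *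
        (ENNReal.ofReal t + ∫⁻ r in Icc 0 t, 𝓜.q (x r)) := by
  have hsub : Ioc s t ⊆ Ici 0 := fun r hr => hs.trans hr.1.le
  have hx' := hx.mono_measure (Measure.restrict_mono hsub le_rfl)
  have hpos : ∀ r ∈ Ioc s t, 0 ≤ r := fun r hr => hsub hr
  rw [intervalIntegral.integral_of_le hst, intervalIntegral.integral_of_le hst,
    ← integral_sub]
  · calc _ ≤ ∫⁻ r in Ioc s t, ‖𝓜.rhs ν β f (x r) w - 𝓜.rhsS ν β f R (x r) w‖ₑ :=
          enorm_integral_le_lintegral_enorm _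
      _ ≤ ∫⁻ r in Ioc s t, ENNReal.ofReal (ρ * ‖𝓜.M w‖) * ENNReal.ofReal √(𝓜.δ R) *
            (1 + 𝓜.q (x r)) :=
          setLIntegral_mono' measurableSet_Ioc fun r hr =>
            𝓜.enorm_rhs_sub_rhsS_le R (hxρ r (hpos r hr)) w
      _ ≤ ∫⁻ r in Icc 0 t, ENNReal.ofReal (ρ * ‖𝓜.M w‖) * ENNReal.ofReal √(𝓜.δ R) *
            (1 + 𝓜.q (x r)) :=
          lintegral_mono_set fun r hr => ⟨hpos r hr, hr.2⟩
      _ = _ := by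
          rw [lintegral_const_mul' _ _ (by finiteness), lintegral_add_left measurable_const]
          simp
  · exact integrableOn_of_bound (aestronglyMeasurable_rhs hx' aestronglyMeasurable_const)
      fun r hr => 𝓜.abs_rhs_le ν β f (hxρ r (hpos r hr)) w
  · exact integrableOn_of_bound ((continuous_rhsS R w).comp_aestronglyMeasurable hx')
      fun r hr => abs_rhsS_le R (hxρ r (hpos r hr)) w

theorem WeakTendsto.inner_tendsto {v y : ℕ → H} {u z : H} (hv : WeakTendsto v u)
    (hvρ : ∀ n, ‖v n‖ ≤ ρ) (hy : Tendsto y atTop (𝓝 z)) :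
    Tendsto (fun n => inner ℝ (v n) (y n)) atTop (𝓝 (inner ℝ u z)) := by
  have h1 : Tendsto (fun n => inner ℝ (v n) (y n - z)) atTop (𝓝 0) := by
    refine squeeze_zero_norm (a := fun n => ρ * ‖y n - z‖) (fun n => ?_) ?_
    · exact (norm_inner_le_norm _ _).trans (by gcongr; exact hvρ n)
    · simpa using (tendsto_iff_norm_sub_tendsto_zero.1 hy).const_mul ρ
  have := h1.add (hv z)
  simpa [← inner_add_right] using this

/-- At each time the smoothed nonlinear term is a pairing of a weakly with a strongly convergent
sequence; the uniform bounds then allow dominated convergence in time. -/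
theorem IsGalerkinSeq.tendsto_integral_rhsS (h : 𝓜.IsGalerkinSeq ν β f u₀ ρ d c)
    (hu : ∀ t, 0 ≤ t → WeakTendsto (fun n => 𝓜.ι (c n t)) (u t)) (R : ℕ) (w : D)
    {s t : ℝ} (hs : 0 ≤ s) (hst : s ≤ t) :
    Tendsto (fun n => ∫ r in s..t, 𝓜.rhsS ν β f R (𝓜.ι (c n r)) w) atTop
      (𝓝 (∫ r in s..t, 𝓜.rhsS ν β f R (u r) w)) := by
  refine intervalIntegral.tendsto_integral_filter_of_dominated_convergence (fun _ => _)
    (Eventually.of_forall fun n => ?_) (Eventually.of_forall fun n =>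
      Eventually.of_forall fun r _ => abs_rhsS_le R (h.norm_le n r) w)
    intervalIntegrable_const ?_
  · exact ((continuous_rhsS R w).comp
      (𝓜.ι.continuous.comp (h.continuous n))).aestronglyMeasurable
  · refine Eventually.of_forall fun r hr => ?_
    rw [uIoc_of_le hst] at hr
    have hr0 : 0 ≤ r := hs.trans hr.1.le
    have hw := hu r hr0
    have hM := WeakTendsto.inner_tendsto hw (fun n => h.norm_le n r)
      (𝓜.tendsto_M_S w R _ _ ρ (fun n => h.norm_le n r) hw)
    exact ((((hw _).const_mul _).add hM).add tendsto_const_nhds).sub ((hw _).const_mul _)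

theorem IsGalerkinSeq.limit_lintegral_q_lt_top (h : 𝓜.IsGalerkinSeq ν β f u₀ ρ d c)
    (hu : ∀ t, 0 ≤ t → WeakTendsto (fun n => 𝓜.ι (c n t)) (u t)) (hν : 0 < ν) (hβ : 0 ≤ β)
    {t : ℝ} (ht : 0 ≤ t) : ∫⁻ r in Icc 0 t, 𝓜.q (u r) < ∞ := by
  have h1 := h.limit_energy hu hν.le hβ ht
  have h2 : ENNReal.ofReal (2 * ν) * (∫⁻ r in Icc 0 t, 𝓜.q (u r)) < ∞ :=
    lt_of_le_of_lt (le_trans (by rw [add_assoc, add_left_comm]; exact le_self_add) h1)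
      ENNReal.ofReal_lt_top
  by_contra! htop
  rw [top_le_iff.1 htop, ENNReal.mul_top (by simpa using hν)] at h2
  exact lt_irrefl _ h2

/-- A three-epsilon argument: `R` is fixed first, with an error small for all large `n` and for the
limit, and only then does `n` go to infinity. -/
theorem IsGalerkinSeq.tendsto_integral_rhs [CompleteSpace H] [TopologicalSpace.SeparableSpace H]
    (h : 𝓜.IsGalerkinSeq ν β f u₀ ρ d c) (hd : DenseRange d)
    (hu : ∀ t, 0 ≤ t → WeakTendsto (fun n => 𝓜.ι (c n t)) (u t)) (hν : 0 < ν) (hβ : 0 ≤ β)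
    (w : D) {s t : ℝ} (hs : 0 ≤ s) (hst : s ≤ t) :
    Tendsto (fun n => ∫ r in s..t, 𝓜.rhs ν β f (𝓜.ι (c n r)) w) atTop
      (𝓝 (∫ r in s..t, 𝓜.rhs ν β f (u r) w)) := by
  have ht : 0 ≤ t := hs.trans hst
  -- The dissipation bound of the approximations plus the dissipation of the limit, so that one
  -- error term serves for both.
  set B : ℝ≥0∞ := ENNReal.ofReal (ρ ^ 2 + 2 * (‖f‖ * ρ * t)) / ENNReal.ofReal (2 * ν) +
    ∫⁻ r in Icc 0 t, 𝓜.q (u r) with hB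
  have hν2 : ENNReal.ofReal (2 * ν) ≠ 0 := by simpa using hν
  have hBtop : B ≠ ∞ := ENNReal.add_ne_top.2
    ⟨ENNReal.div_ne_top ENNReal.ofReal_ne_top hν2, (h.limit_lintegral_q_lt_top hu hν hβ ht).ne⟩
  set err : ℕ → ℝ≥0∞ := fun R => ENNReal.ofReal (ρ * ‖𝓜.M w‖) * ENNReal.ofReal √(𝓜.δ R) *
        (ENNReal.ofReal t + B) with herr
  have herr0 : Tendsto err atTop (𝓝 0) := by
    have h1 : Tendsto (fun R => ENNReal.ofReal √(𝓜.δ R)) atTop (𝓝 0) := by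
      have := ENNReal.tendsto_ofReal ((Real.continuous_sqrt.tendsto 0).comp 𝓜.tendsto_δ)
      simpa using this
    have h2 := ENNReal.Tendsto.mul_const (b := ENNReal.ofReal t + B)
      (ENNReal.Tendsto.const_mul (a := ENNReal.ofReal (ρ * ‖𝓜.M w‖)) h1
      (Or.inr ENNReal.ofReal_ne_top)) (Or.inr (by finiteness))
    simpa using h2
  rw [EMetric.tendsto_nhds]
  intro ε hε
  have hε3 : 0 < ε / 3 := ENNReal.div_pos hε.ne' (by finiteness)
  obtain ⟨R, hR⟩ := (herr0.eventually (gt_mem_nhds hε3)).exists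
  have hu_err : ‖(∫ r in s..t, 𝓜.rhs ν β f (u r) w) -
      ∫ r in s..t, 𝓜.rhsS ν β f R (u r) w‖ₑ ≤ err R := by
    refine (enorm_integral_rhs_sub_le R hs hst (h.limit_aestronglyMeasurable hu hd)
      (fun r hr => h.limit_norm_le hu hr) w).trans ?_
    simp only [herr]
    gcongr
    exact le_add_self
  filter_upwards [EMetric.tendsto_nhds.1 (h.tendsto_integral_rhsS hu R w hs hst) _ hε3,
    eventually_ge_atTop ⌈t⌉₊] with n hn hn'
  have hn_err : ‖(∫ r in s..t, 𝓜.rhs ν β f (𝓜.ι (c n r)) w) -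
      ∫ r in s..t, 𝓜.rhsS ν β f R (𝓜.ι (c n r)) w‖ₑ ≤ err R := by
    refine (enorm_integral_rhs_sub_le R hs hst
      (𝓜.ι.continuous.comp (h.continuous n)).aestronglyMeasurable
      (fun r _ => h.norm_le n r) w).trans ?_
    simp only [herr]
    gcongr
    refine le_trans ?_ le_self_add
    rw [ENNReal.le_div_iff_mul_le (Or.inl hν2) (Or.inl ENNReal.ofReal_ne_top), mul_comm]
    exact h.lintegral_q_le hν hβ n ht (Nat.ceil_le.1 hn')
  rw [← edist_eq_enorm_sub] at hn_err hu_err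
  rw [edist_comm] at hu_err
  calc _ ≤ _ := edist_triangle4 _ (∫ r in s..t, 𝓜.rhsS ν β f R (𝓜.ι (c n r)) w)
        (∫ r in s..t, 𝓜.rhsS ν β f R (u r) w) _
    _ < ε / 3 + ε / 3 + ε / 3 := by
        refine ENNReal.add_lt_add (ENNReal.add_lt_add (hn_err.trans_lt hR) hn)
          (hu_err.trans_lt hR)
    _ = ε := ENNReal.add_thirds ε

/-- Weak solutions of the evolution problem, with the energy inequality. -/
structure IsSolution (𝓜 : EnergyModel H D) (ν β : ℝ) (f u₀ : H) (ρ : ℝ) (u : ℝ → H) : Prop where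
  norm_le : ∀ t, 0 ≤ t → ‖u t‖ ≤ ρ
  mem_closure : ∀ t, 0 ≤ t → u t ∈ closure (range 𝓜.ι)
  weakContinuous : ∀ y, ContinuousOn (fun t => inner ℝ (u t) y) (Ici 0)
  aestronglyMeasurable : AEStronglyMeasurable u (volume.restrict (Ici 0))
  zero : u 0 = u₀
  inner_sub : ∀ w s t, 0 ≤ s → s ≤ t → inner ℝ (u t) (𝓜.ι w) - inner ℝ (u s) (𝓜.ι w) =
    ∫ r in s..t, 𝓜.rhs ν β f (u r) w
  energy : ∀ t : ℝ, 0 ≤ t →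
    ENNReal.ofReal (‖u t‖ ^ 2) + ENNReal.ofReal (2 * ν) * (∫⁻ r in Icc 0 t, 𝓜.q (u r)) +
      ENNReal.ofReal (2 * β) * ∫⁻ r in Icc 0 t, ENNReal.ofReal (‖u r‖ ^ 2) ≤
    ENNReal.ofReal (‖u₀‖ ^ 2 + 2 * ∫ r in (0 : ℝ)..t, inner ℝ f (u r))
  lintegral_q_lt_top : ∀ t, 0 ≤ t → ∫⁻ r in Icc 0 t, 𝓜.q (u r) < ∞

/-- The identity passes to the limit for each `d k`, and both sides are continuous in `w`. -/
theorem IsGalerkinSeq.limit_inner_sub [CompleteSpace H] [TopologicalSpace.SeparableSpace H]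
    (h : 𝓜.IsGalerkinSeq ν β f u₀ ρ d c) (hd : DenseRange d)
    (hu : ∀ t, 0 ≤ t → WeakTendsto (fun n => 𝓜.ι (c n t)) (u t)) (hν : 0 < ν) (hβ : 0 ≤ β)
    (w : D) {s t : ℝ} (hs : 0 ≤ s) (hst : s ≤ t) :
    inner ℝ (u t) (𝓜.ι w) - inner ℝ (u s) (𝓜.ι w) = ∫ r in s..t, 𝓜.rhs ν β f (u r) w := by
  have hρ : 0 ≤ ρ := (norm_nonneg _).trans (h.norm_le 0 0)
  have ht : 0 ≤ t := hs.trans hst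
  have hpos : ∀ r ∈ Ioc s t, 0 ≤ r := fun r hr => hs.trans hr.1.le
  have hmeas := (h.limit_aestronglyMeasurable hu hd).mono_measure
    (Measure.restrict_mono (s := Ioc s t) hpos le_rfl)
  have hInt : ∀ w, IntervalIntegrable (fun r => 𝓜.rhs ν β f (u r) w) volume s t := fun w =>
    (intervalIntegrable_iff_integrableOn_Ioc_of_le hst).2 (integrableOn_of_bound
      (aestronglyMeasurable_rhs hmeas aestronglyMeasurable_const)
      fun r hr => 𝓜.abs_rhs_le ν β f (h.limit_norm_le hu (hpos r hr)) w)
  have hcont : Continuous fun w => ∫ r in s..t, 𝓜.rhs ν β f (u r) w := by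
    have hB := mul_nonneg (𝓜.rhsBound_nonneg ν β f hρ) (sub_nonneg.2 hst)
    refine (LipschitzWith.of_dist_le_mul (K := ⟨_, hB⟩) fun w w' => ?_).continuous
    rw [Real.dist_eq, ← intervalIntegral.integral_sub (hInt w) (hInt w'), dist_eq_norm]
    simp only [← rhs_sub]
    have := intervalIntegral.norm_integral_le_of_norm_le_const (a := s) (b := t)
      (f := fun r => 𝓜.rhs ν β f (u r) (w - w')) (C := 𝓜.rhsBound ν β f ρ * ‖w - w'‖)
      (fun r hr => by
        rw [uIoc_of_le hst] at hr
        exact 𝓜.abs_rhs_le ν β f (h.limit_norm_le hu (hpos r hr)) _)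
    rw [abs_of_nonneg (sub_nonneg.2 hst)] at this
    refine this.trans_eq ?_
    change _ = 𝓜.rhsBound ν β f ρ * (t - s) * ‖w - w'‖
    ring
  have hι := 𝓜.ι.continuous
  have hcl : IsClosed {w | inner ℝ (u t) (𝓜.ι w) - inner ℝ (u s) (𝓜.ι w) =
      ∫ r in s..t, 𝓜.rhs ν β f (u r) w} := isClosed_eq (by fun_prop) hcont
  refine hd.induction_on (p := fun w => inner ℝ (u t) (𝓜.ι w) - inner ℝ (u s) (𝓜.ι w) =
      ∫ r in s..t, 𝓜.rhs ν β f (u r) w) w hcl fun k => ?_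
  refine tendsto_nhds_unique ((hu t ht _).sub (hu s hs _))
    ((h.tendsto_integral_rhs hd hu hν hβ (d k) hs hst).congr' ?_)
  filter_upwards [eventually_gt_atTop k, eventually_ge_atTop ⌈t⌉₊] with n hn hn'
  exact (h.inner_sub k n hn s t hs hst (Nat.ceil_le.1 hn')).symm

/-- Existence of global weak solutions with the energy inequality. -/
theorem exists_isSolution [CompleteSpace H] [TopologicalSpace.SeparableSpace H]
    [TopologicalSpace.SeparableSpace D] (𝓜 : EnergyModel H D) (hν : 0 < ν) (hβ : 0 < β)
    (hu₀ : u₀ ∈ closure (range 𝓜.ι)) : ∃ ρ u, 𝓜.IsSolution ν β f u₀ ρ u := by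
  -- The summand `1` makes `ρ` positive and the inequality `‖f‖ < β ρ` strict, as the barrier
  -- argument requires.
  set ρ : ℝ := ‖u₀‖ + ‖f‖ / β + 1
  have hρ : 0 < ρ := by positivity
  have hfρ : ‖f‖ < β * ρ := by
    have : β * ρ = β * ‖u₀‖ + ‖f‖ + β := by simp only [ρ]; field_simp
    rw [this]
    nlinarith [norm_nonneg u₀]
  have hu₀ρ : ‖u₀‖ ≤ ρ := by
    have : 0 ≤ ‖f‖ / β := by positivity
    simp only [ρ]; linarith
  have hd := TopologicalSpace.denseRange_denseSeq D
  obtain ⟨c, hc⟩ := 𝓜.exists_galerkinSeq hν.le hρ hu₀ρ hfρ (TopologicalSpace.denseSeq D)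
  obtain ⟨φ, hφ, u, hu⟩ := hc.exists_weakTendsto hd
  have h := hc.comp hφ
  exact ⟨ρ, u, fun t ht => h.limit_norm_le hu ht, fun t ht => mem_closure_of_weakTendsto (hu t ht),
    h.limit_weakContinuous hu hd, h.limit_aestronglyMeasurable hu hd, h.limit_zero hu hd hu₀,
    fun w s t hs hst => h.limit_inner_sub hd hu hν hβ.le w hs hst,
    fun t ht => h.limit_energy hu hν.le hβ.le ht,
    fun t ht => h.limit_lintegral_q_lt_top hu hν hβ.le ht⟩

/-- The equation tested with a time dependent test vector. -/
theorem IsSolution.integral_test (h : 𝓜.IsSolution ν β f u₀ ρ u) {v v' : ℝ → D} {C T : ℝ}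
    (hT : 0 ≤ T) (hv : ∀ s t, ‖v t - v s‖ ≤ C * |t - s|) (hvc : Continuous v)
    (hv' : ∀ t, ‖v' t‖ ≤ C) (hvc' : Continuous v')
    (hvv' : ∀ y s t, s ≤ t →
      inner ℝ y (𝓜.ι (v t)) - inner ℝ y (𝓜.ι (v s)) = ∫ r in s..t, inner ℝ y (𝓜.ι (v' r)))
    (hv0 : v 0 = 0) (hvT : ∀ t, T ≤ t → v t = 0) (hvT' : ∀ t, T ≤ t → v' t = 0) :
    ∫ t in Ioi 0, (inner ℝ (u t) (𝓜.ι (v' t)) + 𝓜.rhs ν β f (u t) (v t)) = 0 := by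
  have hρ : 0 ≤ ρ := (norm_nonneg _).trans (h.norm_le 0 le_rfl)
  have hC : 0 ≤ C := (norm_nonneg _).trans (hv' 0)
  set B := 𝓜.rhsBound ν β f ρ with hBdef
  have hB : 0 ≤ B := 𝓜.rhsBound_nonneg ν β f hρ
  have hpos : ∀ {s t : ℝ}, 0 ≤ s → ∀ r ∈ Ioc s t, 0 ≤ r := fun hs r hr => hs.trans hr.1.le
  have hmeas : ∀ {s t : ℝ}, 0 ≤ s → AEStronglyMeasurable u (volume.restrict (Ioc s t)) :=
    fun hs => h.aestronglyMeasurable.mono_measure (Measure.restrict_mono (hpos hs) le_rfl)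
  have hvb : ∀ t, 0 ≤ t → ‖v t‖ ≤ C * t := fun t ht => by
    simpa [hv0, abs_of_nonneg ht] using hv 0 t
  have int_inner : ∀ {s t : ℝ}, 0 ≤ s → s ≤ t →
      IntervalIntegrable (fun r => inner ℝ (u r) (𝓜.ι (v' r))) volume s t := fun hs hst =>
    (intervalIntegrable_iff_integrableOn_Ioc_of_le hst).2 (integrableOn_of_bound
      ((hmeas hs).inner (𝓜.ι.continuous.comp hvc').aestronglyMeasurable)
      fun r hr => (abs_real_inner_le_norm _ _).trans (mul_le_mul (h.norm_le r (hpos hs r hr))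
        ((𝓜.ι.le_opNorm _).trans (mul_le_mul_of_nonneg_left (hv' r) (norm_nonneg _)))
        (norm_nonneg _) hρ))
  have int_rhs : ∀ {s t : ℝ}, 0 ≤ s → s ≤ t → ∀ {w : ℝ → D}, Continuous w →
      (∀ r ∈ Ioc s t, ‖w r‖ ≤ C * t) →
      IntervalIntegrable (fun r => 𝓜.rhs ν β f (u r) (w r)) volume s t := fun hs hst w hw hwC =>
    (intervalIntegrable_iff_integrableOn_Ioc_of_le hst).2 (integrableOn_of_bound
      (aestronglyMeasurable_rhs (hmeas hs) hw.aestronglyMeasurable)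
      fun r hr => (𝓜.abs_rhs_le ν β f (h.norm_le r (hpos hs r hr)) _).trans
        (mul_le_mul_of_nonneg_left (hwC r hr) hB))
  have int_v : ∀ {s t : ℝ}, 0 ≤ s → s ≤ t →
      IntervalIntegrable (fun r => 𝓜.rhs ν β f (u r) (v r)) volume s t := fun hs hst =>
    int_rhs hs hst hvc fun r hr => (hvb r (hpos hs r hr)).trans
      (mul_le_mul_of_nonneg_left hr.2 hC)
  set g : ℝ → ℝ := fun t => inner ℝ (u t) (𝓜.ι (v' t)) + 𝓜.rhs ν β f (u t) (v t) with hg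
  have int_g : ∀ {s t : ℝ}, 0 ≤ s → s ≤ t → IntervalIntegrable g volume s t := fun hs hst =>
    (int_inner hs hst).add (int_v hs hst)
  -- Since `u` is only weakly regular in time, no product rule is available for `⟪u t, ι (v t)⟫`.
  -- Instead `F` is shown to have increments of order `(t - s)²`, hence to be constant.
  let F : ℝ → ℝ := fun t => inner ℝ (u t) (𝓜.ι (v t)) - ∫ r in (0 : ℝ)..t, g r
  have key : ∀ s t, 0 ≤ s → s ≤ t → |F t - F s| ≤ 2 * (B * C) * (t - s) ^ 2 := by
    intro s t hs hst
    have ht := hs.trans hst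
    have hconst : IntervalIntegrable (fun r => 𝓜.rhs ν β f (u r) (v s)) volume s t :=
      int_rhs hs hst continuous_const fun r hr => (hvb s hs).trans
        (mul_le_mul_of_nonneg_left hst hC)
    have hinn : IntervalIntegrable (fun r => inner ℝ (u t) (𝓜.ι (v' r))) volume s t :=
      (continuous_const.inner (𝓜.ι.continuous.comp hvc')).intervalIntegrable _ _
    have e1 := h.inner_sub (v s) s t hs hst
    have e2 := hvv' (u t) s t hst
    have e3 := intervalIntegral.integral_interval_sub_left (int_g le_rfl ht) (int_g le_rfl hs)
    have e4 : ∫ r in s..t, g r = (∫ r in s..t, inner ℝ (u r) (𝓜.ι (v' r))) +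
        ∫ r in s..t, 𝓜.rhs ν β f (u r) (v r) :=
      intervalIntegral.integral_add (int_inner hs hst) (int_v hs hst)
    -- Splitting the increment as `⟪u t, ι (v t - v s)⟫ + ⟪u t - u s, ι (v s)⟫` leaves differences
    -- under the integral that are themselves of order `t - s`.
    have e5 : F t - F s = ∫ r in s..t, ((𝓜.rhs ν β f (u r) (v s) - 𝓜.rhs ν β f (u r) (v r)) +
        (inner ℝ (u t) (𝓜.ι (v' r)) - inner ℝ (u r) (𝓜.ι (v' r)))) := by
      rw [intervalIntegral.integral_add (hconst.sub (int_v hs hst))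
        (hinn.sub (int_inner hs hst)), intervalIntegral.integral_sub hconst (int_v hs hst),
        intervalIntegral.integral_sub hinn (int_inner hs hst)]
      simp only [F]
      linarith
    have hbound : ∀ r ∈ uIoc s t,
        ‖(𝓜.rhs ν β f (u r) (v s) - 𝓜.rhs ν β f (u r) (v r)) +
        (inner ℝ (u t) (𝓜.ι (v' r)) - inner ℝ (u r) (𝓜.ι (v' r)))‖ ≤
        2 * (B * C) * (t - s) := by
      intro r hr
      rw [uIoc_of_le hst] at hr
      have hr0 := hpos hs r hr
      have b1 : |𝓜.rhs ν β f (u r) (v s) - 𝓜.rhs ν β f (u r) (v r)| ≤ B * (C * (t - s)) := by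
        rw [← rhs_sub]
        refine (𝓜.abs_rhs_le ν β f (h.norm_le r hr0) _).trans
          (mul_le_mul_of_nonneg_left ((hv r s).trans ?_) hB)
        rw [abs_sub_comm, abs_of_nonneg (sub_nonneg.2 hr.1.le)]
        gcongr
        exact hr.2
      have b2 : |inner ℝ (u t) (𝓜.ι (v' r)) - inner ℝ (u r) (𝓜.ι (v' r))| ≤
          B * C * (t - s) := by
        rw [h.inner_sub (v' r) r t hr0 hr.2]
        have := intervalIntegral.norm_integral_le_of_norm_le_const (a := r) (b := t)
          (f := fun τ => 𝓜.rhs ν β f (u τ) (v' r)) (C := B * C) (fun τ hτ => by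
            rw [uIoc_of_le hr.2] at hτ
            exact (𝓜.abs_rhs_le ν β f (h.norm_le τ (hpos hr0 τ hτ)) _).trans
              (mul_le_mul_of_nonneg_left (hv' r) hB))
        rw [abs_of_nonneg (sub_nonneg.2 hr.2)] at this
        refine this.trans ?_
        gcongr
        exact hr.1.le
      refine (norm_add_le _ _).trans ?_
      rw [Real.norm_eq_abs, Real.norm_eq_abs]
      linarith
    rw [e5]
    have := intervalIntegral.norm_integral_le_of_norm_le_const hbound
    rw [abs_of_nonneg (sub_nonneg.2 hst), Real.norm_eq_abs] at this
    refine this.trans_eq (by ring)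
  have key' : ∀ s ∈ Icc 0 T, ∀ t ∈ Icc 0 T, |F t - F s| ≤ 2 * (B * C) * |t - s| ^ 2 := by
    intro s hs t ht
    rcases le_total s t with hst | hst
    · rw [sq_abs]; exact key s t hs.1 hst
    · rw [abs_sub_comm, abs_sub_comm t s, sq_abs]; exact key t s ht.1 hst
  have hder : ∀ s ∈ Icc 0 T, HasDerivWithinAt F 0 (Icc 0 T) s := by
    intro s hs
    have hO : (fun t => F t - F s) =O[𝓝[Icc 0 T] s] fun t => ‖t - s‖ ^ 2 := by
      refine Asymptotics.IsBigO.of_bound (2 * (B * C)) ?_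
      filter_upwards [self_mem_nhdsWithin] with t ht
      rw [Real.norm_of_nonneg (by positivity : 0 ≤ ‖t - s‖ ^ 2)]
      exact key' s hs t ht
    have := (hO.hasFDerivWithinAt hs one_lt_two).hasDerivWithinAt.add_const (F s)
    simpa using this
  have hconst := constant_of_derivWithin_zero (f := F) (a := 0) (b := T)
    (fun s hs => (hder s hs).differentiableWithinAt) (fun s hs => by
      have hs' : s ∈ Icc 0 T := ⟨hs.1, hs.2.le⟩
      exact (hder s hs').derivWithin
        (uniqueDiffOn_Icc (hs.1.trans_lt hs.2) s hs')) T ⟨hT, le_rfl⟩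
  have hFT : ∫ r in (0 : ℝ)..T, g r = 0 := by
    simp only [F, hv0, hvT T le_rfl, map_zero, inner_zero_right,
      intervalIntegral.integral_same, zero_sub, sub_zero, neg_eq_zero] at hconst
    exact hconst
  refine Eq.trans ?_ hFT
  rw [intervalIntegral.integral_of_le hT]
  refine (setIntegral_eq_of_subset_of_forall_sdiff_eq_zero measurableSet_Ioi
    Ioc_subset_Ioi_self fun t ht => ?_)
  have hTt : T ≤ t := by
    by_contra! hlt
    exact ht.2 ⟨ht.1, hlt.le⟩
  have h0 : 𝓜.rhs ν β f (u t) 0 = 0 := by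
    simpa using 𝓜.rhs_smul ν β f (u t) 0 0
  simp only [hvT t hTt, hvT' t hTt, map_zero, inner_zero_right, h0, add_zero]

end EnergyModel
end

noncomputable section

/-! ### Conjugation, reflection and the Fourier transform on `L²` -/

/-- The space `L²(ℝ³; ℂ)`. -/
abbrev L2C : Type := Lp ℂ 2 (volume : Measure R3)

section RealStructure

open SchwartzMap

/-- Complex conjugation on `L²`. -/
def conjL : L2C →L[ℝ] L2C := (Complex.conjCLE : ℂ →L[ℝ] ℂ).compLpL 2 volume

theorem coeFn_conjL (g : L2C) : conjL g =ᵐ[volume] fun x => starRingEnd ℂ (g x) :=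
  ContinuousLinearMap.coeFn_compLpL _ _

/-- Reflection on `L²`. -/
def reflL : L2C →ₗᵢ[ℂ] L2C :=
  Lp.compMeasurePreservingₗᵢ ℂ (fun x : R3 => -x) (Measure.measurePreserving_neg volume)

theorem coeFn_reflL (g : L2C) : reflL g =ᵐ[volume] fun x => g (-x) :=
  Lp.coeFn_compMeasurePreserving g (Measure.measurePreserving_neg volume)

theorem L2C.induction_schwartz {p : L2C → Prop} (g : L2C) (hp : IsClosed {g | p g})
    (h : ∀ φ : 𝓢(R3, ℂ), p (φ.toLp 2)) : p g :=
  DenseRange.induction_on (p := p)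
    (SchwartzMap.denseRange_toLpCLM (F := ℂ) (p := 2) (μ := (volume : Measure R3))
      ENNReal.ofNat_ne_top) g hp h

theorem continuous_fourier_L2C : Continuous fun g : L2C => 𝓕 g :=
  (Lp.fourierTransformₗᵢ R3 ℂ).continuous

theorem continuous_fourierInv_L2C : Continuous fun g : L2C => 𝓕⁻ g :=
  (Lp.fourierTransformₗᵢ R3 ℂ).symm.continuous

theorem conj_fourier_apply (φ : R3 → ℂ) (x : R3) :
    starRingEnd ℂ (𝓕 φ x) = 𝓕⁻ (fun y => starRingEnd ℂ (φ y)) x := by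
  rw [Real.fourier_eq', Real.fourierInv_eq', ← integral_conj]
  refine integral_congr_ae (Filter.Eventually.of_forall fun y => ?_)
  simp only [smul_eq_mul, map_mul, ← Complex.exp_conj, Complex.conj_ofReal, Complex.conj_I]
  congr 2
  push_cast
  ring

theorem conjL_fourier (g : L2C) : conjL (𝓕 g) = 𝓕⁻ (conjL g) := by
  refine L2C.induction_schwartz g (isClosed_eq (conjL.continuous.comp continuous_fourier_L2C)
    (continuous_fourierInv_L2C.comp conjL.continuous)) fun φ => ?_
  let ψ : 𝓢(R3, ℂ) := φ.postcompCLM (Complex.conjCLE : ℂ →L[ℝ] ℂ)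
  have hψ : conjL (φ.toLp 2) = ψ.toLp 2 := by
    ext1
    filter_upwards [coeFn_conjL (φ.toLp 2), φ.coeFn_toLp 2 volume, ψ.coeFn_toLp 2 volume]
      with x h1 h2 h3
    rw [h1, h2, h3]; rfl
  change conjL (𝓕 (φ.toLp 2)) = 𝓕⁻ (conjL (φ.toLp 2))
  rw [hψ, toLp_fourier_eq, toLp_fourierInv_eq]
  ext1
  filter_upwards [coeFn_conjL ((𝓕 φ).toLp 2), (𝓕 φ).coeFn_toLp 2 volume,
    (𝓕⁻ ψ).coeFn_toLp 2 volume] with x h1 h2 h3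
  rw [h1, h2, h3, fourier_coe, fourierInv_coe, conj_fourier_apply]
  rfl

theorem reflL_fourier (g : L2C) : reflL (𝓕 g) = 𝓕⁻ g := by
  refine L2C.induction_schwartz g (isClosed_eq (reflL.continuous.comp continuous_fourier_L2C)
    continuous_fourierInv_L2C) fun φ => ?_
  change reflL (𝓕 (φ.toLp 2)) = 𝓕⁻ (φ.toLp 2)
  rw [toLp_fourier_eq, toLp_fourierInv_eq]
  ext1
  filter_upwards [coeFn_reflL ((𝓕 φ).toLp 2), (Measure.measurePreserving_neg
    (volume : Measure R3)).quasiMeasurePreserving.ae ((𝓕 φ).coeFn_toLp 2 volume),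
    (𝓕⁻ φ).coeFn_toLp 2 volume] with x h1 h2 h3
  rw [h1, h2, h3, fourier_coe, fourierInv_coe, Real.fourierInv_eq_fourier_neg]

theorem fourier_reflL (g : L2C) : 𝓕 (reflL g) = 𝓕⁻ g := by
  have h := reflL_fourier (𝓕⁻ g)
  rw [FourierTransform.fourier_fourierInv_eq] at h
  rw [h, FourierTransform.fourier_fourierInv_eq]

theorem conjL_fourierInv (g : L2C) : conjL (𝓕⁻ g) = 𝓕 (conjL g) := by
  have h := conjL_fourier (𝓕⁻ g)
  rw [FourierTransform.fourier_fourierInv_eq] at h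
  rw [h, FourierTransform.fourier_fourierInv_eq]

end RealStructure

/-! ### Even symbols and Fourier multipliers on real vector fields -/

/-- Bounded measurable functions on the frequency space. -/
structure EvenSymbol where
  /-- the underlying function -/
  toFun : R3 → ℝ
  measurable' : Measurable toFun
  bounded' : ∃ C, ∀ ξ, |toFun ξ| ≤ C
  even' : ∀ ξ, toFun (-ξ) = toFun ξ

namespace EvenSymbol

instance : CoeFun EvenSymbol fun _ => R3 → ℝ := ⟨toFun⟩

theorem measurable (m : EvenSymbol) : Measurable m := m.measurable'

/-- A bound of a symbol. -/
def bound (m : EvenSymbol) : ℝ := m.bounded'.choose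

theorem abs_le (m : EvenSymbol) (ξ : R3) : |m ξ| ≤ m.bound := m.bounded'.choose_spec ξ

theorem memLp_mul (m : EvenSymbol) (g : L2C) : MemLp (fun ξ => (m ξ : ℂ) * g ξ) 2 volume := by
  refine (Lp.memLp g).of_le_mul (c := m.bound) ?_ (Filter.Eventually.of_forall fun ξ => ?_)
  · exact (Complex.measurable_ofReal.comp m.measurable).aestronglyMeasurable.mul
      (Lp.aestronglyMeasurable g)
  · rw [norm_mul, Complex.norm_real, Real.norm_eq_abs]
    gcongr
    exact m.abs_le ξ

/-- Multiplication by a symbol. -/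
def mulL (m : EvenSymbol) : L2C →L[ℂ] L2C :=
  LinearMap.mkContinuous
    { toFun := fun g => (m.memLp_mul g).toLp _
      map_add' := fun g h => by
        ext1
        filter_upwards [(m.memLp_mul (g + h)).coeFn_toLp, (m.memLp_mul g).coeFn_toLp,
          (m.memLp_mul h).coeFn_toLp, Lp.coeFn_add g h,
          Lp.coeFn_add ((m.memLp_mul g).toLp _) ((m.memLp_mul h).toLp _)] with ξ h1 h2 h3 h4 h5
        rw [h1, h5, Pi.add_apply, h2, h3, h4, Pi.add_apply, mul_add]
      map_smul' := fun c g => by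
        ext1
        filter_upwards [(m.memLp_mul (c • g)).coeFn_toLp, (m.memLp_mul g).coeFn_toLp,
          Lp.coeFn_smul c g, Lp.coeFn_smul c ((m.memLp_mul g).toLp _)] with ξ h1 h2 h3 h4
        simp only [RingHom.id_apply]
        rw [h1, h4, Pi.smul_apply, h2, h3, Pi.smul_apply, smul_eq_mul, smul_eq_mul]
        ring }
    m.bound fun g => by
      refine Lp.norm_le_mul_norm_of_ae_le_mul ?_
      filter_upwards [(m.memLp_mul g).coeFn_toLp] with ξ h1
      simp only [LinearMap.coe_mk, AddHom.coe_mk]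
      rw [h1, norm_mul, Complex.norm_real, Real.norm_eq_abs]
      gcongr
      exact m.abs_le ξ

theorem coeFn_mulL (m : EvenSymbol) (g : L2C) : m.mulL g =ᵐ[volume] fun ξ => (m ξ : ℂ) * g ξ :=
  (m.memLp_mul g).coeFn_toLp

theorem conjL_mulL (m : EvenSymbol) (g : L2C) : conjL (m.mulL g) = m.mulL (conjL g) := by
  ext1
  filter_upwards [coeFn_conjL (m.mulL g), m.coeFn_mulL g, m.coeFn_mulL (conjL g), coeFn_conjL g]
    with ξ h1 h2 h3 h4
  rw [h1, h2, h3, h4, map_mul, Complex.conj_ofReal]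

theorem reflL_mulL (m : EvenSymbol) (g : L2C) : reflL (m.mulL g) = m.mulL (reflL g) := by
  ext1
  filter_upwards [coeFn_reflL (m.mulL g), (Measure.measurePreserving_neg
    (volume : Measure R3)).quasiMeasurePreserving.ae (m.coeFn_mulL g), m.coeFn_mulL (reflL g),
    coeFn_reflL g] with ξ h1 h2 h3 h4
  rw [h1, h2, h3, h4, m.even']

/-- The Fourier multiplier with a given symbol. -/
def multiplier (m : EvenSymbol) : L2C →L[ℂ] L2C :=
  ((Lp.fourierTransformₗᵢ R3 ℂ).symm.toContinuousLinearEquiv : L2C →L[ℂ] L2C) ∘L m.mulL ∘L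
    ((Lp.fourierTransformₗᵢ R3 ℂ).toContinuousLinearEquiv : L2C →L[ℂ] L2C)

theorem multiplier_apply (m : EvenSymbol) (g : L2C) : m.multiplier g = 𝓕⁻ (m.mulL (𝓕 g)) := rfl

theorem fourier_multiplier (m : EvenSymbol) (g : L2C) : 𝓕 (m.multiplier g) = m.mulL (𝓕 g) := by
  rw [multiplier_apply, FourierTransform.fourier_fourierInv_eq]

/-- Conjugation exchanges `𝓕` and `𝓕⁻`, which differ by a reflection; a real even symbol commutes
with both operations. Hence real functions are mapped to real functions. -/
theorem conjL_multiplier (m : EvenSymbol) (g : L2C) :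
    conjL (m.multiplier g) = m.multiplier (conjL g) := by
  rw [multiplier_apply, multiplier_apply, conjL_fourierInv, conjL_mulL, conjL_fourier,
    ← reflL_fourier, ← reflL_mulL, fourier_reflL]

end EvenSymbol

section Fields

/-- The `i`-th component of a vector field as a linear map. -/
def componentL (i : Fin 3) : L2Field →L[ℝ] L2C :=
  (Complex.ofRealCLM.comp (EuclideanSpace.proj i : R3 →L[ℝ] ℝ)).compLpL 2 volume

theorem componentL_apply (i : Fin 3) (v : L2Field) : componentL i v = componentC i v := rfl

theorem coeFn_componentL (i : Fin 3) (v : L2Field) :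
    componentL i v =ᵐ[volume] fun x => ((v x i : ℝ) : ℂ) :=
  ContinuousLinearMap.coeFn_compLpL _ _

/-- The vector field in direction `i` given by the real part of a function. -/
def singleL (i : Fin 3) : L2C →L[ℝ] L2Field :=
  (Complex.reCLM.smulRight (EuclideanSpace.single i (1 : ℝ))).compLpL 2 volume

theorem coeFn_singleL (i : Fin 3) (g : L2C) :
    singleL i g =ᵐ[volume] fun x => (g x).re • EuclideanSpace.single i (1 : ℝ) :=
  ContinuousLinearMap.coeFn_compLpL _ _

theorem componentL_singleL (i j : Fin 3) {g : L2C} (hg : conjL g = g) :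
    componentL i (singleL j g) = if i = j then g else 0 := by
  ext1
  have hgc := coeFn_conjL g
  rw [hg] at hgc
  filter_upwards [coeFn_componentL i (singleL j g), coeFn_singleL j g, hgc] with x h1 h2 h4
  rw [h1, h2]
  split_ifs with hij
  · subst hij
    simpa using Complex.conj_eq_iff_re.1 h4.symm
  · simp [hij]

theorem conjL_componentL (i : Fin 3) (v : L2Field) : conjL (componentL i v) = componentL i v := by
  ext1
  filter_upwards [coeFn_conjL (componentL i v), coeFn_componentL i v] with x h1 h2
  rw [h1, h2, Complex.conj_ofReal]

/-- The Fourier transform of the `i`-th component of a vector field. -/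
def hatL (i : Fin 3) : L2Field →L[ℝ] L2C :=
  (((Lp.fourierTransformₗᵢ R3 ℂ).toContinuousLinearEquiv : L2C →L[ℂ] L2C).restrictScalars ℝ) ∘L
    componentL i

theorem hatL_apply (i : Fin 3) (v : L2Field) : hatL i v = 𝓕 (componentC i v) := rfl

theorem inner_componentL (v w : L2Field) :
    inner ℝ v w = ∑ i, (inner ℂ (componentL i v) (componentL i w)).re := by
  have hInt : ∀ i, Integrable (fun x => inner ℂ (componentL i v x) (componentL i w x)) :=
    fun i => L2.integrable_inner _ _
  have hintre : ∀ i, Integrable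
      (fun x => (inner ℂ (componentL i v x) (componentL i w x)).re) := fun i => (hInt i).re
  have hre : ∀ i, (inner ℂ (componentL i v) (componentL i w)).re =
      ∫ x, (inner ℂ (componentL i v x) (componentL i w x)).re := fun i => by
    rw [L2.inner_def]
    exact (integral_re (hInt i)).symm
  simp only [hre]
  rw [L2.inner_def, ← integral_finsetSum _ fun i _ => hintre i]
  refine integral_congr_ae ?_
  have hc : ∀ v : L2Field, ∀ᵐ x, ∀ i, componentL i v x = ((v x i : ℝ) : ℂ) := fun v =>
    ae_all_iff.2 fun i => coeFn_componentL i v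
  filter_upwards [hc v, hc w] with x h1 h2
  simp only [h1, h2, PiLp.inner_apply]
  refine Finset.sum_congr rfl fun i _ => ?_
  simp [mul_comm]

theorem inner_hatL (v w : L2Field) : inner ℝ v w = ∑ i, (inner ℂ (hatL i v) (hatL i w)).re := by
  rw [inner_componentL]
  refine Finset.sum_congr rfl fun i _ => ?_
  rw [← Lp.inner_fourier_eq]
  rfl

theorem norm_sq_hatL (v : L2Field) : ‖v‖ ^ 2 = ∑ i, ‖hatL i v‖ ^ 2 := by
  rw [← real_inner_self_eq_norm_sq, inner_hatL]
  refine Finset.sum_congr rfl fun i _ => ?_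
  rw [inner_self_eq_norm_sq_to_K]
  norm_cast

theorem norm_hatL_le (i : Fin 3) (v : L2Field) : ‖hatL i v‖ ≤ ‖v‖ := by
  refine abs_le_of_sq_le_sq' ?_ (norm_nonneg _) |>.2
  rw [norm_sq_hatL]
  exact Finset.single_le_sum (f := fun i => ‖hatL i v‖ ^ 2) (fun _ _ => by positivity)
    (Finset.mem_univ i)

theorem ext_hatL {v w : L2Field} (h : ∀ i, hatL i v = hatL i w) : v = w := by
  rw [← sub_eq_zero, ← norm_eq_zero, ← sq_eq_zero_iff, norm_sq_hatL]
  simp [h]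

/-- The Fourier multiplier on vector fields with a matrix of symbols. -/
def matrixMultiplier (m : Fin 3 → Fin 3 → EvenSymbol) : L2Field →L[ℝ] L2Field :=
  ∑ i, ∑ k, singleL i ∘L ((m i k).multiplier.restrictScalars ℝ) ∘L componentL k

/-- `singleL` keeps only real parts, so the formula rests on each multiplier preserving real
functions. -/
theorem hatL_matrixMultiplier (m : Fin 3 → Fin 3 → EvenSymbol) (i : Fin 3) (v : L2Field) :
    hatL i (matrixMultiplier m v) = ∑ k, (m i k).mulL (hatL k v) := by
  have h : componentL i (matrixMultiplier m v) = ∑ k, (m i k).multiplier (componentL k v) := by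
    simp only [matrixMultiplier, sum_apply, ContinuousLinearMap.comp_apply, map_sum,
      ContinuousLinearMap.coe_restrictScalars']
    rw [Finset.sum_comm]
    refine Finset.sum_congr rfl fun k _ => ?_
    rw [Finset.sum_eq_single i]
    · rw [componentL_singleL _ _ (by rw [EvenSymbol.conjL_multiplier, conjL_componentL]), if_pos rfl]
    · intro j _ hj
      rw [componentL_singleL _ _ (by rw [EvenSymbol.conjL_multiplier, conjL_componentL]),
        if_neg hj.symm]
    · simp
  have h2 : hatL i (matrixMultiplier m v) =
      (Lp.fourierTransformₗᵢ R3 ℂ) (componentL i (matrixMultiplier m v)) := rfl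
  rw [h2, h, map_sum]
  exact Finset.sum_congr rfl fun k _ => (m i k).fourier_multiplier _

end Fields

end

noncomputable section

/-! ### The integral Fourier inversion on `L¹ ∩ L²` -/

section Coincidence

theorem continuous_neg_innerₗ : Continuous fun p : R3 × R3 => (-innerₗ R3) p.1 p.2 := by
  change Continuous fun p : R3 × R3 => -inner ℝ p.1 p.2
  fun_prop

theorem integral_fourierInv_mul_eq_flip {φ g : R3 → ℂ} (hφ : Integrable φ) (hg : Integrable g) :
    ∫ x, 𝓕⁻ φ x * g x = ∫ x, φ x * 𝓕⁻ g x := by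
  have h := VectorFourier.integral_fourierIntegral_smul_eq_flip (L := -innerₗ R3)
    (e := Real.fourierChar) (μ := volume) (ν := volume) Real.continuous_fourierChar continuous_neg_innerₗ hφ hg
  have hflip : (-innerₗ R3 : R3 →ₗ[ℝ] R3 →ₗ[ℝ] ℝ).flip = -innerₗ R3 := by
    ext x y
    simp [real_inner_comm]
  rw [hflip] at h
  exact h

/-- On `L¹ ∩ L²` the inverse Fourier transforms of `L¹` and of `L²` coincide. -/
theorem coeFn_fourierInv_toLp {g : R3 → ℂ} (h1 : Integrable g) (h2 : MemLp g 2 volume) :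
    (𝓕⁻ (h2.toLp g) : L2C) =ᵐ[volume] 𝓕⁻ g := by
  have hcont : Continuous (𝓕⁻ g) :=
    VectorFourier.fourierIntegral_continuous Real.continuous_fourierChar
      continuous_neg_innerₗ h1
  refine ae_eq_of_integral_contDiff_smul_eq
    ((Lp.memLp (𝓕⁻ (h2.toLp g) : L2C)).locallyIntegrable (by norm_num))
    hcont.locallyIntegrable fun η hη hηs => ?_
  let φ : SchwartzMap R3 ℂ := HasCompactSupport.toSchwartzMap (f := fun x => ((η x : ℝ) : ℂ))
    (hηs.comp_left (g := fun r : ℝ => (r : ℂ)) Complex.ofReal_zero)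
    (Complex.ofRealCLM.contDiff.comp hη)
  have hφ : ∀ x, φ x = (η x : ℂ) := fun x => rfl
  -- Both transforms are compared as tempered distributions against the test function `η`, the
  -- integral one by Fubini.
  have h3 := congrArg (fun T => T φ) (Lp.fourierInv_toTemperedDistribution_eq (h2.toLp g))
  simp only [TemperedDistribution.fourierInv_apply, Lp.toTemperedDistribution_apply] at h3
  have h4 : ∫ x, (𝓕⁻ φ) x • (h2.toLp g) x = ∫ x, (𝓕⁻ (φ : R3 → ℂ)) x * g x := by
    refine integral_congr_ae ?_
    filter_upwards [h2.coeFn_toLp] with x hx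
    rw [hx, SchwartzMap.fourierInv_coe, smul_eq_mul]
  rw [h4, integral_fourierInv_mul_eq_flip φ.integrable h1] at h3
  simp only [hφ, smul_eq_mul] at h3
  simpa only [Complex.real_smul] using h3.symm

theorem fourierInv_hasFDerivAt {f : R3 → ℂ} (hf : Integrable f)
    (hf' : Integrable fun ξ => ‖ξ‖ * ‖f ξ‖) (x : R3) :
    ∃ L : R3 →L[ℝ] ℂ, HasFDerivAt (𝓕⁻ f) L x ∧ ∀ m, L m =
      𝓕⁻ (fun ξ => (2 * Real.pi * Complex.I * (inner ℝ ξ m : ℝ)) * f ξ) x := by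
  -- `𝓕⁻ f` is `𝓕 f` composed with the reflection, so its derivative follows from the chain rule at
  -- `-x`.
  have h := (Real.hasFDerivAt_fourier hf hf' (-x)).comp x (hasFDerivAt_id x).neg
  have hfun : 𝓕 f ∘ (fun y => -y) = 𝓕⁻ f := by
    ext y
    simp [Real.fourierInv_eq_fourier_neg]
  rw [hfun] at h
  refine ⟨_, h, fun m => ?_⟩
  have hInt : Integrable (VectorFourier.fourierSMulRight (innerSL ℝ) f) := by
    refine (hf'.const_mul (2 * Real.pi)).mono'
      hf.1.fourierSMulRight (Filter.Eventually.of_forall fun ξ => ?_)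
    refine (VectorFourier.norm_fourierSMulRight_le _ _ _).trans ?_
    have : ‖innerSL ℝ (E := R3)‖ ≤ 1 := norm_innerSL_le _
    have h2 : 0 ≤ 2 * Real.pi * (‖ξ‖ * ‖f ξ‖) := by positivity
    nlinarith
  rw [ContinuousLinearMap.comp_apply, Real.fourier_continuousLinearMap_apply hInt,
    Real.fourierInv_eq_fourier_neg]
  refine Real.fourier_congr_ae (Filter.Eventually.of_forall fun ξ => ?_) (-x)
  simp only [neg_apply, ContinuousLinearMap.coe_id', id_eq, map_neg,
    VectorFourier.fourierSMulRight_apply, smul_eq_mul, Complex.real_smul]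
  change -(-(2 * ↑Real.pi * Complex.I) * ((inner ℝ ξ m : ℝ) * f ξ)) = _
  ring

end Coincidence

/-! ### Pointwise synthesis with decaying symbols, and the resulting multiplication operators -/

/-- Bounded, square integrable functions on the frequency space. -/
structure DecaySymbol where
  /-- the underlying function -/
  toFun : R3 → ℂ
  bounded' : ∃ C, ∀ ξ, ‖toFun ξ‖ ≤ C
  memLp' : MemLp toFun 2 volume

namespace DecaySymbol

instance : CoeFun DecaySymbol fun _ => R3 → ℂ := ⟨toFun⟩

theorem memLp (κ : DecaySymbol) : MemLp κ 2 volume := κ.memLp'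

theorem memLp_mul (κ : DecaySymbol) (g : L2C) : MemLp (fun ξ => κ ξ * g ξ) 2 volume := by
  obtain ⟨C, hC⟩ := κ.bounded'
  refine (Lp.memLp g).of_le_mul (c := C) (κ.memLp.1.mul (Lp.aestronglyMeasurable g))
    (Filter.Eventually.of_forall fun ξ => ?_)
  rw [norm_mul]
  gcongr
  exact hC ξ

theorem integrable_mul (κ : DecaySymbol) (g : L2C) : Integrable fun ξ => κ ξ * g ξ :=
  κ.memLp.integrable_mul (Lp.memLp g)

/-- The function with Fourier transform `κ g`. -/
def synth (κ : DecaySymbol) (g : L2C) (x : R3) : ℂ := 𝓕⁻ (fun ξ => κ ξ * g ξ) x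

theorem synth_congr {κ κ' : DecaySymbol} {g g' : L2C}
    (h : (fun ξ => κ ξ * g ξ) =ᵐ[volume] fun ξ => κ' ξ * g' ξ) : κ.synth g = κ'.synth g' :=
  funext fun x => Real.fourierInv_congr_ae h x

theorem continuous_synth (κ : DecaySymbol) (g : L2C) : Continuous (κ.synth g) :=
  VectorFourier.fourierIntegral_continuous Real.continuous_fourierChar
    continuous_neg_innerₗ (κ.integrable_mul g)

theorem coeFn_fourierInv_mul (κ : DecaySymbol) (g : L2C) :
    (𝓕⁻ ((κ.memLp_mul g).toLp _) : L2C) =ᵐ[volume] κ.synth g :=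
  coeFn_fourierInv_toLp (κ.integrable_mul g) (κ.memLp_mul g)

theorem memLp_synth (κ : DecaySymbol) (g : L2C) : MemLp (κ.synth g) 2 volume :=
  (memLp_congr_ae (κ.coeFn_fourierInv_mul g)).1 (Lp.memLp _)

/-- The integral kernel of `synth`. -/
def kernelFun (κ : DecaySymbol) (x ξ : R3) : ℂ :=
  starRingEnd ℂ (Complex.exp (↑(2 * Real.pi * inner ℝ ξ x) * Complex.I) * κ ξ)

theorem norm_kernelFun (κ : DecaySymbol) (x ξ : R3) : ‖κ.kernelFun x ξ‖ = ‖κ ξ‖ := by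
  rw [kernelFun, RCLike.norm_conj, norm_mul, Complex.norm_exp_ofReal_mul_I, one_mul]

theorem memLp_kernelFun (κ : DecaySymbol) (x : R3) : MemLp (κ.kernelFun x) 2 volume := by
  refine κ.memLp.of_le ?_ (Filter.Eventually.of_forall fun ξ => (κ.norm_kernelFun x ξ).le)
  refine (Complex.continuous_conj.comp_aestronglyMeasurable
    (AEStronglyMeasurable.mul (Continuous.aestronglyMeasurable ?_) κ.memLp.1))
  fun_prop

/-- The integral kernel of `synth` as an element of `L²`. -/
def kernel (κ : DecaySymbol) (x : R3) : L2C := (κ.memLp_kernelFun x).toLp _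

/-- Point values are bounded linear functionals of `g`. This yields the uniform bound below and,
later, pointwise convergence under weak convergence. -/
theorem synth_eq_inner (κ : DecaySymbol) (g : L2C) (x : R3) :
    κ.synth g x = inner ℂ (κ.kernel x) g := by
  rw [synth, Real.fourierInv_eq', L2.inner_def]
  refine integral_congr_ae ?_
  filter_upwards [(κ.memLp_kernelFun x).coeFn_toLp] with ξ hξ
  rw [kernel, hξ, kernelFun, RCLike.inner_apply, Complex.conj_conj, smul_eq_mul]
  ring

/-- The norm of a symbol in `L²`. -/
def l2norm (κ : DecaySymbol) : ℝ := ‖κ.memLp.toLp _‖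

theorem l2norm_nonneg (κ : DecaySymbol) : 0 ≤ κ.l2norm := norm_nonneg _

theorem norm_kernel (κ : DecaySymbol) (x : R3) : ‖κ.kernel x‖ ≤ κ.l2norm := by
  refine Lp.norm_le_norm_of_ae_le ?_
  filter_upwards [(κ.memLp_kernelFun x).coeFn_toLp, κ.memLp.coeFn_toLp] with ξ h1 h2
  rw [kernel, h1, h2, norm_kernelFun]

theorem norm_synth_le (κ : DecaySymbol) (g : L2C) (x : R3) :
    ‖κ.synth g x‖ ≤ κ.l2norm * ‖g‖ := by
  rw [synth_eq_inner]
  exact (norm_inner_le_norm _ _).trans (by gcongr; exact κ.norm_kernel x)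

theorem synth_add (κ : DecaySymbol) (g h : L2C) (x : R3) :
    κ.synth (g + h) x = κ.synth g x + κ.synth h x := by
  simp only [synth_eq_inner, inner_add_right]

theorem synth_real_smul (κ : DecaySymbol) (c : ℝ) (g : L2C) (x : R3) :
    κ.synth (c • g) x = c * κ.synth g x := by
  have : c • g = (c : ℂ) • g := (Complex.coe_smul c g).symm
  simp only [synth_eq_inner, this, inner_smul_right]

theorem memLp_top_re_synth (κ : DecaySymbol) (g : L2C) :
    MemLp (fun x => (κ.synth g x).re) ∞ volume :=
  memLp_top_of_bound (Complex.continuous_re.comp (κ.continuous_synth g)).aestronglyMeasurable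
    (κ.l2norm * ‖g‖) (Filter.Eventually.of_forall fun x =>
      (Complex.abs_re_le_norm _).trans (κ.norm_synth_le g x))

/-- The real part of `synth` as an element of `L^∞`. -/
def synthL (κ : DecaySymbol) : L2C →L[ℝ] Lp ℝ ∞ (volume : Measure R3) :=
  LinearMap.mkContinuous
    { toFun := fun g => (κ.memLp_top_re_synth g).toLp _
      map_add' := fun g h => by
        rw [← MemLp.toLp_add]
        exact MemLp.toLp_congr _ _ (Filter.Eventually.of_forall fun x => by simp [synth_add])
      map_smul' := fun c g => by
        rw [RingHom.id_apply, ← MemLp.toLp_const_smul]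
        exact MemLp.toLp_congr _ _ (Filter.Eventually.of_forall fun x => by
          simp [synth_real_smul]) }
    κ.l2norm fun g => by
      change ‖(κ.memLp_top_re_synth g).toLp _‖ ≤ _
      rw [Lp.norm_toLp, eLpNorm_exponent_top]
      refine ENNReal.toReal_le_of_le_ofReal (mul_nonneg κ.l2norm_nonneg (norm_nonneg _))
        (eLpNormEssSup_le_of_ae_bound (Filter.Eventually.of_forall fun x => ?_))
      exact (Complex.abs_re_le_norm _).trans (κ.norm_synth_le g x)

theorem coeFn_synthL (κ : DecaySymbol) (g : L2C) :
    κ.synthL g =ᵐ[volume] fun x => (κ.synth g x).re :=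
  (κ.memLp_top_re_synth g).coeFn_toLp

/-- The bilinear map `(r, y) ↦ r yⱼ eᵢ`. -/
def entryB (i j : Fin 3) : ℝ →L[ℝ] R3 →L[ℝ] R3 :=
  (ContinuousLinearMap.lsmul ℝ ℝ).flip
    ((EuclideanSpace.proj j : R3 →L[ℝ] ℝ).smulRight (EuclideanSpace.single i (1 : ℝ)))

theorem entryB_apply (i j : Fin 3) (r : ℝ) (y : R3) :
    entryB i j r y = (r * y j) • EuclideanSpace.single i (1 : ℝ) := by
  simp [entryB, mul_smul]

/-- The map `(g, u) ↦ Re (𝓕⁻ (κ g)) uⱼ eᵢ`. -/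
def entryL (i j : Fin 3) (κ : DecaySymbol) : L2C →L[ℝ] L2Field →L[ℝ] L2Field :=
  ((entryB i j).holderL volume ∞ 2 2) ∘L κ.synthL

theorem coeFn_entryL (i j : Fin 3) (κ : DecaySymbol) (g : L2C) (u : L2Field) :
    entryL i j κ g u =ᵐ[volume]
      fun x => ((κ.synth g x).re * u x j) • EuclideanSpace.single i (1 : ℝ) := by
  have h := (entryB i j).coeFn_holder (r := 2) (κ.synthL g) u
  filter_upwards [h, κ.coeFn_synthL g] with x h1 h2
  rw [← h2, ← entryB_apply]
  exact h1

theorem entryL_congr {i j : Fin 3} {κ κ' : DecaySymbol} {g g' : L2C}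
    (h : (fun ξ => κ ξ * g ξ) =ᵐ[volume] fun ξ => κ' ξ * g' ξ) :
    entryL i j κ g = entryL i j κ' g' := by
  ext1 u
  ext1
  filter_upwards [coeFn_entryL i j κ g u, coeFn_entryL i j κ' g' u] with x h1 h2
  rw [h1, h2, synth_congr h]

theorem inner_entryL (i j : Fin 3) (κ : DecaySymbol) (g : L2C) (v u : L2Field) :
    inner ℝ v (entryL i j κ g u) = ∫ x, (κ.synth g x).re * (v x i * u x j) := by
  rw [L2.inner_def]
  refine integral_congr_ae ?_
  filter_upwards [coeFn_entryL i j κ g u] with x hx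
  rw [hx, inner_smul_right, EuclideanSpace.inner_single_right]
  simp
  ring

theorem integrable_entry (i j : Fin 3) (κ : DecaySymbol) (g : L2C) (v u : L2Field) :
    Integrable fun x => (κ.synth g x).re * (v x i * u x j) := by
  refine (L2.integrable_inner (𝕜 := ℝ) v (entryL i j κ g u)).congr ?_
  filter_upwards [coeFn_entryL i j κ g u] with x hx
  rw [hx, inner_smul_right, EuclideanSpace.inner_single_right]
  simp
  ring

end DecaySymbol

end

noncomputable section

/-! ### The concrete symbols -/

section Symbols

/-- The weight `(1 + |ξ|²)⁻¹`. -/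
def weight (ξ : R3) : ℝ := (1 + ‖ξ‖ ^ 2)⁻¹

theorem weight_pos (ξ : R3) : 0 < weight ξ := by unfold weight; positivity

theorem weight_le_one (ξ : R3) : weight ξ ≤ 1 :=
  inv_le_one_of_one_le₀ (by nlinarith [sq_nonneg ‖ξ‖])

theorem continuous_weight : Continuous weight := by
  unfold weight
  exact Continuous.inv₀ (by fun_prop) fun ξ => by positivity

theorem norm_mul_weight_le (ξ : R3) : ‖ξ‖ * weight ξ ≤ 1 := by
  rw [weight, ← div_eq_mul_inv, div_le_one (by positivity)]
  nlinarith [sq_nonneg (‖ξ‖ - 1)]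

/-- The square decays as `|ξ|⁻⁴`, which is integrable in dimension three. -/
theorem memLp_weight : MemLp weight 2 volume := by
  rw [memLp_two_iff_integrable_sq continuous_weight.aestronglyMeasurable]
  have h := integrable_rpow_neg_one_add_norm_sq (E := R3) (μ := volume) (r := 4) (by
    rw [finrank_euclideanSpace, Fintype.card_fin]; norm_num)
  refine h.congr (Filter.Eventually.of_forall fun ξ => ?_)
  have h0 : (0 : ℝ) ≤ 1 + ‖ξ‖ ^ 2 := by positivity
  change (1 + ‖ξ‖ ^ 2) ^ (-(4 : ℝ) / 2) = weight ξ ^ 2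
  rw [show (-(4 : ℝ) / 2) = -((2 : ℕ) : ℝ) by norm_num, Real.rpow_neg h0, Real.rpow_natCast,
    weight, inv_pow]

/-- A symbol which decays as `(1 + |ξ|²)⁻¹`. -/
def DecaySymbol.ofLe (κ : R3 → ℂ) (hm : Measurable κ) (C : ℝ)
    (h : ∀ ξ, ‖κ ξ‖ ≤ C * weight ξ) : DecaySymbol where
  toFun := κ
  bounded' := ⟨|C|, fun ξ => (h ξ).trans (by
    have := weight_pos ξ
    have := weight_le_one ξ
    have := le_abs_self C
    have := abs_nonneg C
    nlinarith)⟩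
  memLp' := memLp_weight.of_le_mul (c := C) hm.aestronglyMeasurable
    (Filter.Eventually.of_forall fun ξ => by
      rw [Real.norm_of_nonneg (weight_pos ξ).le]; exact h ξ)

theorem measurable_coord (i : Fin 3) : Measurable fun ξ : R3 => ξ i :=
  (EuclideanSpace.proj i : R3 →L[ℝ] ℝ).continuous.measurable

theorem abs_coord_le (ξ : R3) (i : Fin 3) : |ξ i| ≤ ‖ξ‖ := PiLp.norm_apply_le ξ i

/-- The symbol `(1 + |ξ|²)⁻¹`. -/
def besselSymbol : EvenSymbol where
  toFun := weight
  measurable' := continuous_weight.measurable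
  bounded' := ⟨1, fun ξ => by rw [abs_of_pos (weight_pos ξ)]; exact weight_le_one ξ⟩
  even' ξ := by simp [weight]

/-- The symbol `(1 + |ξ|²)⁻²`. -/
def smoothSymbol : EvenSymbol where
  toFun ξ := weight ξ ^ 2
  measurable' := (continuous_weight.pow 2).measurable
  bounded' := ⟨1, fun ξ => by
    rw [abs_of_nonneg (by positivity)]
    exact pow_le_one₀ (weight_pos ξ).le (weight_le_one ξ)⟩
  even' ξ := by simp [weight]

theorem indicator_closedBall_neg (R : ℝ) (g : R3 → ℝ) (hg : ∀ ξ, g (-ξ) = g ξ) (ξ : R3) :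
    (Metric.closedBall (0 : R3) R).indicator g (-ξ) =
      (Metric.closedBall (0 : R3) R).indicator g ξ := by
  simp [indicator, hg]

/-- The indicator function of a ball, as a symbol. -/
def ballSymbol (R : ℝ) : EvenSymbol where
  toFun := (Metric.closedBall (0 : R3) R).indicator fun _ => 1
  measurable' := measurable_const.indicator Metric.isClosed_closedBall.measurableSet
  bounded' := ⟨1, fun ξ => by
    unfold indicator; split_ifs <;> simp⟩
  even' ξ := indicator_closedBall_neg R _ (fun _ => rfl) ξ

/-- `|ξ|^α` is at most `1` inside the unit ball and at most `|ξ|⁴` outside. Here the upper bound on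
`α` enters. -/
theorem rpow_norm_mul_weight_sq_le {α : ℝ} (hα₀ : 0 < α) (hα₄ : α < 4) (ξ : R3) :
    (2 * Real.pi * ‖ξ‖) ^ α * weight ξ ^ 2 ≤ (2 * Real.pi) ^ α := by
  rw [Real.mul_rpow (by positivity) (norm_nonneg _), mul_assoc]
  refine mul_le_of_le_one_right (by positivity) ?_
  rw [weight, inv_pow, ← div_eq_mul_inv, div_le_one (by positivity)]
  rcases le_total ‖ξ‖ 1 with h | h
  · calc ‖ξ‖ ^ α ≤ 1 := Real.rpow_le_one (norm_nonneg _) h hα₀.le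
      _ ≤ (1 + ‖ξ‖ ^ 2) ^ 2 := one_le_pow₀ (by nlinarith [sq_nonneg ‖ξ‖])
  · calc ‖ξ‖ ^ α ≤ ‖ξ‖ ^ (4 : ℝ) := Real.rpow_le_rpow_of_exponent_le h hα₄.le
      _ = (‖ξ‖ ^ 2) ^ 2 := by
        rw [← pow_mul, show (4 : ℝ) = ((4 : ℕ) : ℝ) by norm_num, Real.rpow_natCast]
      _ ≤ (1 + ‖ξ‖ ^ 2) ^ 2 := by gcongr; linarith

/-- The symbol `(2π|ξ|)^α (1 + |ξ|²)⁻²`. -/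
def fracSymbol (α : ℝ) (hα₀ : 0 < α) (hα₄ : α < 4) : EvenSymbol where
  toFun ξ := (2 * Real.pi * ‖ξ‖) ^ α * weight ξ ^ 2
  measurable' := ((measurable_norm.const_mul _).pow_const α).mul
    (continuous_weight.pow 2).measurable
  bounded' := ⟨(2 * Real.pi) ^ α, fun ξ => by
    rw [abs_of_nonneg (by positivity)]
    exact rpow_norm_mul_weight_sq_le hα₀ hα₄ ξ⟩
  even' ξ := by simp [weight]

/-- The symbol `(2π|ξ|)^(α/2)` on a ball. -/
def truncSymbol (α : ℝ) (hα₀ : 0 < α) (R : ℝ) : EvenSymbol where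
  toFun := (Metric.closedBall (0 : R3) R).indicator fun ξ => (2 * Real.pi * ‖ξ‖) ^ (α / 2)
  measurable' := ((measurable_norm.const_mul _).pow_const _).indicator
    Metric.isClosed_closedBall.measurableSet
  bounded' := ⟨|(2 * Real.pi * R) ^ (α / 2)|, fun ξ => by
    unfold indicator
    split_ifs with h
    · rw [mem_closedBall_zero_iff] at h
      have h0 : (0 : ℝ) ≤ (2 * Real.pi * ‖ξ‖) ^ (α / 2) := by positivity
      refine abs_le_abs_of_nonneg h0 (Real.rpow_le_rpow (by positivity) (by gcongr) (by linarith))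
    · simp⟩
  even' ξ := indicator_closedBall_neg R _ (fun _ => by simp) ξ

theorem abs_coord_mul_div_le (i k : Fin 3) (ξ : R3) : |ξ i * ξ k / ‖ξ‖ ^ 2| ≤ 1 := by
  rw [abs_div, abs_mul, abs_of_nonneg (sq_nonneg ‖ξ‖)]
  refine div_le_one_of_le₀ ?_ (by positivity)
  rw [sq]
  exact mul_le_mul (abs_coord_le ξ i) (abs_coord_le ξ k) (abs_nonneg _) (norm_nonneg _)

theorem measurable_coord_mul_div (i k : Fin 3) :
    Measurable fun ξ : R3 => ξ i * ξ k / ‖ξ‖ ^ 2 :=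
  ((measurable_coord i).mul (measurable_coord k)).div (measurable_norm.pow_const 2)

/-- The symbol `ξᵢ ξₖ / |ξ|²`. -/
def rieszSymbol (i k : Fin 3) : EvenSymbol where
  toFun ξ := ξ i * ξ k / ‖ξ‖ ^ 2
  measurable' := measurable_coord_mul_div i k
  bounded' := ⟨1, abs_coord_mul_div_le i k⟩
  even' ξ := by simp

/-- The symbol `(1 + |ξ|²)⁻²`, as a decaying symbol. -/
def smoothDecay : DecaySymbol :=
  .ofLe (fun ξ => ((weight ξ ^ 2 : ℝ) : ℂ))
    (Complex.measurable_ofReal.comp (continuous_weight.pow 2).measurable) 1 fun ξ => by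
      rw [Complex.norm_real, Real.norm_of_nonneg (by positivity), sq, one_mul]
      exact mul_le_of_le_one_left (weight_pos ξ).le (weight_le_one ξ)

/-- The symbol of `∂ⱼ` times `(1 + |ξ|²)⁻²`. -/
def gradDecay (j : Fin 3) : DecaySymbol :=
  .ofLe (fun ξ => 2 * Real.pi * Complex.I * (ξ j : ℝ) * ((weight ξ ^ 2 : ℝ) : ℂ))
    ((measurable_const.mul (Complex.measurable_ofReal.comp (measurable_coord j))).mul
      (Complex.measurable_ofReal.comp (continuous_weight.pow 2).measurable)) (2 * Real.pi)
    fun ξ => by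
      simp only [norm_mul, Complex.norm_real, Complex.norm_I, Complex.norm_ofNat, mul_one, norm_pow,
        Real.norm_of_nonneg (weight_pos ξ).le, Real.norm_of_nonneg Real.pi_pos.le, Real.norm_eq_abs]
      have h1 : |ξ j| * weight ξ ≤ 1 := by
        refine le_trans ?_ (norm_mul_weight_le ξ)
        gcongr
        · exact (weight_pos ξ).le
        · exact abs_coord_le ξ j
      calc 2 * Real.pi * |ξ j| * weight ξ ^ 2 = 2 * Real.pi * (|ξ j| * weight ξ) * weight ξ := by
            ring
        _ ≤ 2 * Real.pi * 1 * weight ξ := by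
            have := (weight_pos ξ).le
            gcongr
        _ = _ := by ring

/-- The symbol `ξᵢ ξⱼ / |ξ|²` times `(1 + |ξ|²)⁻²`. -/
def rieszDecay (i j : Fin 3) : DecaySymbol :=
  .ofLe (fun ξ => ((ξ i * ξ j / ‖ξ‖ ^ 2 * weight ξ ^ 2 : ℝ) : ℂ))
    (Complex.measurable_ofReal.comp
      ((measurable_coord_mul_div i j).mul (continuous_weight.pow 2).measurable)) 1 fun ξ => by
      rw [Complex.norm_real, norm_mul, one_mul, Real.norm_eq_abs, norm_pow,
        Real.norm_of_nonneg (weight_pos ξ).le]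
      have h1 := abs_coord_mul_div_le i j ξ
      have h2 := weight_pos ξ
      have h3 := weight_le_one ξ
      calc _ ≤ 1 * (weight ξ * 1) := by
            rw [sq (weight ξ)]; gcongr
        _ = _ := by ring

/-- The symbol `(2π|ξ|)^α` times `(1 + |ξ|²)⁻⁴`. -/
def fracDecay (α : ℝ) (hα₀ : 0 < α) (hα₄ : α < 4) : DecaySymbol :=
  .ofLe (fun ξ => (((2 * Real.pi * ‖ξ‖) ^ α * weight ξ ^ 2 * weight ξ ^ 2 : ℝ) : ℂ))
    (Complex.measurable_ofReal.comp ((fracSymbol α hα₀ hα₄).measurable.mul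
      (continuous_weight.pow 2).measurable)) ((2 * Real.pi) ^ α) fun ξ => by
      rw [Complex.norm_real, Real.norm_of_nonneg (by positivity)]
      have h1 := rpow_norm_mul_weight_sq_le hα₀ hα₄ ξ
      have h2 := weight_pos ξ
      have h3 := weight_le_one ξ
      calc _ ≤ (2 * Real.pi) ^ α * (weight ξ * 1) := by
            rw [sq (weight ξ)] at *; gcongr
        _ = _ := by ring

/-- The indicator function of a ball, as a decaying symbol. -/
def ballDecay (R : ℝ) : DecaySymbol where
  toFun ξ := (ballSymbol R ξ : ℝ)
  bounded' := ⟨(ballSymbol R).bound, fun ξ => by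
    rw [Complex.norm_real]; exact (ballSymbol R).abs_le ξ⟩
  memLp' := by
    have h : MemLp (ballSymbol R) 2 (volume : Measure R3) :=
      memLp_indicator_const 2 Metric.isClosed_closedBall.measurableSet 1
        (.inr (isCompact_closedBall _ _).measure_lt_top.ne)
    exact h.ofReal

end Symbols

/-! ### Scalar multipliers and the projection on gradients -/

section FieldMultipliers

theorem ext_hatL_ae {v w : L2Field} (h : ∀ i, hatL i v =ᵐ[volume] hatL i w) : v = w :=
  ext_hatL fun i => Lp.ext (h i)

theorem coeFn_hatL_matrixMultiplier (m : Fin 3 → Fin 3 → EvenSymbol) (i : Fin 3) (v : L2Field) :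
    hatL i (matrixMultiplier m v) =ᵐ[volume] fun ξ => ∑ k, (m i k ξ : ℂ) * hatL k v ξ := by
  rw [hatL_matrixMultiplier, Fin.sum_univ_three]
  filter_upwards [Lp.coeFn_add ((m i 0).mulL (hatL 0 v) + (m i 1).mulL (hatL 1 v))
    ((m i 2).mulL (hatL 2 v)), Lp.coeFn_add ((m i 0).mulL (hatL 0 v)) ((m i 1).mulL (hatL 1 v)),
    (m i 0).coeFn_mulL (hatL 0 v), (m i 1).coeFn_mulL (hatL 1 v), (m i 2).coeFn_mulL (hatL 2 v)]
    with ξ h1 h2 h3 h4 h5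
  rw [h1, Pi.add_apply, h2, Pi.add_apply, h3, h4, h5, Fin.sum_univ_three]

/-- The zero symbol. -/
instance : Zero EvenSymbol :=
  ⟨{ toFun := fun _ => 0, measurable' := measurable_const, bounded' := ⟨0, by simp⟩,
     even' := fun _ => rfl }⟩

theorem EvenSymbol.zero_apply (ξ : R3) : (0 : EvenSymbol) ξ = 0 := rfl

/-- The Fourier multiplier on vector fields with a scalar symbol. -/
def scalarMultiplier (m : EvenSymbol) : L2Field →L[ℝ] L2Field :=
  matrixMultiplier fun i k => if i = k then m else 0

theorem coeFn_hatL_scalarMultiplier (m : EvenSymbol) (i : Fin 3) (v : L2Field) :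
    hatL i (scalarMultiplier m v) =ᵐ[volume] fun ξ => (m ξ : ℂ) * hatL i v ξ := by
  filter_upwards [coeFn_hatL_matrixMultiplier (fun i k => if i = k then m else 0) i v] with ξ h
  rw [scalarMultiplier, h, Finset.sum_eq_single i]
  · simp
  · intro j _ hj
    simp [hj.symm, EvenSymbol.zero_apply]
  · simp

/-- The orthogonal projection on gradient fields. -/
def gradProj : L2Field →L[ℝ] L2Field := matrixMultiplier rieszSymbol

theorem coeFn_hatL_gradProj (i : Fin 3) (v : L2Field) :
    hatL i (gradProj v) =ᵐ[volume]
      fun ξ => ((ξ i / ‖ξ‖ ^ 2 : ℝ) : ℂ) * ∑ k, (ξ k : ℂ) * hatL k v ξ := by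
  filter_upwards [coeFn_hatL_matrixMultiplier rieszSymbol i v] with ξ h
  rw [gradProj, h, Finset.mul_sum]
  refine Finset.sum_congr rfl fun k _ => ?_
  change ((ξ i * ξ k / ‖ξ‖ ^ 2 : ℝ) : ℂ) * _ = _
  push_cast
  ring

theorem re_inner_eq (z w : ℂ) : (inner ℂ z w).re = (starRingEnd ℂ z * w).re := by
  rw [RCLike.inner_apply, mul_comm]

theorem L2C.integrable_re_inner (g h : L2C) :
    Integrable fun ξ => (starRingEnd ℂ (g ξ) * h ξ).re := by
  have hInt : Integrable (fun ξ => (inner ℂ (g ξ) (h ξ)).re) := (L2.integrable_inner (𝕜 := ℂ) g h).re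
  simpa only [re_inner_eq] using hInt

theorem L2C.re_inner_eq_integral (g h : L2C) :
    (inner ℂ g h).re = ∫ ξ, (starRingEnd ℂ (g ξ) * h ξ).re := by
  simp only [← re_inner_eq]
  rw [L2.inner_def]
  exact (integral_re (L2.integrable_inner (𝕜 := ℂ) g h)).symm

theorem inner_eq_integral_hatL (v w : L2Field) :
    inner ℝ v w = ∫ ξ, ∑ i, (starRingEnd ℂ (hatL i v ξ) * hatL i w ξ).re := by
  rw [inner_hatL, integral_finsetSum _ fun i _ => L2C.integrable_re_inner (hatL i v) (hatL i w)]
  exact Finset.sum_congr rfl fun i _ => L2C.re_inner_eq_integral _ _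

theorem inner_scalarMultiplier (m : EvenSymbol) (v w : L2Field) :
    inner ℝ (scalarMultiplier m v) w = inner ℝ v (scalarMultiplier m w) := by
  rw [inner_eq_integral_hatL, inner_eq_integral_hatL]
  refine integral_congr_ae ?_
  filter_upwards [ae_all_iff.2 fun i => coeFn_hatL_scalarMultiplier m i v,
    ae_all_iff.2 fun i => coeFn_hatL_scalarMultiplier m i w] with ξ h1 h2
  refine Finset.sum_congr rfl fun i _ => ?_
  rw [h1, h2, map_mul, Complex.conj_ofReal]
  congr 1
  ring

theorem scalarMultiplier_injective {m : EvenSymbol} (hm : ∀ ξ, m ξ ≠ 0) :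
    Function.Injective (scalarMultiplier m) := by
  intro v w h
  refine ext_hatL_ae fun i => ?_
  filter_upwards [coeFn_hatL_scalarMultiplier m i v, coeFn_hatL_scalarMultiplier m i w]
    with ξ h1 h2
  rw [h, h2] at h1
  exact (mul_left_cancel₀ (Complex.ofReal_ne_zero.2 (hm ξ)) h1).symm

theorem scalarMultiplier_comm (m : EvenSymbol) (v : L2Field) :
    scalarMultiplier m (gradProj v) = gradProj (scalarMultiplier m v) := by
  refine ext_hatL_ae fun i => ?_
  filter_upwards [coeFn_hatL_scalarMultiplier m i (gradProj v), coeFn_hatL_gradProj i v,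
    coeFn_hatL_gradProj i (scalarMultiplier m v),
    ae_all_iff.2 fun i => coeFn_hatL_scalarMultiplier m i v] with ξ h1 h2 h3 h4
  rw [h1, h2, h3]
  simp only [h4, Finset.mul_sum]
  exact Finset.sum_congr rfl fun k _ => by ring

theorem inner_gradProj (v w : L2Field) : inner ℝ (gradProj v) w = inner ℝ v (gradProj w) := by
  rw [inner_eq_integral_hatL, inner_eq_integral_hatL]
  refine integral_congr_ae ?_
  filter_upwards [ae_all_iff.2 fun i => coeFn_hatL_gradProj i v,
    ae_all_iff.2 fun i => coeFn_hatL_gradProj i w] with ξ h1 h2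
  simp only [h1, h2, map_mul, map_sum, Complex.conj_ofReal]
  rw [← Complex.re_sum, ← Complex.re_sum]
  congr 1
  simp only [Fin.sum_univ_three]
  push_cast
  ring

theorem gradProj_gradProj (v : L2Field) : gradProj (gradProj v) = gradProj v := by
  refine ext_hatL_ae fun i => ?_
  filter_upwards [coeFn_hatL_gradProj i (gradProj v),
    ae_all_iff.2 fun i => coeFn_hatL_gradProj i v] with ξ h1 h2
  rw [h1, h2 i]
  simp only [h2]
  -- At the origin both sides vanish, because division by zero gives zero.
  rcases eq_or_ne ξ 0 with rfl | hξ
  · simp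
  · have hn : (‖ξ‖ : ℂ) ≠ 0 := by simpa using hξ
    have hs : (‖ξ‖ : ℂ) ^ 2 = (ξ 0 : ℂ) ^ 2 + (ξ 1 : ℂ) ^ 2 + (ξ 2 : ℂ) ^ 2 := by
      rw [← Complex.ofReal_pow, EuclideanSpace.real_norm_sq_eq, Fin.sum_univ_three]
      push_cast
      ring
    congr 1
    simp only [Fin.sum_univ_three]
    push_cast
    field_simp
    rw [hs]
    ring

end FieldMultipliers

end

noncomputable section

/-! ### Divergence-free fields: distributional and frequency descriptions -/

section Divergence

open SchwartzMap

/-- The vector fields in `L²` with vanishing gradient part. -/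
def solenoidal : Submodule ℝ L2Field := LinearMap.ker (gradProj : L2Field →ₗ[ℝ] L2Field)

theorem mem_solenoidal {v : L2Field} : v ∈ solenoidal ↔ gradProj v = 0 := Iff.rfl

theorem isClosed_solenoidal : IsClosed (solenoidal : Set L2Field) :=
  isClosed_singleton.preimage gradProj.continuous

theorem ofReal_norm_sq (ξ : R3) : (‖ξ‖ : ℂ) ^ 2 = ∑ k, (ξ k : ℂ) ^ 2 := by
  rw [← Complex.ofReal_pow, EuclideanSpace.real_norm_sq_eq]
  push_cast
  rfl

/-- Contracting the transform of `gradProj v` with `ξ` returns `ξ · v̂` away from the origin, a null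
set. -/
theorem mem_solenoidal_iff {v : L2Field} :
    v ∈ solenoidal ↔ ∀ᵐ ξ, ∑ k, (ξ k : ℂ) * hatL k v ξ = 0 := by
  rw [mem_solenoidal]
  constructor
  · intro h
    have h0 : ∀ i, hatL i (gradProj v) =ᵐ[volume] 0 := fun i => by
      rw [h, map_zero]
      exact Lp.coeFn_zero _ _ _
    have hne : ∀ᵐ ξ : R3, ξ ≠ 0 := by
      rw [ae_iff]
      simp
    filter_upwards [ae_all_iff.2 h0, ae_all_iff.2 fun i => coeFn_hatL_gradProj i v, hne]
      with ξ h1 h2 h3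
    have h4 : ∀ i, ((ξ i / ‖ξ‖ ^ 2 : ℝ) : ℂ) * ∑ k, (ξ k : ℂ) * hatL k v ξ = 0 := fun i => by
      rw [← h2, h1]; rfl
    have hn : (‖ξ‖ : ℂ) ≠ 0 := by simpa using h3
    have h5 : ∑ i, (ξ i : ℂ) * (((ξ i / ‖ξ‖ ^ 2 : ℝ) : ℂ) * ∑ k, (ξ k : ℂ) * hatL k v ξ) =
        ∑ k, (ξ k : ℂ) * hatL k v ξ := by
      simp only [← mul_assoc]
      rw [← Finset.sum_mul]
      have : ∑ i, (ξ i : ℂ) * ((ξ i / ‖ξ‖ ^ 2 : ℝ) : ℂ) = 1 := by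
        push_cast
        simp only [← mul_div_assoc, ← Finset.sum_div, ← sq]
        rw [← ofReal_norm_sq, div_self (pow_ne_zero 2 hn)]
      rw [this, one_mul]
    rw [← h5]
    simp only [h4, mul_zero, Finset.sum_const_zero]
  · intro h
    refine ext_hatL_ae fun i => ?_
    rw [map_zero]
    filter_upwards [h, coeFn_hatL_gradProj i v, Lp.coeFn_zero ℂ 2 (volume : Measure R3)]
      with ξ h1 h2 h3
    rw [h2, h1, h3, mul_zero, Pi.zero_apply]

theorem inner_singleL (v : L2Field) (j : Fin 3) (g : L2C) :
    inner ℝ v (singleL j g) = (inner ℂ (componentL j v) g).re := by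
  rw [L2.inner_def, L2C.re_inner_eq_integral]
  refine integral_congr_ae ?_
  filter_upwards [coeFn_singleL j g, coeFn_componentL j v] with x h1 h2
  rw [h1, h2, inner_smul_right, EuclideanSpace.inner_single_right]
  simp [mul_comm]

/-- The unit vector in direction `j`. -/
def unitVec (j : Fin 3) : R3 := EuclideanSpace.single j (1 : ℝ)

theorem inner_unitVec (ξ : R3) (j : Fin 3) : inner ℝ ξ (unitVec j) = ξ j := by
  simp [unitVec, EuclideanSpace.inner_single_right]

theorem coeFn_fourier_lineDeriv (φ : 𝓢(R3, ℂ)) (j : Fin 3) :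
    (𝓕 ((∂_{unitVec j} φ).toLp 2) : L2C) =ᵐ[volume]
      fun ξ => 2 * Real.pi * Complex.I * (ξ j : ℝ) * 𝓕 φ ξ := by
  rw [toLp_fourier_eq]
  filter_upwards [(𝓕 (∂_{unitVec j} φ)).coeFn_toLp 2 volume] with ξ h
  rw [h, fourier_lineDerivOp_eq]
  have : (inner ℝ · (unitVec j) : R3 → ℝ).HasTemperateGrowth := by fun_prop
  rw [smul_apply, smulLeftCLM_apply_apply this, inner_unitVec]
  simp only [smul_eq_mul, Complex.real_smul]
  ring

/-- The gradient of the real part of a Schwartz function, as a vector field. -/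
def gradField (φ : 𝓢(R3, ℂ)) : L2Field := ∑ j, singleL j ((∂_{unitVec j} φ).toLp 2)

/-- Plancherel reading of the pairing with a gradient; the next lemma gives its reading in physical
space. Comparing the two links `solenoidal` with `IsDivFree` in both directions. -/
theorem inner_gradField (v : L2Field) (φ : 𝓢(R3, ℂ)) :
    inner ℝ v (gradField φ) = ∫ ξ, (starRingEnd ℂ (∑ j, (ξ j : ℂ) * hatL j v ξ) *
      (2 * Real.pi * Complex.I * 𝓕 φ ξ)).re := by
  have h : ∀ j, inner ℝ v (singleL j ((∂_{unitVec j} φ).toLp 2)) =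
      (inner ℂ (hatL j v) (𝓕 ((∂_{unitVec j} φ).toLp 2) : L2C)).re := fun j => by
    rw [inner_singleL, hatL_apply, Lp.inner_fourier_eq]
    rfl
  rw [gradField, inner_sum]
  simp only [h, L2C.re_inner_eq_integral]
  rw [← integral_finsetSum _ fun j _ => L2C.integrable_re_inner _ _]
  refine integral_congr_ae ?_
  filter_upwards [ae_all_iff.2 fun j => coeFn_fourier_lineDeriv φ j] with ξ hξ
  simp only [hξ]
  rw [← Complex.re_sum, map_sum, Finset.sum_mul]
  congr 1
  refine Finset.sum_congr rfl fun j _ => ?_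
  rw [map_mul, Complex.conj_ofReal]
  ring

theorem inner_gradField_eq_integral (v : L2Field) (φ : 𝓢(R3, ℂ)) :
    inner ℝ v (gradField φ) = ∫ x, (fderiv ℝ φ x (v x)).re := by
  have h : ∀ j, inner ℝ v (singleL j ((∂_{unitVec j} φ).toLp 2)) =
      ∫ x, (starRingEnd ℂ (componentL j v x) * ((∂_{unitVec j} φ).toLp 2 : L2C) x).re := fun j => by
    rw [inner_singleL, L2C.re_inner_eq_integral]
  rw [gradField, inner_sum]
  simp only [h]
  rw [← integral_finsetSum _ fun j _ => L2C.integrable_re_inner _ _]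
  refine integral_congr_ae ?_
  filter_upwards [ae_all_iff.2 fun j => coeFn_componentL j v,
    ae_all_iff.2 fun j => (∂_{unitVec j} φ).coeFn_toLp 2 volume] with x h1 h2
  simp only [h1, h2, lineDerivOp_apply_eq_fderiv, Complex.conj_ofReal, Complex.re_ofReal_mul]
  have hv : v x = ∑ j, (v x j) • unitVec j := by
    ext k
    fin_cases k <;> simp [Fin.sum_univ_three, unitVec]
  conv_rhs => rw [hv]
  rw [map_sum, Complex.re_sum]
  refine Finset.sum_congr rfl fun j _ => ?_
  rw [map_smul, Complex.real_smul, Complex.re_ofReal_mul]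

theorem isDivFree_of_mem_solenoidal {v : L2Field} (hv : v ∈ solenoidal) : IsDivFree v := by
  intro ψ hψ hψs
  let φ : 𝓢(R3, ℂ) := HasCompactSupport.toSchwartzMap (f := fun x => ((ψ x : ℝ) : ℂ))
    (hψs.comp_left (g := fun r : ℝ => (r : ℂ)) Complex.ofReal_zero)
    (Complex.ofRealCLM.contDiff.comp hψ)
  have hd : ∀ x, fderiv ℝ φ x = Complex.ofRealCLM ∘L fderiv ℝ ψ x := fun x =>
    (Complex.ofRealCLM.hasFDerivAt.comp x
      (hψ.differentiable (by simp) x).hasFDerivAt).fderiv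
  have h1 := inner_gradField_eq_integral v φ
  have h2 : inner ℝ v (gradField φ) = 0 := by
    rw [inner_gradField, integral_eq_zero_of_ae]
    filter_upwards [mem_solenoidal_iff.1 hv] with ξ hξ
    rw [hξ]
    simp
  rw [h2] at h1
  rw [h1]
  simp [hd]

/-- A sequence of smooth cut-off functions. -/
theorem exists_cutoff : ∃ (χ : ℕ → R3 → ℝ) (C : ℝ), (∀ n, ContDiff ℝ (⊤ : ℕ∞) (χ n)) ∧
    (∀ n, HasCompactSupport (χ n)) ∧ (∀ n x, |χ n x| ≤ 1) ∧
    (∀ n x, ‖fderiv ℝ (χ n) x‖ ≤ C / (n + 1)) ∧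
    ∀ x, Filter.Tendsto (fun n => χ n x) Filter.atTop (nhds 1) := by
  let b : ContDiffBump (0 : R3) := ⟨1, 2, one_pos, one_lt_two⟩
  have hbc : HasCompactSupport (fderiv ℝ b) := b.hasCompactSupport.fderiv (𝕜 := ℝ)
  obtain ⟨C, hC⟩ := hbc.exists_bound_of_continuous
    (b.contDiff (n := 1).continuous_fderiv one_ne_zero)
  have hd : ∀ (n : ℕ) (x : R3), HasFDerivAt (fun x => b (((n : ℝ) + 1)⁻¹ • x))
      (fderiv ℝ b (((n : ℝ) + 1)⁻¹ • x) ∘L (((n : ℝ) + 1)⁻¹ • ContinuousLinearMap.id ℝ R3)) x :=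
    fun n x => ((b.contDiff (n := 1)).differentiable one_ne_zero _).hasFDerivAt.comp x
      ((((n : ℝ) + 1)⁻¹ • ContinuousLinearMap.id ℝ R3).hasFDerivAt)
  refine ⟨fun n x => b (((n : ℝ) + 1)⁻¹ • x), C, fun n => ?_, fun n => ?_, fun n x => ?_,
    fun n x => ?_, fun x => ?_⟩
  · exact b.contDiff.comp (((n : ℝ) + 1)⁻¹ • ContinuousLinearMap.id ℝ R3).contDiff
  · exact b.hasCompactSupport.comp_smul (by positivity)
  · rw [abs_of_nonneg b.nonneg]
    exact b.le_one
  · rw [(hd n x).fderiv]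
    refine (ContinuousLinearMap.opNorm_comp_le _ _).trans ?_
    rw [norm_smul, Real.norm_of_nonneg (by positivity), div_eq_mul_inv]
    have h1 : ‖ContinuousLinearMap.id ℝ R3‖ ≤ 1 := ContinuousLinearMap.norm_id_le
    have h2 := hC (((n : ℝ) + 1)⁻¹ • x)
    have h3 : 0 ≤ C := (norm_nonneg _).trans h2
    calc _ ≤ C * (((n : ℝ) + 1)⁻¹ * 1) := by gcongr
      _ = _ := by ring
  · refine tendsto_const_nhds.congr' ?_
    obtain ⟨N, hN⟩ := exists_nat_ge ‖x‖
    filter_upwards [Filter.eventually_ge_atTop N] with n hn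
    refine (b.one_of_mem_closedBall ?_).symm
    rw [mem_closedBall_zero_iff, norm_smul, Real.norm_of_nonneg (by positivity),
      inv_mul_le_iff₀ (by positivity)]
    have : (N : ℝ) ≤ n := by exact_mod_cast hn
    change ‖x‖ ≤ ((n : ℝ) + 1) * 1
    linarith

/-- Extends the test functions from compactly supported to Schwartz ones by cut-off. The term with
the gradient of the cut-off tends to zero, and the dominating functions are products of two square
integrable functions. -/
theorem IsDivFree.inner_gradField {v : L2Field} (hv : IsDivFree v) (φ : 𝓢(R3, ℂ)) :
    inner ℝ v (gradField φ) = 0 := by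
  rw [inner_gradField_eq_integral]
  obtain ⟨χ, C, hχ, hχs, hχ1, hχ', hχt⟩ := exists_cutoff
  let ψ : R3 → ℝ := fun x => (φ x).re
  have hψ : ContDiff ℝ (⊤ : ℕ∞) ψ := Complex.reCLM.contDiff.comp (φ.smooth ⊤)
  have hψd : ∀ x, HasFDerivAt ψ (Complex.reCLM ∘L fderiv ℝ φ x) x := fun x =>
    Complex.reCLM.hasFDerivAt.comp x φ.differentiableAt.hasFDerivAt
  have h0 : ∀ n, ∫ x, (χ n x * (fderiv ℝ φ x (v x)).re + ψ x * fderiv ℝ (χ n) x (v x)) = 0 := by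
    intro n
    rw [← hv (fun x => χ n x * ψ x) ((hχ n).mul hψ) ((hχs n).mul_right)]
    refine integral_congr_ae (Filter.Eventually.of_forall fun x => ?_)
    have := (((hχ n).differentiable (by simp) x).hasFDerivAt.mul (hψd x)).fderiv
    change _ = fderiv ℝ (χ n * ψ) x (v x)
    rw [this]
    simp
  have hC : 0 ≤ C := by
    have h := (norm_nonneg _).trans (hχ' 0 0)
    simpa using h
  have hint1 : Integrable fun x => ‖fderiv ℝ φ x‖ * ‖v x‖ := by
    have h : MemLp (fun x => ‖fderiv ℝ φ x‖) 2 volume :=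
      ((fderivCLM ℝ R3 ℂ φ).memLp 2 volume).norm
    exact h.integrable_mul (Lp.memLp v).norm
  have hint2 : Integrable fun x => ‖φ x‖ * ‖v x‖ :=
    (φ.memLp 2 volume).norm.integrable_mul (Lp.memLp v).norm
  have hlim := tendsto_integral_of_dominated_convergence
    (F := fun n x => χ n x * (fderiv ℝ φ x (v x)).re + ψ x * fderiv ℝ (χ n) x (v x))
    (f := fun x => (fderiv ℝ φ x (v x)).re) (μ := (volume : Measure R3))
    (fun x => ‖fderiv ℝ φ x‖ * ‖v x‖ + C * (‖φ x‖ * ‖v x‖)) (fun n => ?_)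
    (hint1.add (hint2.const_mul C)) (fun n => Filter.Eventually.of_forall fun x => ?_)
    (Filter.Eventually.of_forall fun x => ?_)
  · simp only [h0] at hlim
    exact (tendsto_nhds_unique hlim tendsto_const_nhds)
  · have hv' := Lp.aestronglyMeasurable v
    have e1 : AEStronglyMeasurable (fun x => (fderiv ℝ φ x (v x)).re) volume :=
      Complex.continuous_re.comp_aestronglyMeasurable
        (isBoundedBilinearMap_apply.continuous.comp_aestronglyMeasurable
          ((fderivCLM ℝ R3 ℂ φ).continuous.aestronglyMeasurable.prodMk hv'))
    have e2 : AEStronglyMeasurable (fun x => fderiv ℝ (χ n) x (v x)) volume :=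
      isBoundedBilinearMap_apply.continuous.comp_aestronglyMeasurable
        (((hχ n).continuous_fderiv (by simp)).aestronglyMeasurable.prodMk hv')
    exact ((hχ n).continuous.aestronglyMeasurable.mul e1).add
      (hψ.continuous.aestronglyMeasurable.mul e2)
  · refine (norm_add_le _ _).trans (add_le_add ?_ ?_)
    · rw [norm_mul]
      calc _ ≤ 1 * (‖fderiv ℝ φ x‖ * ‖v x‖) := by
            gcongr
            · exact hχ1 n x
            · exact (Complex.abs_re_le_norm _).trans (ContinuousLinearMap.le_opNorm _ _)
        _ = _ := one_mul _
    · rw [norm_mul]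
      have h1 : ‖ψ x‖ ≤ ‖φ x‖ := Complex.abs_re_le_norm _
      have h2 : ‖fderiv ℝ (χ n) x‖ ≤ C := (hχ' n x).trans (div_le_self hC (by linarith [n.cast_nonneg (α := ℝ)]))
      calc _ ≤ ‖φ x‖ * (C * ‖v x‖) := by
            gcongr
            exact (ContinuousLinearMap.le_opNorm _ _).trans (by gcongr)
        _ = _ := by ring
  · have h1 : Filter.Tendsto (fun n : ℕ => fderiv ℝ (χ n) x (v x)) Filter.atTop (nhds 0) := by
      have h2 : Filter.Tendsto (fun n : ℕ => C / ((n : ℝ) + 1) * ‖v x‖) Filter.atTop (nhds 0) := by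
        have := (tendsto_const_div_atTop_nhds_zero_nat C).comp (Filter.tendsto_add_atTop_nat 1)
        simpa [Function.comp_def] using this.mul_const ‖v x‖
      refine squeeze_zero_norm (fun n => ?_) h2
      exact (ContinuousLinearMap.le_opNorm _ _).trans (by gcongr; exact hχ' n x)
    simpa using ((hχt x).mul_const (fderiv ℝ φ x (v x)).re).add (h1.const_mul (ψ x))

/-- Testing with the inverse Fourier transform of an arbitrary bump function `η` shows that the
locally integrable function `ξ · v̂` vanishes as a distribution. -/
theorem IsDivFree.mem_solenoidal {v : L2Field} (hv : IsDivFree v) : v ∈ solenoidal := by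
  rw [mem_solenoidal_iff]
  let D : R3 → ℂ := fun ξ => starRingEnd ℂ (∑ j, (ξ j : ℂ) * hatL j v ξ)
  have hloc : LocallyIntegrable D := by
    have h1 : ∀ j, LocallyIntegrable (fun ξ : R3 => (ξ j : ℂ) * starRingEnd ℂ (hatL j v ξ)) :=
      fun j => by
        have h2 : MemLp (fun ξ => starRingEnd ℂ (hatL j v ξ)) 2 volume :=
          (memLp_congr_ae (coeFn_conjL (hatL j v))).1 (Lp.memLp _)
        refine (h2.locallyIntegrable (by norm_num)).continuous_mul ?_
        exact Complex.continuous_ofReal.comp (EuclideanSpace.proj j : R3 →L[ℝ] ℝ).continuous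
    have h3 : D = fun ξ : R3 => ∑ j, (ξ j : ℂ) * starRingEnd ℂ (hatL j v ξ) := by
      ext ξ
      simp [D]
    rw [h3]
    simp only [Fin.sum_univ_three]
    exact ((h1 0).add (h1 1)).add (h1 2)
  have hzero : ∀ᵐ ξ, D ξ = 0 := by
    refine ae_eq_zero_of_integral_contDiff_smul_eq_zero hloc fun η hη hηs => ?_
    let θ : 𝓢(R3, ℂ) := HasCompactSupport.toSchwartzMap (f := fun x => ((η x : ℝ) : ℂ))
      (hηs.comp_left (g := fun r : ℝ => (r : ℂ)) Complex.ofReal_zero)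
      (Complex.ofRealCLM.contDiff.comp hη)
    have hθ : ∀ ξ, θ ξ = (η ξ : ℂ) := fun ξ => rfl
    have hpi : (2 * Real.pi * Complex.I : ℂ) ≠ 0 := by
      simp [Real.pi_ne_zero]
    have hInt : Integrable fun ξ => η ξ • D ξ :=
      hloc.integrable_smul_left_of_hasCompactSupport hη.continuous hηs
    -- The pairing only controls a real part; the choices `c = 1` and `c = -i` recover the real and
    -- imaginary parts of the integral.
    have key : ∀ c : ℂ, (c * ∫ ξ, η ξ • D ξ).re = 0 := fun c => by
      have h1 := hv.inner_gradField (𝓕⁻ ((c / (2 * Real.pi * Complex.I)) • θ))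
      rw [_root_.inner_gradField, FourierTransform.fourier_fourierInv_eq] at h1
      rw [← integral_const_mul, ← h1]
      refine Eq.trans (integral_re (hInt.const_mul c)).symm ?_
      refine integral_congr_ae (Filter.Eventually.of_forall fun ξ => ?_)
      change (c * (η ξ • D ξ)).re = (D ξ * (2 * Real.pi * Complex.I *
        ((c / (2 * Real.pi * Complex.I)) • θ) ξ)).re
      rw [smul_apply, hθ, Complex.real_smul, smul_eq_mul, ← mul_assoc (2 * Real.pi * Complex.I : ℂ),
        mul_div_cancel₀ _ hpi]
      congr 1
      ring
    have h1 := key 1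
    have h2 := key (-Complex.I)
    rw [one_mul] at h1
    refine Complex.ext h1 ?_
    simpa using h2
  filter_upwards [hzero] with ξ hξ
  exact (map_eq_zero (starRingEnd ℂ)).1 hξ

end Divergence

end

noncomputable section

/-! ### The convective term and its cancellation -/

section Convection

open DecaySymbol Filter

/-- A component of a vector field whose Fourier transform is `κ g` is given by `synth`. -/
theorem coeFn_of_hatL {v : L2Field} {j : Fin 3} {κ : DecaySymbol} {g : L2C}
    (h : hatL j v =ᵐ[volume] fun ξ => κ ξ * g ξ) :
    (fun x => v x j) =ᵐ[volume] fun x => (κ.synth g x).re := by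
  have h1 : hatL j v = (κ.memLp_mul g).toLp _ := by
    ext1
    exact h.trans (κ.memLp_mul g).coeFn_toLp.symm
  have h2 : componentL j v = 𝓕⁻ ((κ.memLp_mul g).toLp _) := by
    rw [← h1, hatL_apply, FourierTransform.fourierInv_fourier_eq]
    rfl
  filter_upwards [coeFn_componentL j v, κ.coeFn_fourierInv_mul g] with x h3 h4
  rw [← h4, ← h2, h3, Complex.ofReal_re]

/-- The smoothing operator `(1 - Δ / 4π²)⁻²`. -/
def smoothing : L2Field →L[ℝ] L2Field := scalarMultiplier smoothSymbol

theorem coeFn_hatL_smoothing (i : Fin 3) (v : L2Field) :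
    hatL i (smoothing v) =ᵐ[volume] fun ξ => smoothDecay ξ * hatL i v ξ :=
  coeFn_hatL_scalarMultiplier smoothSymbol i v

theorem coeFn_smoothing (v : L2Field) (i : Fin 3) :
    (fun x => smoothing v x i) =ᵐ[volume] fun x => (smoothDecay.synth (hatL i v) x).re :=
  coeFn_of_hatL (coeFn_hatL_smoothing i v)

/-- The map `(v, u) ↦ (D w) u` for `w = smoothing v`. -/
def convection : L2Field →L[ℝ] L2Field →L[ℝ] L2Field :=
  ∑ i, ∑ j, (entryL i j (gradDecay j)) ∘L hatL i

theorem convection_apply (v u : L2Field) :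
    convection v u = ∑ i, ∑ j, entryL i j (gradDecay j) (hatL i v) u := by
  simp [convection]

theorem inner_convection (v u' u : L2Field) :
    inner ℝ u' (convection v u) =
      ∑ i, ∑ j, ∫ x, ((gradDecay j).synth (hatL i v) x).re * (u' x i * u x j) := by
  rw [convection_apply, inner_sum]
  refine Finset.sum_congr rfl fun i _ => ?_
  rw [inner_sum]
  exact Finset.sum_congr rfl fun j _ => inner_entryL i j _ _ _ _

theorem hasFDerivAt_synth_smoothDecay (g : L2C) (x : R3) :
    ∃ L : R3 →L[ℝ] ℝ, HasFDerivAt (fun y => (smoothDecay.synth g y).re) L x ∧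
      ∀ j, L (unitVec j) = ((gradDecay j).synth g x).re := by
  have hInt : Integrable fun ξ => ‖ξ‖ * ‖smoothDecay ξ * g ξ‖ := by
    let κ : DecaySymbol := .ofLe (fun ξ => ((‖ξ‖ * weight ξ ^ 2 : ℝ) : ℂ))
      (Complex.measurable_ofReal.comp (measurable_norm.mul (continuous_weight.pow 2).measurable)) 1
      fun ξ => by
        rw [Complex.norm_real, Real.norm_of_nonneg (by positivity), sq, ← mul_assoc]
        exact mul_le_mul_of_nonneg_right (norm_mul_weight_le ξ) (weight_pos ξ).le
    refine (κ.integrable_mul g).norm.congr (Eventually.of_forall fun ξ => ?_)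
    change ‖((‖ξ‖ * weight ξ ^ 2 : ℝ) : ℂ) * g ξ‖ = ‖ξ‖ * ‖((weight ξ ^ 2 : ℝ) : ℂ) * g ξ‖
    rw [norm_mul, norm_mul, Complex.norm_real, Complex.norm_real, norm_mul, norm_norm, mul_assoc]
  obtain ⟨L, hL, hLm⟩ := fourierInv_hasFDerivAt (smoothDecay.integrable_mul g) hInt x
  refine ⟨Complex.reCLM ∘L L, Complex.reCLM.hasFDerivAt.comp x hL, fun j => ?_⟩
  rw [ContinuousLinearMap.comp_apply, hLm, Complex.reCLM_apply]
  congr 1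
  refine Real.fourierInv_congr_ae (Eventually.of_forall fun ξ => ?_) x
  change _ = (2 * Real.pi * Complex.I * (ξ j : ℝ) * ((weight ξ ^ 2 : ℝ) : ℂ)) * g ξ
  rw [inner_unitVec, mul_assoc _ _ (g ξ)]
  rfl

theorem integrable_synth_mul_mul (κ₁ κ₂ κ₃ : DecaySymbol) (g₁ g₂ g₃ : L2C) :
    Integrable fun x => (κ₁.synth g₁ x).re * ((κ₂.synth g₂ x).re * (κ₃.synth g₃ x).re) := by
  have h : Integrable fun x => (κ₂.synth g₂ x).re * (κ₃.synth g₃ x).re :=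
    (κ₂.memLp_synth g₂).re.integrable_mul (κ₃.memLp_synth g₃).re
  exact h.bdd_mul (Complex.continuous_re.comp (κ₁.continuous_synth g₁)).aestronglyMeasurable
    (Eventually.of_forall fun x => (Complex.abs_re_le_norm _).trans (κ₁.norm_synth_le g₁ x))

theorem sum_synth_gradDecay {v : L2Field} (hv : v ∈ solenoidal) (x : R3) :
    ∑ j, (gradDecay j).synth (hatL j v) x = 0 := by
  simp only [synth]
  have hd := mem_solenoidal_iff.1 hv
  simp only [Real.fourierInv_eq']
  rw [← integral_finsetSum]
  · refine integral_eq_zero_of_ae ?_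
    filter_upwards [hd] with ξ hξ
    rw [← Finset.smul_sum, smul_eq_mul]
    have : ∑ j, gradDecay j ξ * hatL j v ξ =
        2 * Real.pi * Complex.I * ((weight ξ ^ 2 : ℝ) : ℂ) * ∑ j, (ξ j : ℂ) * hatL j v ξ := by
      rw [Finset.mul_sum]
      refine Finset.sum_congr rfl fun j _ => ?_
      change (2 * Real.pi * Complex.I * (ξ j : ℝ) * ((weight ξ ^ 2 : ℝ) : ℂ)) * _ = _
      ring
    rw [this, hξ]
    simp
  · intro j _
    refine ((gradDecay j).integrable_mul (hatL j v)).bdd_mul (c := 1) ?_ ?_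
    · exact Continuous.aestronglyMeasurable (by fun_prop)
    · exact Eventually.of_forall fun ξ => by rw [Complex.norm_exp_ofReal_mul_I]

/-- With `W` the smoothed field, `∑ⱼ Wᵢ Wⱼ ∂ⱼWᵢ = ½ ∑ⱼ Wⱼ ∂ⱼ(Wᵢ²)`, and integration by parts moves
the derivatives onto `div W = 0`. Smoothing makes all the products integrable: one factor is bounded
and the other two are in `L²`. -/
theorem inner_convection_self {v : L2Field} (hv : v ∈ solenoidal) :
    inner ℝ (smoothing v) (convection v (smoothing v)) = 0 := by
  set W : Fin 3 → R3 → ℝ := fun i x => (smoothDecay.synth (hatL i v) x).re with hW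
  set G : Fin 3 → Fin 3 → R3 → ℝ := fun i j x => ((gradDecay j).synth (hatL i v) x).re with hG
  choose L hL hLG using fun i x => hasFDerivAt_synth_smoothDecay (hatL i v) x
  have hparts : ∀ i j, ∫ x, W i x ^ 2 * G j j x = - ∫ x, 2 * (G i j x * (W i x * W j x)) := by
    intro i j
    have hWd : ∀ i x, fderiv ℝ (W i) x = L i x := fun i x => (hL i x).fderiv
    have hsq : ∀ x, fderiv ℝ (fun x => W i x ^ 2) x (unitVec j) = 2 * (W i x * G i j x) := by
      intro x
      have := ((hL i x).pow 2).fderiv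
      change fderiv ℝ (fun x => (smoothDecay.synth (hatL i v) x).re ^ 2) x (unitVec j) = _
      rw [this]
      simp [hLG, hW, hG]
      ring
    have e1 : ∀ x, fderiv ℝ (fun x => W i x ^ 2) x (unitVec j) * W j x =
        2 * (G i j x * (W i x * W j x)) := fun x => by rw [hsq]; ring
    have e2 : ∀ x, W i x ^ 2 * fderiv ℝ (W j) x (unitVec j) = W i x ^ 2 * G j j x := fun x => by
      rw [hWd, hLG]
    have h := integral_mul_fderiv_eq_neg_fderiv_mul_of_integrable (μ := (volume : Measure R3))
      (f := fun x => W i x ^ 2) (g := W j) (v := unitVec j) ?_ ?_ ?_ ?_ ?_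
    · simpa only [e1, e2] using h
    · simp only [e1]
      exact (integrable_synth_mul_mul _ _ _ _ _ _).const_mul 2
    · simp only [e2]
      refine (integrable_synth_mul_mul (gradDecay j) smoothDecay smoothDecay (hatL j v) (hatL i v)
        (hatL i v)).congr (Eventually.of_forall fun x => ?_)
      simp only [hW, hG]; ring
    · refine (integrable_synth_mul_mul smoothDecay smoothDecay smoothDecay (hatL j v) (hatL i v)
        (hatL i v)).congr (Eventually.of_forall fun x => ?_)
      simp only [hW]; ring
    · exact fun x _ => ((hL i x).differentiableAt).pow 2
    · exact fun x _ => (hL j x).differentiableAt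
  have hcoe : ∀ i j, ∫ x, ((gradDecay j).synth (hatL i v) x).re *
      (smoothing v x i * smoothing v x j) = ∫ x, G i j x * (W i x * W j x) := by
    intro i j
    refine integral_congr_ae ?_
    filter_upwards [coeFn_smoothing v i, coeFn_smoothing v j] with x h1 h2
    rw [h1, h2]
  rw [inner_convection]
  refine Finset.sum_eq_zero fun i _ => ?_
  simp only [hcoe]
  have h1 : ∑ j, ∫ x, W i x ^ 2 * G j j x = 0 := by
    rw [← integral_finsetSum]
    · refine integral_eq_zero_of_ae (Eventually.of_forall fun x => ?_)
      have h2 := congrArg Complex.re (sum_synth_gradDecay hv x)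
      rw [Complex.re_sum] at h2
      change ∑ j, W i x ^ 2 * G j j x = 0
      rw [← Finset.mul_sum]
      simp only [hG]
      rw [h2]
      simp
    · intro j _
      refine (integrable_synth_mul_mul (gradDecay j) smoothDecay smoothDecay (hatL j v) (hatL i v)
        (hatL i v)).congr (Eventually.of_forall fun x => ?_)
      simp only [hW, hG]; ring
  simp only [hparts, integral_const_mul, Finset.sum_neg_distrib, ← Finset.mul_sum] at h1
  linarith

end Convection

/-! ### Strong convergence after truncation to low frequencies -/

section Compactness

open DecaySymbol Filter

theorem WeakTendsto.clm_apply {H : Type*} [NormedAddCommGroup H] [InnerProductSpace ℝ H]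
    [CompleteSpace H] {v : ℕ → H} {u : H} (h : WeakTendsto v u) (ℓ : H →L[ℝ] ℝ) :
    Tendsto (fun n => ℓ (v n)) atTop (nhds (ℓ u)) := by
  have h1 : ∀ x, ℓ x = inner ℝ x ((InnerProductSpace.toDual ℝ H).symm ℓ) := fun x => by
    rw [real_inner_comm, InnerProductSpace.toDual_symm_apply]
  simp only [h1]
  exact h _

theorem WeakTendsto.clm_map {H K : Type*} [NormedAddCommGroup H] [InnerProductSpace ℝ H]
    [CompleteSpace H] [NormedAddCommGroup K] [InnerProductSpace ℝ K] {v : ℕ → H} {u : H}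
    (h : WeakTendsto v u) (T : H →L[ℝ] K) : WeakTendsto (fun n => T (v n)) (T u) := fun y => by
  have := h.clm_apply ((innerSL ℝ y) ∘L T)
  simpa only [ContinuousLinearMap.comp_apply, innerSL_apply_apply, real_inner_comm y] using this

theorem WeakTendsto.sub_const {H : Type*} [NormedAddCommGroup H] [InnerProductSpace ℝ H]
    {v : ℕ → H} {u : H} (h : WeakTendsto v u) : WeakTendsto (fun n => v n - u) 0 := fun y => by
  simpa [inner_sub_left] using (h y).sub_const (inner ℝ u y)

theorem norm_sq_eq_integral (v : L2Field) : ‖v‖ ^ 2 = ∫ x, ‖v x‖ ^ 2 := by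
  rw [← real_inner_self_eq_norm_sq, L2.inner_def]
  simp only [real_inner_self_eq_norm_sq]

/-- The low frequencies of a vector field. -/
def lowPass (R : ℝ) : L2Field →L[ℝ] L2Field := scalarMultiplier (ballSymbol R)

theorem coeFn_lowPass (R : ℝ) (v : L2Field) (j : Fin 3) :
    (fun x => lowPass R v x j) =ᵐ[volume] fun x => ((ballDecay R).synth (hatL j v) x).re :=
  coeFn_of_hatL (coeFn_hatL_scalarMultiplier (ballSymbol R) j v)

/-- At each point the truncated field is a bounded linear functional of `z n`, so it tends to zero,
and it is bounded uniformly in `x` and `n`. The fixed factor `synth κ g` lies in `L²`, so dominated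
convergence applies on the whole space without localisation. -/
theorem tendsto_entryL_lowPass (i j : Fin 3) (κ : DecaySymbol) (g : L2C) (R : ℝ)
    {z : ℕ → L2Field} {C : ℝ} (hz : WeakTendsto z 0) (hC : ∀ n, ‖z n‖ ≤ C) :
    Tendsto (fun n => entryL i j κ g (lowPass R (z n))) atTop (nhds 0) := by
  have hnorm : ∀ n, ‖entryL i j κ g (lowPass R (z n))‖ ^ 2 =
      ∫ x, (κ.synth g x).re ^ 2 * ((ballDecay R).synth (hatL j (z n)) x).re ^ 2 := fun n => by
    rw [norm_sq_eq_integral]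
    refine integral_congr_ae ?_
    filter_upwards [coeFn_entryL i j κ g (lowPass R (z n)), coeFn_lowPass R (z n) j] with x h1 h2
    rw [h1, norm_smul, h2, mul_pow, PiLp.norm_single, norm_one, one_pow, mul_one, norm_mul,
      mul_pow, Real.norm_eq_abs, Real.norm_eq_abs, sq_abs, sq_abs]
  have hsq : Tendsto (fun n => ‖entryL i j κ g (lowPass R (z n))‖ ^ 2) atTop (nhds 0) := by
    simp only [hnorm]
    have hκ : Integrable fun x => (κ.synth g x).re ^ 2 := (κ.memLp_synth g).re.integrable_sq
    have h0 : (0 : ℝ) = ∫ _ : R3, (0 : ℝ) := by simp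
    rw [h0]
    refine tendsto_integral_of_dominated_convergence
      (fun x => (κ.synth g x).re ^ 2 * ((ballDecay R).l2norm * C) ^ 2) (fun n => ?_)
      (hκ.mul_const _) (fun n => Eventually.of_forall fun x => ?_)
      (Eventually.of_forall fun x => ?_)
    · exact Continuous.aestronglyMeasurable
        (((Complex.continuous_re.comp (κ.continuous_synth g)).pow 2).mul
          ((Complex.continuous_re.comp ((ballDecay R).continuous_synth _)).pow 2))
    · rw [Real.norm_of_nonneg (by positivity)]
      refine mul_le_mul_of_nonneg_left (sq_le_sq.2 ?_) (by positivity)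
      rw [abs_of_nonneg (mul_nonneg (ballDecay R).l2norm_nonneg ((norm_nonneg _).trans (hC 0)))]
      refine (Complex.abs_re_le_norm _).trans (((ballDecay R).norm_synth_le _ x).trans ?_)
      gcongr
      · exact (ballDecay R).l2norm_nonneg
      · exact (norm_hatL_le j _).trans (hC n)
    · let ℓ : L2Field →L[ℝ] ℝ := Complex.reCLM ∘L
        ((innerSL ℂ ((ballDecay R).kernel x)).restrictScalars ℝ) ∘L hatL j
      have h1 := hz.clm_apply ℓ
      have h2 : ∀ v, ℓ v = ((ballDecay R).synth (hatL j v) x).re := fun v => by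
        rw [synth_eq_inner]
        rfl
      simp only [h2, map_zero] at h1
      have h3 : ((ballDecay R).synth 0 x).re = 0 := by rw [synth_eq_inner, inner_zero_right]; rfl
      rw [h3] at h1
      simpa using (h1.pow 2).const_mul ((κ.synth g x).re ^ 2)
  rw [tendsto_zero_iff_norm_tendsto_zero]
  have := hsq.sqrt
  simpa only [Real.sqrt_sq (norm_nonneg _), Real.sqrt_zero] using this

theorem tendsto_convection_lowPass (w : L2Field) (R : ℝ) {v : ℕ → L2Field} {u : L2Field} {C : ℝ}
    (hv : ∀ n, ‖v n‖ ≤ C) (h : WeakTendsto v u) :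
    Tendsto (fun n => convection w (lowPass R (v n))) atTop
      (nhds (convection w (lowPass R u))) := by
  have hz := h.sub_const
  have hb : ∀ n, ‖v n - u‖ ≤ C + ‖u‖ := fun n =>
    (norm_sub_le _ _).trans (by gcongr; exact hv n)
  rw [← tendsto_sub_nhds_zero_iff]
  simp only [← map_sub]
  simp only [convection_apply]
  have : (0 : L2Field) = ∑ _ : Fin 3, ∑ _ : Fin 3, 0 := by simp
  rw [this]
  exact tendsto_finsetSum _ fun i _ => tendsto_finsetSum _ fun j _ =>
    tendsto_entryL_lowPass i j _ _ R hz hb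

end Compactness

end

noncomputable section

/-! ### Homogeneous Sobolev norms and the dissipation -/

section Sobolev

open Filter

theorem L2C.ofReal_norm_sq (g : L2C) : ENNReal.ofReal (‖g‖ ^ 2) = ∫⁻ ξ, ‖g ξ‖ₑ ^ 2 := by
  have h : ‖g‖ ^ 2 = ∫ ξ, ‖g ξ‖ ^ 2 := by
    have h1 : ‖g‖ ^ 2 = (inner ℂ g g).re := by
      rw [inner_self_eq_norm_sq_to_K]; norm_cast
    rw [h1, L2C.re_inner_eq_integral]
    refine integral_congr_ae (Eventually.of_forall fun ξ => ?_)
    change (starRingEnd ℂ (g ξ) * g ξ).re = ‖g ξ‖ ^ 2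
    rw [mul_comm, Complex.mul_conj, Complex.normSq_eq_norm_sq, Complex.ofReal_re]
  rw [h, ofReal_integral_eq_lintegral_ofReal (Lp.memLp g).norm.integrable_sq
    (Eventually.of_forall fun ξ => by positivity)]
  refine lintegral_congr fun ξ => ?_
  rw [ENNReal.ofReal_pow (norm_nonneg _), ofReal_norm]

theorem ofReal_norm_sq_field (v : L2Field) :
    ENNReal.ofReal (‖v‖ ^ 2) = ∑ i, ∫⁻ ξ, ‖hatL i v ξ‖ₑ ^ 2 := by
  rw [norm_sq_hatL, ENNReal.ofReal_sum_of_nonneg fun i _ => by positivity]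
  simp only [L2C.ofReal_norm_sq]

theorem ofReal_norm_sq_scalarMultiplier (m : EvenSymbol) (v : L2Field) :
    ENNReal.ofReal (‖scalarMultiplier m v‖ ^ 2) =
      ∑ i, ∫⁻ ξ, ENNReal.ofReal (m ξ ^ 2) * ‖hatL i v ξ‖ₑ ^ 2 := by
  rw [ofReal_norm_sq_field]
  refine Finset.sum_congr rfl fun i _ => lintegral_congr_ae ?_
  filter_upwards [coeFn_hatL_scalarMultiplier m i v] with ξ h
  rw [h, enorm_mul, mul_pow, ← sq_abs, ENNReal.ofReal_pow (abs_nonneg _), ← ofReal_norm,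
    Complex.norm_real, Real.norm_eq_abs]

theorem homSobolevSq_eq (α : ℝ) (v : L2Field) :
    homSobolevSq (α / 2) v =
      ∑ i, ∫⁻ ξ, ENNReal.ofReal ((2 * Real.pi * ‖ξ‖) ^ α) * ‖hatL i v ξ‖ₑ ^ 2 := by
  rw [homSobolevSq, mul_div_cancel₀ α two_ne_zero]
  rfl

variable {α : ℝ}

theorem sq_truncSymbol (hα₀ : 0 < α) (R : ℝ) (ξ : R3) :
    truncSymbol α hα₀ R ξ ^ 2 =
      (Metric.closedBall (0 : R3) R).indicator (fun ξ => (2 * Real.pi * ‖ξ‖) ^ α) ξ := by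
  change ((Metric.closedBall (0 : R3) R).indicator
    (fun ξ => (2 * Real.pi * ‖ξ‖) ^ (α / 2)) ξ) ^ 2 = _
  by_cases h : ξ ∈ Metric.closedBall (0 : R3) R
  · rw [indicator_of_mem h, indicator_of_mem h, ← Real.rpow_natCast, ← Real.rpow_mul (by positivity)]
    norm_num
  · rw [indicator_of_notMem h, indicator_of_notMem h]
    norm_num

theorem tendsto_truncSymbol (hα₀ : 0 < α) (v : L2Field) :
    Tendsto (fun R : ℕ => ENNReal.ofReal (‖scalarMultiplier (truncSymbol α hα₀ R) v‖ ^ 2)) atTop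
      (nhds (homSobolevSq (α / 2) v)) := by
  simp only [ofReal_norm_sq_scalarMultiplier, homSobolevSq_eq, sq_truncSymbol]
  refine tendsto_finsetSum _ fun i _ => ?_
  refine lintegral_tendsto_of_tendsto_of_monotone (fun R => ?_)
    (Eventually.of_forall fun ξ => ?_) (Eventually.of_forall fun ξ => ?_)
  · refine AEMeasurable.mul ?_ ((Lp.aestronglyMeasurable (hatL i v)).enorm.pow_const 2)
    exact (ENNReal.measurable_ofReal.comp ((((measurable_norm.const_mul _).pow_const α).indicator
      Metric.isClosed_closedBall.measurableSet))).aemeasurable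
  · intro R R' hRR'
    dsimp only
    gcongr
  · refine tendsto_const_nhds.congr' ?_
    obtain ⟨N, hN⟩ := exists_nat_ge ‖ξ‖
    filter_upwards [eventually_ge_atTop N] with R hR
    rw [indicator_of_mem]
    rw [mem_closedBall_zero_iff]
    exact hN.trans (by exact_mod_cast hR)

theorem ofReal_norm_sq_truncSymbol_le (hα₀ : 0 < α) (R : ℝ) (v : L2Field) :
    ENNReal.ofReal (‖scalarMultiplier (truncSymbol α hα₀ R) v‖ ^ 2) ≤ homSobolevSq (α / 2) v := by
  simp only [ofReal_norm_sq_scalarMultiplier, homSobolevSq_eq, sq_truncSymbol]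
  refine Finset.sum_le_sum fun i _ => lintegral_mono fun ξ => ?_
  gcongr
  exact indicator_le_self' (fun _ _ => by positivity) ξ

/-- The Sobolev norm is the increasing limit of the norms after frequency truncation. Each
truncation is a bounded operator, hence weakly continuous, and the `L²` norm is weakly lower
semicontinuous. -/
theorem WeakTendsto.homSobolevSq_le_liminf (hα₀ : 0 < α) {v : ℕ → L2Field} {u : L2Field}
    (h : WeakTendsto v u) :
    homSobolevSq (α / 2) u ≤ liminf (fun n => homSobolevSq (α / 2) (v n)) atTop := by
  refine le_of_tendsto' (tendsto_truncSymbol hα₀ u) fun R => ?_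
  refine (h.clm_map (scalarMultiplier (truncSymbol α hα₀ R))).enorm_sq_le_liminf.trans ?_
  exact liminf_le_liminf (Eventually.of_forall fun n => ofReal_norm_sq_truncSymbol_le hα₀ R (v n))

/-- Only frequencies `|ξ| > R` remain, where `1 ≤ (2πR)^(-α) (2π|ξ|)^α`. -/
theorem ofReal_norm_sq_sub_lowPass_le (hα₀ : 0 < α) {R : ℝ} (hR : 0 < R) (u : L2Field) :
    ENNReal.ofReal (‖u - lowPass R u‖ ^ 2) ≤
      ENNReal.ofReal ((2 * Real.pi * R) ^ (-α)) * homSobolevSq (α / 2) u := by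
  rw [ofReal_norm_sq_field, homSobolevSq_eq, Finset.mul_sum]
  refine Finset.sum_le_sum fun i _ => ?_
  rw [← lintegral_const_mul' _ _ ENNReal.ofReal_ne_top]
  refine lintegral_mono_ae ?_
  rw [map_sub]
  filter_upwards [Lp.coeFn_sub (hatL i u) (hatL i (lowPass R u)),
    coeFn_hatL_scalarMultiplier (ballSymbol R) i u] with ξ h1 h2
  rw [h1, Pi.sub_apply, lowPass, h2]
  change ‖hatL i u ξ - (((Metric.closedBall (0 : R3) R).indicator (fun _ => (1 : ℝ)) ξ : ℝ) : ℂ) *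
    hatL i u ξ‖ₑ ^ 2 ≤ _
  by_cases h : ξ ∈ Metric.closedBall (0 : R3) R
  · rw [indicator_of_mem h]
    simp
  · rw [indicator_of_notMem h, Complex.ofReal_zero, zero_mul, sub_zero, ← mul_assoc,
      ← ENNReal.ofReal_mul (by positivity)]
    refine le_mul_of_one_le_left' ?_
    rw [ENNReal.one_le_ofReal, Real.rpow_neg (by positivity), inv_mul_eq_div,
      one_le_div (by positivity)]
    rw [mem_closedBall_zero_iff, not_le] at h
    gcongr

variable (hα₀ : 0 < α) (hα₄ : α < 4)

/-- The operator `(-Δ)^(α/2)` after smoothing. -/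
def fracOp (hα₀ : 0 < α) (hα₄ : α < 4) : L2Field →L[ℝ] L2Field :=
  scalarMultiplier (fracSymbol α hα₀ hα₄)

theorem re_conj_hatL_smoothing (w : L2Field) (i : Fin 3) :
    ∀ᵐ ξ, (starRingEnd ℂ (hatL i (smoothing w) ξ) * hatL i (fracOp hα₀ hα₄ w) ξ).re =
      (2 * Real.pi * ‖ξ‖) ^ α * ‖hatL i (smoothing w) ξ‖ ^ 2 := by
  filter_upwards [coeFn_hatL_scalarMultiplier smoothSymbol i w,
    coeFn_hatL_scalarMultiplier (fracSymbol α hα₀ hα₄) i w] with ξ h1 h2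
  rw [fracOp, h2, smoothing, h1]
  change (starRingEnd ℂ (((weight ξ ^ 2 : ℝ) : ℂ) * hatL i w ξ) *
    ((((2 * Real.pi * ‖ξ‖) ^ α * weight ξ ^ 2 : ℝ) : ℂ) * hatL i w ξ)).re =
    _ * ‖((weight ξ ^ 2 : ℝ) : ℂ) * hatL i w ξ‖ ^ 2
  have h3 : starRingEnd ℂ (((weight ξ ^ 2 : ℝ) : ℂ) * hatL i w ξ) *
      ((((2 * Real.pi * ‖ξ‖) ^ α * weight ξ ^ 2 : ℝ) : ℂ) * hatL i w ξ) =
      (((2 * Real.pi * ‖ξ‖) ^ α : ℝ) : ℂ) * (starRingEnd ℂ (((weight ξ ^ 2 : ℝ) : ℂ) * hatL i w ξ) *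
        (((weight ξ ^ 2 : ℝ) : ℂ) * hatL i w ξ)) := by
    push_cast
    ring
  rw [h3, Complex.re_ofReal_mul, mul_comm (starRingEnd ℂ _), Complex.mul_conj,
    Complex.normSq_eq_norm_sq, Complex.ofReal_re]

theorem inner_smoothing_fracOp_term_nonneg (w : L2Field) (i : Fin 3) :
    0 ≤ᵐ[volume] fun ξ =>
      (starRingEnd ℂ (hatL i (smoothing w) ξ) * hatL i (fracOp hα₀ hα₄ w) ξ).re := by
  filter_upwards [re_conj_hatL_smoothing hα₀ hα₄ w i] with ξ h
  rw [h, Pi.zero_apply]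
  positivity

theorem inner_smoothing_fracOp_nonneg (w : L2Field) :
    0 ≤ inner ℝ (smoothing w) (fracOp hα₀ hα₄ w) := by
  rw [inner_hatL]
  refine Finset.sum_nonneg fun i _ => ?_
  rw [L2C.re_inner_eq_integral]
  exact integral_nonneg_of_ae (inner_smoothing_fracOp_term_nonneg hα₀ hα₄ w i)

theorem homSobolevSq_smoothing (w : L2Field) :
    homSobolevSq (α / 2) (smoothing w) =
      ENNReal.ofReal (inner ℝ (smoothing w) (fracOp hα₀ hα₄ w)) := by
  rw [inner_hatL, homSobolevSq_eq]
  simp only [L2C.re_inner_eq_integral]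
  rw [ENNReal.ofReal_sum_of_nonneg fun i _ =>
    integral_nonneg_of_ae (inner_smoothing_fracOp_term_nonneg hα₀ hα₄ w i)]
  refine Finset.sum_congr rfl fun i _ => ?_
  rw [ofReal_integral_eq_lintegral_ofReal (L2C.integrable_re_inner _ _)
    (inner_smoothing_fracOp_term_nonneg hα₀ hα₄ w i)]
  refine lintegral_congr_ae ?_
  filter_upwards [re_conj_hatL_smoothing hα₀ hα₄ w i] with ξ h
  rw [h, ENNReal.ofReal_mul (by positivity), ENNReal.ofReal_pow (norm_nonneg _), ofReal_norm]

end Sobolev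

/-! ### The Navier–Stokes model and density of the smoothed fields -/

section Model

open Filter

variable {α : ℝ} (hα₀ : 0 < α) (hα₄ : α < 4)

/-- The fractional Navier-Stokes equations, tested with smoothed divergence-free fields. -/
def navierStokesModel : EnergyModel L2Field solenoidal where
  ι := smoothing ∘L solenoidal.subtypeL
  A := fracOp hα₀ hα₄ ∘L solenoidal.subtypeL
  M := convection ∘L solenoidal.subtypeL
  q := homSobolevSq (α / 2)
  -- The shift keeps the radius positive at `R = 0`, where the rate would otherwise degenerate.
  S R := lowPass (R + 1)
  δ R := (2 * Real.pi * (R + 1)) ^ (-α)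
  ι_injective := (scalarMultiplier_injective fun ξ => (pow_pos (weight_pos ξ) 2).ne').comp
    Subtype.val_injective
  inner_M_self w := inner_convection_self w.2
  inner_A_nonneg w := inner_smoothing_fracOp_nonneg hα₀ hα₄ w
  q_ι w := homSobolevSq_smoothing hα₀ hα₄ w
  q_le_liminf v u h := WeakTendsto.homSobolevSq_le_liminf hα₀ h
  tendsto_M_S w R v u C hv h := tendsto_convection_lowPass w (R + 1) hv h
  norm_sub_S_le R u := ofReal_norm_sq_sub_lowPass_le hα₀ (by positivity) u
  δ_nonneg R := by positivity
  tendsto_δ := by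
    refine (tendsto_rpow_neg_atTop hα₀).comp ?_
    exact Tendsto.const_mul_atTop (by positivity)
      (tendsto_atTop_add_const_right _ _ tendsto_natCast_atTop_atTop)

theorem smoothing_mem_solenoidal {v : L2Field} (hv : v ∈ solenoidal) :
    smoothing v ∈ solenoidal := by
  rw [mem_solenoidal] at hv ⊢
  rw [smoothing, ← scalarMultiplier_comm, hv, map_zero]

/-- Writing `smoothing` as the square of a symmetric injective operator shows that it is positive
definite. -/
theorem smoothing_eq_bessel (v : L2Field) :
    smoothing v = scalarMultiplier besselSymbol (scalarMultiplier besselSymbol v) := by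
  refine ext_hatL_ae fun i => ?_
  filter_upwards [coeFn_hatL_scalarMultiplier smoothSymbol i v,
    coeFn_hatL_scalarMultiplier besselSymbol i v,
    coeFn_hatL_scalarMultiplier besselSymbol i (scalarMultiplier besselSymbol v)] with ξ h1 h2 h3
  rw [smoothing, h1, h3, h2]
  change ((weight ξ ^ 2 : ℝ) : ℂ) * _ = (weight ξ : ℂ) * ((weight ξ : ℂ) * _)
  push_cast
  ring

theorem eq_zero_of_inner_smoothing {z : L2Field} (hz : inner ℝ (smoothing z) z = 0) : z = 0 := by
  rw [smoothing_eq_bessel, inner_scalarMultiplier, real_inner_self_eq_norm_sq, sq_eq_zero_iff,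
    norm_eq_zero] at hz
  exact scalarMultiplier_injective (fun ξ => (weight_pos ξ).ne') (hz.trans (map_zero _).symm)

/-- A divergence-free `z` orthogonal to the range is in particular orthogonal to its own smoothing,
and positive definiteness forces `z = 0`. -/
theorem closure_range_smoothing :
    closure (range (navierStokesModel hα₀ hα₄).ι) = (solenoidal : Set L2Field) := by
  set K : Submodule ℝ L2Field :=
    (LinearMap.range ((navierStokesModel hα₀ hα₄).ι : solenoidal →ₗ[ℝ] L2Field)).topologicalClosure
    with hK
  have hKc : (K : Set L2Field) = closure (range (navierStokesModel hα₀ hα₄).ι) := by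
    rw [hK, Submodule.topologicalClosure_coe]
    rfl
  have hsub : closure (range (navierStokesModel hα₀ hα₄).ι) ⊆ (solenoidal : Set L2Field) := by
    refine closure_minimal ?_ isClosed_solenoidal
    rintro _ ⟨w, rfl⟩
    exact smoothing_mem_solenoidal w.2
  refine subset_antisymm hsub fun u hu => ?_
  rw [← hKc]
  have hcl : IsClosed (K : Set L2Field) := by rw [hKc]; exact isClosed_closure
  have : CompleteSpace K := hcl.completeSpace_coe
  set z := u - K.starProjection u with hz
  have hPK : K.starProjection u ∈ K := Submodule.starProjection_apply_mem K u
  have hzo : ∀ w ∈ K, inner ℝ w z = 0 := fun w hw => by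
    rw [real_inner_comm]
    exact K.starProjection_inner_eq_zero u w hw
  have hzs : z ∈ solenoidal := solenoidal.sub_mem hu (hsub (hKc ▸ hPK))
  have hin : smoothing z ∈ K := by
    rw [← SetLike.mem_coe, hKc]
    exact subset_closure ⟨⟨z, hzs⟩, rfl⟩
  have h0 : z = 0 := eq_zero_of_inner_smoothing (hzo _ hin)
  rw [hz, sub_eq_zero] at h0
  rw [h0]
  exact hPK

theorem exists_isSolution_navierStokes {ν β : ℝ} (hν : 0 < ν) (hβ : 0 < β) (f : L2Field)
    {u₀ : L2Field} (hu₀ : u₀ ∈ solenoidal) :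
    ∃ ρ u, (navierStokesModel hα₀ hα₄).IsSolution ν β f u₀ ρ u := by
  -- Needed by the instance that makes `L²` separable.
  have : Fact ((2 : ℝ≥0∞) ≠ ∞) := ⟨by norm_num⟩
  refine (navierStokesModel hα₀ hα₄).exists_isSolution hν hβ ?_
  rw [closure_range_smoothing]
  exact hu₀

end Model

end

noncomputable section

/-! ### Space-time test functions as curves in `L²` -/

section Slices

open SchwartzMap Filter

theorem lineDerivOp_testFunction_apply (m : ℝ × R3) (φ : 𝓓(spaceTime, R3)) (z : ℝ × R3) :
    (∂_{m} φ) z = fderiv ℝ φ z m := by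
  have hφ : DifferentiableAt ℝ φ z := (φ.contDiff.differentiable (by simp)).differentiableAt
  rw [TestFunction.lineDerivOp_eq_lineDerivCLM ℝ]
  simp [TestFunction.lineDerivCLM_apply, hφ.lineDeriv_eq_fderiv]

/-- The time derivative of a test function. -/
def timeDeriv (φ : 𝓓(spaceTime, R3)) : 𝓓(spaceTime, R3) := ∂_{((1 : ℝ), (0 : R3))} φ

/-- The derivative of a test function in the space direction `j`. -/
def spaceDeriv (j : Fin 3) (φ : 𝓓(spaceTime, R3)) : 𝓓(spaceTime, R3) := ∂_{((0 : ℝ), unitVec j)} φ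

theorem hasDerivAt_testFunction (φ : 𝓓(spaceTime, R3)) (t : ℝ) (x : R3) :
    HasDerivAt (fun s => φ (s, x)) (timeDeriv φ (t, x)) t := by
  have hφ : DifferentiableAt ℝ φ (t, x) := (φ.contDiff.differentiable (by simp)).differentiableAt
  have := hφ.hasFDerivAt.comp_hasDerivAt t ((hasDerivAt_id t).prodMk (hasDerivAt_const t x))
  rw [timeDeriv, lineDerivOp_testFunction_apply]
  exact this

theorem hasFDerivAt_testFunction (φ : 𝓓(spaceTime, R3)) (t : ℝ) (x : R3) :
    HasFDerivAt (fun y => φ (t, y))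
      ((fderiv ℝ φ (t, x)).comp (ContinuousLinearMap.inr ℝ ℝ R3)) x := by
  have hφ : DifferentiableAt ℝ φ (t, x) := (φ.contDiff.differentiable (by simp)).differentiableAt
  exact hφ.hasFDerivAt.comp x (hasFDerivAt_prodMk_right t x)

theorem fderiv_testFunction_unitVec (φ : 𝓓(spaceTime, R3)) (t : ℝ) (x : R3) (j : Fin 3) :
    fderiv ℝ (fun y => φ (t, y)) x (unitVec j) = spaceDeriv j φ (t, x) := by
  rw [(hasFDerivAt_testFunction φ t x).fderiv, spaceDeriv, lineDerivOp_testFunction_apply]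
  simp

theorem exists_bound_testFunction (φ : 𝓓(spaceTime, R3)) : ∃ C, ∀ z, ‖φ z‖ ≤ C :=
  φ.hasCompactSupport.exists_bound_of_continuous φ.continuous

/-- The points of space where a test function does not vanish at some time. -/
def spaceSupport (φ : 𝓓(spaceTime, R3)) : Set R3 := Prod.snd '' tsupport φ

theorem isCompact_spaceSupport (φ : 𝓓(spaceTime, R3)) : IsCompact (spaceSupport φ) :=
  φ.hasCompactSupport.isCompact.image continuous_snd

theorem eq_zero_of_notMem_spaceSupport {φ : 𝓓(spaceTime, R3)} {x : R3} (hx : x ∉ spaceSupport φ)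
    (t : ℝ) : φ (t, x) = 0 :=
  image_eq_zero_of_notMem_tsupport fun h => hx ⟨_, h, rfl⟩

theorem timeDeriv_eq_zero_of_notMem {φ : 𝓓(spaceTime, R3)} {x : R3} (hx : x ∉ spaceSupport φ)
    (t : ℝ) : timeDeriv φ (t, x) = 0 := by
  have h := hasDerivAt_testFunction φ t x
  simp only [eq_zero_of_notMem_spaceSupport hx] at h
  exact h.unique (hasDerivAt_const t 0)

theorem contDiff_slice (φ : 𝓓(spaceTime, R3)) (t : ℝ) :
    ContDiff ℝ (⊤ : ℕ∞) fun x => φ (t, x) :=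
  φ.contDiff.comp (contDiff_const.prodMk contDiff_id)

theorem hasCompactSupport_slice (φ : 𝓓(spaceTime, R3)) (t : ℝ) :
    HasCompactSupport fun x => φ (t, x) :=
  HasCompactSupport.intro (isCompact_spaceSupport φ) fun _ hx => eq_zero_of_notMem_spaceSupport hx t

theorem memLp_slice (φ : 𝓓(spaceTime, R3)) (t : ℝ) : MemLp (fun x => φ (t, x)) 2 volume :=
  (contDiff_slice φ t).continuous.memLp_of_hasCompactSupport (hasCompactSupport_slice φ t)

/-- A test function at a fixed time, as an element of `L²`. -/
def slice (t : ℝ) : 𝓓(spaceTime, R3) →ₗ[ℝ] L2Field where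
  toFun φ := (memLp_slice φ t).toLp _
  map_add' φ ψ := by
    rw [← MemLp.toLp_add]
    exact MemLp.toLp_congr _ _ (Eventually.of_forall fun x => by simp)
  map_smul' c φ := by
    rw [RingHom.id_apply, ← MemLp.toLp_const_smul]
    exact MemLp.toLp_congr _ _ (Eventually.of_forall fun x => by simp)

theorem coeFn_slice (t : ℝ) (φ : 𝓓(spaceTime, R3)) :
    slice t φ =ᵐ[volume] fun x => φ (t, x) := (memLp_slice φ t).coeFn_toLp

theorem norm_le_of_ae_bound_of_support (v : L2Field) {K : Set R3} (hK : IsCompact K) {B : ℝ}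
    (hB : 0 ≤ B) (h : ∀ᵐ x, ‖v x‖ ≤ K.indicator (fun _ => B) x) :
    ‖v‖ ≤ √(volume.real K) * B := by
  rw [← Real.sqrt_sq hB, ← Real.sqrt_mul measureReal_nonneg]
  refine Real.le_sqrt_of_sq_le ?_
  have hInt : Integrable (K.indicator fun _ => B ^ 2) (volume : Measure R3) :=
    (integrable_indicator_iff hK.measurableSet).2 (integrableOn_const hK.measure_lt_top.ne)
  calc ‖v‖ ^ 2 = ∫ x, ‖v x‖ ^ 2 := norm_sq_eq_integral v
    _ ≤ ∫ x, K.indicator (fun _ => B ^ 2) x := by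
      refine integral_mono_ae (Lp.memLp v).norm.integrable_sq hInt ?_
      filter_upwards [h] with x hx
      by_cases hxK : x ∈ K
      · rw [indicator_of_mem hxK] at hx ⊢
        change ‖v x‖ ^ 2 ≤ _
        gcongr
      · rw [indicator_of_notMem hxK] at hx ⊢
        change ‖v x‖ ^ 2 ≤ _
        rw [le_antisymm hx (norm_nonneg _)]
        norm_num
    _ = volume.real K * B ^ 2 := by
      rw [integral_indicator hK.measurableSet, setIntegral_const, smul_eq_mul]

theorem norm_slice_le {φ : 𝓓(spaceTime, R3)} {K : Set R3} (hK : IsCompact K)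
    (h : spaceSupport φ ⊆ K) {B : ℝ} (hB : ∀ z, ‖φ z‖ ≤ B) (t : ℝ) :
    ‖slice t φ‖ ≤ √(volume.real K) * B := by
  have hB0 : 0 ≤ B := (norm_nonneg _).trans (hB 0)
  refine norm_le_of_ae_bound_of_support _ hK hB0 ?_
  filter_upwards [coeFn_slice t φ] with x hx
  rw [hx]
  by_cases hxK : x ∈ K
  · rw [indicator_of_mem hxK]
    exact hB _
  · rw [indicator_of_notMem hxK, eq_zero_of_notMem_spaceSupport (fun h' => hxK (h h')), norm_zero]

theorem exists_bound_slice (φ : 𝓓(spaceTime, R3)) : ∃ C, 0 ≤ C ∧ ∀ t, ‖slice t φ‖ ≤ C := by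
  obtain ⟨B, hB⟩ := exists_bound_testFunction φ
  have hB0 : 0 ≤ B := (norm_nonneg _).trans (hB 0)
  exact ⟨_, by positivity, norm_slice_le (isCompact_spaceSupport φ) subset_rfl hB⟩

theorem norm_timeDeriv_sub_le {φ : 𝓓(spaceTime, R3)} {B : ℝ} (hB : ∀ z, ‖timeDeriv φ z‖ ≤ B)
    (s t : ℝ) (x : R3) : ‖φ (s, x) - φ (t, x)‖ ≤ B * |s - t| :=
  Convex.norm_image_sub_le_of_norm_hasDerivWithin_le (s := univ)
    (fun r _ => (hasDerivAt_testFunction φ r x).hasDerivWithinAt) (fun _ _ => hB _) convex_univ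
    (mem_univ _) (mem_univ _)

theorem norm_taylor_testFunction_le {φ : 𝓓(spaceTime, R3)} {B : ℝ}
    (hB : ∀ z, ‖timeDeriv (timeDeriv φ) z‖ ≤ B) (s t : ℝ) (x : R3) :
    ‖φ (s, x) - φ (t, x) - (s - t) • timeDeriv φ (t, x)‖ ≤ B * |s - t| * |s - t| := by
  have hB0 : 0 ≤ B := (norm_nonneg _).trans (hB 0)
  have h := Convex.norm_image_sub_le_of_norm_hasDerivWithin_le (s := uIcc t s)
    (f := fun r => φ (r, x) - r • timeDeriv φ (t, x))
    (f' := fun r => timeDeriv φ (r, x) - timeDeriv φ (t, x)) (C := B * |s - t|) (x := t) (y := s)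
    (fun r _ => ((hasDerivAt_testFunction φ r x).sub
      (by simpa using (hasDerivAt_id r).smul_const (timeDeriv φ (t, x)))).hasDerivWithinAt)
    (fun r hr => (norm_timeDeriv_sub_le hB r t x).trans 
      (mul_le_mul_of_nonneg_left (abs_sub_left_of_mem_uIcc hr) hB0)) (convex_uIcc _ _) left_mem_uIcc right_mem_uIcc
  refine le_trans (le_of_eq ?_) h
  congr 1
  rw [sub_smul]
  abel

/-- The Taylor remainder in time is uniform in `x` and supported in one fixed compact set, so the
pointwise derivative is also the derivative in `L²`. -/
theorem hasDerivAt_slice (φ : 𝓓(spaceTime, R3)) (t : ℝ) :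
    HasDerivAt (fun s => slice s φ) (slice t (timeDeriv φ)) t := by
  obtain ⟨B, hB⟩ := exists_bound_testFunction (timeDeriv (timeDeriv φ))
  have hB0 : 0 ≤ B := (norm_nonneg _).trans (hB 0)
  set V := √(volume.real (spaceSupport φ))
  have hest : ∀ s, ‖slice s φ - slice t φ - (s - t) • slice t (timeDeriv φ)‖ ≤
      V * B * ‖(s - t) ^ 2‖ := by
    intro s
    have h := norm_le_of_ae_bound_of_support (slice s φ - slice t φ - (s - t) • slice t (timeDeriv φ))
      (isCompact_spaceSupport φ) (B := B * |s - t| * |s - t|) (by positivity) ?_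
    · refine h.trans (le_of_eq ?_)
      rw [norm_pow, Real.norm_eq_abs]
      ring
    · filter_upwards [Lp.coeFn_sub (slice s φ - slice t φ) ((s - t) • slice t (timeDeriv φ)),
        Lp.coeFn_sub (slice s φ) (slice t φ), Lp.coeFn_smul (s - t) (slice t (timeDeriv φ)),
        coeFn_slice s φ, coeFn_slice t φ, coeFn_slice t (timeDeriv φ)] with x h1 h2 h3 h4 h5 h6
      rw [h1, Pi.sub_apply, h2, Pi.sub_apply, h3, Pi.smul_apply, h4, h5, h6]
      by_cases hx : x ∈ spaceSupport φ
      · rw [indicator_of_mem hx]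
        exact norm_taylor_testFunction_le hB s t x
      · rw [indicator_of_notMem hx, eq_zero_of_notMem_spaceSupport hx,
          eq_zero_of_notMem_spaceSupport hx, timeDeriv_eq_zero_of_notMem hx]
        simp
  rw [hasDerivAt_iff_isLittleO]
  have hO : (fun s => slice s φ - slice t φ - (s - t) • slice t (timeDeriv φ)) =O[nhds t]
      fun s => (s - t) ^ 2 := Asymptotics.IsBigO.of_bound _ (Eventually.of_forall hest)
  refine hO.trans_isLittleO ?_
  have h2 : (fun r : ℝ => r ^ 2) =o[nhds 0] fun r : ℝ => r := by
    simpa using Asymptotics.isLittleO_pow_pow (𝕜 := ℝ) (m := 1) (n := 2) (by norm_num)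
  have h3 : Tendsto (fun s : ℝ => s - t) (nhds t) (nhds 0) := by
    simpa using (tendsto_id (α := ℝ) (x := nhds t)).sub_const t
  exact h2.comp_tendsto h3

theorem continuous_slice (φ : 𝓓(spaceTime, R3)) : Continuous fun t => slice t φ :=
  continuous_iff_continuousAt.2 fun t => (hasDerivAt_slice φ t).continuousAt

theorem slice_eq_zero {φ : 𝓓(spaceTime, R3)} {t : ℝ} (h : ∀ x, φ (t, x) = 0) : slice t φ = 0 := by
  ext1
  filter_upwards [coeFn_slice t φ, Lp.coeFn_zero R3 2 (volume : Measure R3)] with x h1 h2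
  rw [h1, h2, h, Pi.zero_apply]

theorem testFunction_eq_zero_of_nonpos (φ : 𝓓(spaceTime, R3)) {t : ℝ} (ht : t ≤ 0) (x : R3) :
    φ (t, x) = 0 := by
  refine image_eq_zero_of_notMem_tsupport fun h => ?_
  have h' : (0 : ℝ) < t := φ.tsupport_subset h
  linarith

theorem exists_time_bound (φ : 𝓓(spaceTime, R3)) :
    ∃ T, 0 ≤ T ∧ ∀ t, T ≤ t → ∀ x, φ (t, x) = 0 := by
  obtain ⟨T, hT⟩ := (φ.hasCompactSupport.isCompact.image continuous_fst).bddAbove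
  -- Adding `1` puts all times considered strictly after the support.
  refine ⟨max (T + 1) 0, le_max_right _ _, fun t ht x => ?_⟩
  refine image_eq_zero_of_notMem_tsupport fun h => ?_
  have h1 := hT ⟨_, h, rfl⟩
  have h2 := (le_max_left (T + 1) 0).trans ht
  change t ≤ T at h1
  linarith

/-- A component of a test function at a fixed time, as a Schwartz function. -/
def sliceSchwartz (i : Fin 3) (t : ℝ) (φ : 𝓓(spaceTime, R3)) : 𝓢(R3, ℂ) :=
  HasCompactSupport.toSchwartzMap (f := fun x => ((φ (t, x) i : ℝ) : ℂ))
    ((hasCompactSupport_slice φ t).comp_left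
      (g := Complex.ofRealCLM.comp (EuclideanSpace.proj i : R3 →L[ℝ] ℝ)) (map_zero _))
    ((Complex.ofRealCLM.comp (EuclideanSpace.proj i : R3 →L[ℝ] ℝ)).contDiff.comp
      (contDiff_slice φ t))

theorem sliceSchwartz_apply (i : Fin 3) (t : ℝ) (φ : 𝓓(spaceTime, R3)) (x : R3) :
    sliceSchwartz i t φ x = ((φ (t, x) i : ℝ) : ℂ) := rfl

theorem componentL_slice (i : Fin 3) (t : ℝ) (φ : 𝓓(spaceTime, R3)) :
    componentL i (slice t φ) = (sliceSchwartz i t φ).toLp 2 := by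
  ext1
  filter_upwards [coeFn_componentL i (slice t φ), coeFn_slice t φ,
    (sliceSchwartz i t φ).coeFn_toLp 2 volume] with x h1 h2 h3
  rw [h1, h2, h3, sliceSchwartz_apply]

theorem coeFn_hatL_slice (i : Fin 3) (t : ℝ) (φ : 𝓓(spaceTime, R3)) :
    hatL i (slice t φ) =ᵐ[volume] 𝓕 (fun x => ((φ (t, x) i : ℝ) : ℂ)) := by
  have h : hatL i (slice t φ) = (𝓕 (sliceSchwartz i t φ)).toLp 2 := by
    rw [hatL_apply, ← toLp_fourier_eq, ← componentL_slice, componentL_apply]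
  rw [h]
  filter_upwards [(𝓕 (sliceSchwartz i t φ)).coeFn_toLp 2 volume] with ξ hξ
  rw [hξ, fourier_coe]
  rfl

theorem sliceSchwartz_spaceDeriv (i j : Fin 3) (t : ℝ) (φ : 𝓓(spaceTime, R3)) :
    sliceSchwartz i t (spaceDeriv j φ) = ∂_{unitVec j} (sliceSchwartz i t φ) := by
  ext x
  rw [lineDerivOp_apply_eq_fderiv]
  have h : HasFDerivAt (sliceSchwartz i t φ)
      ((Complex.ofRealCLM.comp (EuclideanSpace.proj i : R3 →L[ℝ] ℝ)).comp
        ((fderiv ℝ φ (t, x)).comp (ContinuousLinearMap.inr ℝ ℝ R3))) x :=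
    (Complex.ofRealCLM.comp (EuclideanSpace.proj i : R3 →L[ℝ] ℝ)).hasFDerivAt.comp x
      (hasFDerivAt_testFunction φ t x)
  rw [h.fderiv, sliceSchwartz_apply, spaceDeriv, lineDerivOp_testFunction_apply]
  simp

theorem coeFn_hatL_spaceDeriv (i j : Fin 3) (t : ℝ) (φ : 𝓓(spaceTime, R3)) :
    hatL i (slice t (spaceDeriv j φ)) =ᵐ[volume]
      fun ξ => 2 * Real.pi * Complex.I * (ξ j : ℝ) * hatL i (slice t φ) ξ := by
  have h1 : hatL i (slice t (spaceDeriv j φ)) =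
      𝓕 ((∂_{unitVec j} (sliceSchwartz i t φ)).toLp 2 : L2C) := by
    rw [hatL_apply, ← sliceSchwartz_spaceDeriv, ← componentL_slice, componentL_apply]
  rw [h1]
  filter_upwards [coeFn_fourier_lineDeriv (sliceSchwartz i t φ) j, coeFn_hatL_slice i t φ]
    with ξ h2 h3
  rw [h2, h3, fourier_coe]
  rfl

/-- The operator `1 - Δ / 4π²` on test functions. -/
def besselInv : 𝓓(spaceTime, R3) →L[ℝ] 𝓓(spaceTime, R3) :=
  ContinuousLinearMap.id ℝ _ - (4 * Real.pi ^ 2)⁻¹ • ∑ j,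
    (TestFunction.lineDerivCLM ℝ ((0 : ℝ), unitVec j) : 𝓓(spaceTime, R3) →L[ℝ] 𝓓(spaceTime, R3)) ∘L
      (TestFunction.lineDerivCLM ℝ ((0 : ℝ), unitVec j))

theorem besselInv_apply (φ : 𝓓(spaceTime, R3)) :
    besselInv φ = φ - (4 * Real.pi ^ 2)⁻¹ • ∑ j, spaceDeriv j (spaceDeriv j φ) := by
  simp [besselInv]
  rfl

theorem coeFn_hatL_besselInv (i : Fin 3) (t : ℝ) (φ : 𝓓(spaceTime, R3)) :
    hatL i (slice t φ) =ᵐ[volume] fun ξ => (weight ξ : ℂ) * hatL i (slice t (besselInv φ)) ξ := by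
  have h0 : hatL i (slice t (besselInv φ)) = hatL i (slice t φ) - (4 * Real.pi ^ 2)⁻¹ •
      (hatL i (slice t (spaceDeriv 0 (spaceDeriv 0 φ))) +
        hatL i (slice t (spaceDeriv 1 (spaceDeriv 1 φ))) +
        hatL i (slice t (spaceDeriv 2 (spaceDeriv 2 φ)))) := by
    rw [besselInv_apply, Fin.sum_univ_three]
    simp only [map_sub, map_smul, map_add]
  rw [h0]
  set g := fun j => hatL i (slice t (spaceDeriv j (spaceDeriv j φ))) with hg
  change _ =ᵐ[volume] fun ξ => (weight ξ : ℂ) *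
    (hatL i (slice t φ) - (4 * Real.pi ^ 2)⁻¹ • (g 0 + g 1 + g 2) : L2C) ξ
  have h2 : ∀ j, g j =ᵐ[volume] fun ξ => -(4 * Real.pi ^ 2 * (ξ j : ℂ) ^ 2) *
      hatL i (slice t φ) ξ := fun j => by
    filter_upwards [coeFn_hatL_spaceDeriv i j t (spaceDeriv j φ), coeFn_hatL_spaceDeriv i j t φ]
      with ξ h3 h4
    simp only [hg]
    rw [h3, h4]
    linear_combination (4 * Real.pi ^ 2 * (ξ j : ℂ) ^ 2 * hatL i (slice t φ) ξ) * Complex.I_sq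
  filter_upwards [Lp.coeFn_sub (hatL i (slice t φ)) ((4 * Real.pi ^ 2)⁻¹ • (g 0 + g 1 + g 2)),
    Lp.coeFn_smul (4 * Real.pi ^ 2)⁻¹ (g 0 + g 1 + g 2), Lp.coeFn_add (g 0 + g 1) (g 2),
    Lp.coeFn_add (g 0) (g 1), h2 0, h2 1, h2 2] with ξ e1 e2 e3 e4 e5 e6 e7
  rw [e1, Pi.sub_apply, e2, Pi.smul_apply, e3, Pi.add_apply, e4, Pi.add_apply, e5, e6, e7]
  have hs := ofReal_norm_sq ξ
  rw [Fin.sum_univ_three] at hs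
  have hw : (weight ξ : ℂ) * (1 + (‖ξ‖ : ℂ) ^ 2) = 1 := by
    have : weight ξ * (1 + ‖ξ‖ ^ 2) = 1 := inv_mul_cancel₀ (by positivity)
    exact_mod_cast this
  have hpi : (4 * (Real.pi : ℂ) ^ 2) ≠ 0 := by
    simp [Real.pi_ne_zero]
  rw [Complex.real_smul]
  push_cast
  rw [hs] at hw
  have h5 : (4 * (Real.pi : ℂ) ^ 2)⁻¹ * (-(4 * (Real.pi : ℂ) ^ 2 * (ξ 0 : ℂ) ^ 2) *
      hatL i (slice t φ) ξ + -(4 * (Real.pi : ℂ) ^ 2 * (ξ 1 : ℂ) ^ 2) * hatL i (slice t φ) ξ +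
      -(4 * (Real.pi : ℂ) ^ 2 * (ξ 2 : ℂ) ^ 2) * hatL i (slice t φ) ξ) =
      -((ξ 0 : ℂ) ^ 2 + (ξ 1 : ℂ) ^ 2 + (ξ 2 : ℂ) ^ 2) * hatL i (slice t φ) ξ := by
    field_simp
    ring
  rw [h5]
  linear_combination -(hatL i (slice t φ) ξ) * hw

/-- The operator `(1 - Δ / 4π²)²` on test functions. -/
def smoothInv : 𝓓(spaceTime, R3) →L[ℝ] 𝓓(spaceTime, R3) := besselInv ∘L besselInv

theorem coeFn_hatL_smoothInv (i : Fin 3) (t : ℝ) (φ : 𝓓(spaceTime, R3)) :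
    hatL i (slice t φ) =ᵐ[volume]
      fun ξ => ((weight ξ ^ 2 : ℝ) : ℂ) * hatL i (slice t (smoothInv φ)) ξ := by
  filter_upwards [coeFn_hatL_besselInv i t φ, coeFn_hatL_besselInv i t (besselInv φ)] with ξ h1 h2
  rw [h1, h2, smoothInv, ContinuousLinearMap.comp_apply]
  push_cast
  ring

/-- Every test function is the smoothing of another test function, so it has the form required by
the abstract model. -/
theorem smoothing_slice_smoothInv (t : ℝ) (φ : 𝓓(spaceTime, R3)) :
    smoothing (slice t (smoothInv φ)) = slice t φ := by
  refine ext_hatL_ae fun i => ?_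
  filter_upwards [coeFn_hatL_scalarMultiplier smoothSymbol i (slice t (smoothInv φ)),
    coeFn_hatL_smoothInv i t φ] with ξ h1 h2
  rw [smoothing, h1, h2]
  rfl

end Slices

end

noncomputable section

/-! ### The weak formulation in terms of operators on `L²` -/

section Identification

open DecaySymbol Filter

variable {α : ℝ}

/-- Applying `smoothInv` once more gains a factor `(1 + |ξ|²)⁻²`, which makes the symbol square
integrable, so that the integral inversion formula is available. -/
theorem coeFn_fracOp_slice (hα₀ : 0 < α) (hα₄ : α < 4) (t : ℝ) (φ : 𝓓(spaceTime, R3)) :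
    fracOp hα₀ hα₄ (slice t (smoothInv φ)) =ᵐ[volume]
      fun x => fracLaplacianVec α (fun y => φ (t, y)) x := by
  have h : ∀ i, (fun x => fracOp hα₀ hα₄ (slice t (smoothInv φ)) x i) =ᵐ[volume]
      fun x => fracLaplacian α (fun y => φ (t, y) i) x := fun i => by
    have h1 : hatL i (fracOp hα₀ hα₄ (slice t (smoothInv φ))) =ᵐ[volume] fun ξ =>
        fracDecay α hα₀ hα₄ ξ * hatL i (slice t (smoothInv (smoothInv φ))) ξ := by
      filter_upwards [coeFn_hatL_scalarMultiplier (fracSymbol α hα₀ hα₄) i (slice t (smoothInv φ)),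
        coeFn_hatL_smoothInv i t (smoothInv φ)] with ξ h2 h3
      rw [fracOp, h2, h3]
      change (((2 * Real.pi * ‖ξ‖) ^ α * weight ξ ^ 2 : ℝ) : ℂ) * _ =
        (((2 * Real.pi * ‖ξ‖) ^ α * weight ξ ^ 2 * weight ξ ^ 2 : ℝ) : ℂ) * _
      push_cast
      ring
    refine (coeFn_of_hatL h1).trans (Eventually.of_forall fun x => ?_)
    refine congrArg Complex.re (Real.fourierInv_congr_ae ?_ x)
    filter_upwards [coeFn_hatL_slice i t φ, coeFn_hatL_smoothInv i t φ,
      coeFn_hatL_smoothInv i t (smoothInv φ)] with ξ h2 h3 h4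
    rw [← h2, h3, h4]
    change (((2 * Real.pi * ‖ξ‖) ^ α * weight ξ ^ 2 * weight ξ ^ 2 : ℝ) : ℂ) * _ = _
    push_cast
    ring
  filter_upwards [ae_all_iff.2 h] with x hx
  ext i
  exact hx i

theorem coeFn_synth_gradDecay_slice (i j : Fin 3) (t : ℝ) (φ : 𝓓(spaceTime, R3)) :
    (fun x => ((gradDecay j).synth (hatL i (slice t (smoothInv φ))) x).re) =ᵐ[volume]
      fun x => spaceDeriv j φ (t, x) i := by
  have h1 : hatL i (slice t (spaceDeriv j φ)) =ᵐ[volume] fun ξ =>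
      gradDecay j ξ * hatL i (slice t (smoothInv φ)) ξ := by
    filter_upwards [coeFn_hatL_spaceDeriv i j t φ, coeFn_hatL_smoothInv i t φ] with ξ h2 h3
    rw [h2, h3, ← mul_assoc]
    rfl
  filter_upwards [coeFn_of_hatL h1, coeFn_slice t (spaceDeriv j φ)] with x h2 h3
  rw [← h2, h3]

theorem eq_sum_unitVec (y : R3) : y = ∑ j, y j • unitVec j := by
  ext k
  fin_cases k <;> simp [Fin.sum_univ_three, unitVec]

theorem inner_fderiv_testFunction (t : ℝ) (φ : 𝓓(spaceTime, R3)) (u : L2Field) :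
    (fun x => inner ℝ (u x) (fderiv ℝ (fun y => φ (t, y)) x (u x))) =ᵐ[volume] fun x =>
      ∑ i, ∑ j, ((gradDecay j).synth (hatL i (slice t (smoothInv φ))) x).re * (u x i * u x j) := by
  filter_upwards [ae_all_iff.2 fun i => ae_all_iff.2 fun j =>
    coeFn_synth_gradDecay_slice i j t φ] with x h
  conv_lhs => rw [eq_sum_unitVec (u x)]
  rw [map_sum, ← eq_sum_unitVec (u x), inner_sum, Finset.sum_comm]
  refine Finset.sum_congr rfl fun j _ => ?_
  rw [map_smul, fderiv_testFunction_unitVec, inner_smul_right, PiLp.inner_apply, Finset.mul_sum]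
  refine Finset.sum_congr rfl fun i _ => ?_
  rw [h i j]
  simp only [RCLike.inner_apply, conj_trivial]
  ring

theorem inner_convection_slice (t : ℝ) (φ : 𝓓(spaceTime, R3)) (u : L2Field) :
    Integrable (fun x => inner ℝ (u x) (fderiv ℝ (fun y => φ (t, y)) x (u x))) ∧
    ∫ x, inner ℝ (u x) (fderiv ℝ (fun y => φ (t, y)) x (u x)) =
      inner ℝ u (convection (slice t (smoothInv φ)) u) := by
  have h := inner_fderiv_testFunction t φ u
  have hInt : ∀ i j, Integrable fun x =>
      ((gradDecay j).synth (hatL i (slice t (smoothInv φ))) x).re * (u x i * u x j) :=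
    fun i j => integrable_entry i j _ _ u u
  refine ⟨(integrable_finsetSum _ fun i _ => integrable_finsetSum _ fun j _ => hInt i j).congr
    h.symm, ?_⟩
  rw [integral_congr_ae h, inner_convection,
    integral_finsetSum _ fun i _ => integrable_finsetSum _ fun j _ => hInt i j]
  exact Finset.sum_congr rfl fun i _ => integral_finsetSum _ fun j _ => hInt i j

theorem inner_coeFn {v w : L2Field} {g : R3 → R3} (h : w =ᵐ[volume] g) :
    Integrable (fun x => inner ℝ (v x) (g x)) ∧ ∫ x, inner ℝ (v x) (g x) = inner ℝ v w := by
  have h1 : (fun x => inner ℝ (v x) (w x)) =ᵐ[volume] fun x => inner ℝ (v x) (g x) := by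
    filter_upwards [h] with x hx
    rw [hx]
  exact ⟨(L2.integrable_inner v w).congr h1, by rw [L2.inner_def, integral_congr_ae h1]⟩

/-- The space integral in the weak formulation, in terms of operators on `L²`. -/
theorem integral_weak_formulation (hα₀ : 0 < α) (hα₄ : α < 4) (ν β : ℝ) (f u : L2Field)
    (φ : 𝓓(spaceTime, R3)) (t : ℝ) :
    ∫ x : R3, (inner ℝ (u x) (deriv (fun s => φ (s, x)) t)
        - ν * inner ℝ (u x) (fracLaplacianVec α (fun y => φ (t, y)) x)
        + inner ℝ (u x) (fderiv ℝ (fun y => φ (t, y)) x (u x))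
        + inner ℝ (f x) (φ (t, x)) - β * inner ℝ (u x) (φ (t, x))) =
      inner ℝ u (slice t (timeDeriv φ)) - ν * inner ℝ u (fracOp hα₀ hα₄ (slice t (smoothInv φ)))
        + inner ℝ u (convection (slice t (smoothInv φ)) u) + inner ℝ f (slice t φ)
        - β * inner ℝ u (slice t φ) := by
  have hd : ∀ x, deriv (fun s => φ (s, x)) t = timeDeriv φ (t, x) := fun x =>
    (hasDerivAt_testFunction φ t x).deriv
  simp only [hd]
  obtain ⟨i1, e1⟩ := inner_coeFn (v := u) (coeFn_slice t (timeDeriv φ))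
  obtain ⟨i2, e2⟩ := inner_coeFn (v := u) (coeFn_fracOp_slice hα₀ hα₄ t φ)
  obtain ⟨i3, e3⟩ := inner_convection_slice t φ u
  obtain ⟨i4, e4⟩ := inner_coeFn (v := f) (coeFn_slice t φ)
  obtain ⟨i5, e5⟩ := inner_coeFn (v := u) (coeFn_slice t φ)
  rw [integral_sub, integral_add, integral_add, integral_sub, integral_const_mul,
    integral_const_mul, e1, e2, e3, e4, e5]
  · exact i1
  · exact i2.const_mul ν
  · exact i1.sub (i2.const_mul ν)
  · exact i3
  · exact (i1.sub (i2.const_mul ν)).add i3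
  · exact i4
  · exact ((i1.sub (i2.const_mul ν)).add i3).add i4
  · exact i5.const_mul β

end Identification

/-! ### The pressure -/

section Pressure

open DecaySymbol Filter

/-- The map `(g, u) ↦ (Re 𝓕⁻ (ξᵢ ξⱼ |ξ|⁻² (1 + |ξ|²)⁻² g))ᵢⱼ u`. -/
def pressureForm : L2C →L[ℝ] L2Field →L[ℝ] L2Field :=
  ∑ i, ∑ j, entryL i j (rieszDecay i j)

theorem pressureForm_apply (g : L2C) :
    pressureForm g = ∑ i, ∑ j, entryL i j (rieszDecay i j) g := by
  simp [pressureForm]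

/-- The embedding of scalar test functions as the first component of vector test functions. -/
def scalarTest : 𝓓(spaceTime, ℝ) →L[ℝ] 𝓓(spaceTime, R3) :=
  TestFunction.postcompCLM (ContinuousLinearMap.toSpanSingleton ℝ (unitVec 0))

theorem scalarTest_apply (ψ : 𝓓(spaceTime, ℝ)) (z : ℝ × R3) :
    scalarTest ψ z = ψ z • unitVec 0 := by
  rw [scalarTest, TestFunction.postcompCLM_apply]
  simp

theorem hatL_scalarTest_spaceDiv (t : ℝ) (φ : 𝓓(spaceTime, R3)) :
    hatL 0 (slice t (scalarTest (spaceDiv φ))) = ∑ k, hatL k (slice t (spaceDeriv k φ)) := by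
  have h : componentL 0 (slice t (scalarTest (spaceDiv φ))) =
      ∑ k, componentL k (slice t (spaceDeriv k φ)) := by
    ext1
    rw [Fin.sum_univ_three]
    set c := fun k => componentL k (slice t (spaceDeriv k φ))
    have hc : ∀ k, c k =ᵐ[volume] fun x => ((spaceDeriv k φ (t, x) k : ℝ) : ℂ) := fun k => by
      filter_upwards [coeFn_componentL k (slice t (spaceDeriv k φ)),
        coeFn_slice t (spaceDeriv k φ)] with x h1 h2
      change componentL k (slice t (spaceDeriv k φ)) x = _
      rw [h1, h2]
    change _ =ᵐ[volume] ((c 0 + c 1 + c 2 : L2C) : R3 → ℂ)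
    filter_upwards [coeFn_componentL 0 (slice t (scalarTest (spaceDiv φ))),
      coeFn_slice t (scalarTest (spaceDiv φ)), hc 0, hc 1, hc 2, Lp.coeFn_add (c 0 + c 1) (c 2),
      Lp.coeFn_add (c 0) (c 1)] with x h1 h2 h3 h4 h5 h6 h7
    rw [h1, h2, h6, Pi.add_apply, h7, Pi.add_apply, h3, h4, h5, scalarTest_apply, spaceDiv_apply,
      Fin.sum_univ_three]
    simp only [← fderiv_testFunction_unitVec]
    simp [unitVec]
  have h2 : ∀ k v, hatL k v = (Lp.fourierTransformₗᵢ R3 ℂ) (componentL k v) := fun _ _ => rfl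
  simp only [h2]
  rw [h, map_sum]

/-- The derivative `∂ⱼ` of the `i`-th component of the gradient part has transform `ξᵢ ξⱼ |ξ|⁻²`
times that of the divergence. The contribution of the gradient part thus depends on `φ` only through
`spaceDiv φ`, which is what allows a pressure to be defined. -/
theorem convection_gradProj_slice (t : ℝ) (φ : 𝓓(spaceTime, R3)) :
    convection (gradProj (slice t (smoothInv φ))) =
      pressureForm (hatL 0 (slice t (smoothInv (scalarTest (spaceDiv φ))))) := by
  ext1 u
  rw [convection_apply, pressureForm_apply]
  simp only [sum_apply]
  refine Finset.sum_congr rfl fun i _ => Finset.sum_congr rfl fun j _ => ?_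
  congr 1
  refine entryL_congr ?_
  have h0 : hatL 0 (slice t (scalarTest (spaceDiv φ))) =ᵐ[volume] fun ξ =>
      ∑ k, 2 * Real.pi * Complex.I * (ξ k : ℝ) * hatL k (slice t φ) ξ := by
    rw [hatL_scalarTest_spaceDiv, Fin.sum_univ_three]
    set c := fun k => hatL k (slice t (spaceDeriv k φ)) with hc
    change ((c 0 + c 1 + c 2 : L2C) : R3 → ℂ) =ᵐ[volume] _
    filter_upwards [coeFn_hatL_spaceDeriv 0 0 t φ, coeFn_hatL_spaceDeriv 1 1 t φ,
      coeFn_hatL_spaceDeriv 2 2 t φ, Lp.coeFn_add (c 0 + c 1) (c 2), Lp.coeFn_add (c 0) (c 1)]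
      with ξ h1 h2 h3 h4 h5
    rw [h4, Pi.add_apply, h5, Pi.add_apply, Fin.sum_univ_three]
    simp only [hc]
    rw [h1, h2, h3]
  filter_upwards [h0, coeFn_hatL_smoothInv 0 t (scalarTest (spaceDiv φ)),
    ae_all_iff.2 fun k => coeFn_hatL_smoothInv k t φ,
    coeFn_hatL_gradProj i (slice t (smoothInv φ))] with ξ h1 h2 h3 h4
  rw [h4]
  change (2 * Real.pi * Complex.I * (ξ j : ℝ) * ((weight ξ ^ 2 : ℝ) : ℂ)) * _ =
    ((ξ i * ξ j / ‖ξ‖ ^ 2 * weight ξ ^ 2 : ℝ) : ℂ) * _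
  have h5 : ((ξ i * ξ j / ‖ξ‖ ^ 2 * weight ξ ^ 2 : ℝ) : ℂ) *
      hatL 0 (slice t (smoothInv (scalarTest (spaceDiv φ)))) ξ =
      ((ξ i * ξ j / ‖ξ‖ ^ 2 : ℝ) : ℂ) * (((weight ξ ^ 2 : ℝ) : ℂ) *
        hatL 0 (slice t (smoothInv (scalarTest (spaceDiv φ)))) ξ) := by
    push_cast
    ring
  rw [h5, ← h2, h1]
  simp only [h3, Fin.sum_univ_three]
  push_cast
  ring

theorem integrableOn_Ioi_of_bound {F : ℝ → ℝ} {T C : ℝ}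
    (hF : AEStronglyMeasurable F (volume.restrict (Ioi 0))) (hC : ∀ t, 0 < t → |F t| ≤ C)
    (hT : ∀ t, T ≤ t → F t = 0) : IntegrableOn F (Ioi 0) := by
  have hg : IntegrableOn ((Icc 0 T).indicator fun _ => C) (Ioi (0 : ℝ)) :=
    ((integrable_indicator_iff measurableSet_Icc).2
      (integrableOn_const measure_Icc_lt_top.ne)).integrableOn
  refine hg.mono' hF ((ae_restrict_iff' measurableSet_Ioi).2 (Eventually.of_forall fun t ht => ?_))
  by_cases h : t ∈ Icc 0 T
  · rw [indicator_of_mem h]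
    exact hC t ht
  · rw [indicator_of_notMem h, hT t, norm_zero]
    by_contra! hlt
    exact h ⟨le_of_lt ht, hlt.le⟩

variable {u : ℝ → L2Field} {ρ : ℝ}

/-- The density in time of the pressure. -/
def pressureDensity (u : ℝ → L2Field) (φ : 𝓓(spaceTime, R3)) (t : ℝ) : ℝ :=
  inner ℝ (u t) (pressureForm (hatL 0 (slice t φ)) (u t))

theorem abs_pressureDensity_le (hu : ∀ t, 0 ≤ t → ‖u t‖ ≤ ρ) {φ : 𝓓(spaceTime, R3)} {C : ℝ}
    (hC : ∀ t, ‖slice t φ‖ ≤ C) {t : ℝ} (ht : 0 ≤ t) :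
    |pressureDensity u φ t| ≤ ρ * (‖pressureForm‖ * C * ρ) := by
  have hρ : 0 ≤ ρ := (norm_nonneg _).trans (hu 0 le_rfl)
  have hC0 : 0 ≤ C := (norm_nonneg _).trans (hC 0)
  refine (abs_real_inner_le_norm _ _).trans ?_
  gcongr
  · exact hu t ht
  · refine (ContinuousLinearMap.le_opNorm _ _).trans ?_
    gcongr
    · refine (ContinuousLinearMap.le_opNorm _ _).trans ?_
      gcongr
      exact (norm_hatL_le 0 _).trans (hC t)
    · exact hu t ht

theorem pressureDensity_eq_zero {φ : 𝓓(spaceTime, R3)} {t : ℝ} (h : ∀ x, φ (t, x) = 0) :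
    pressureDensity u φ t = 0 := by
  rw [pressureDensity, slice_eq_zero h]
  simp

theorem aestronglyMeasurable_pressureDensity
    (hm : AEStronglyMeasurable u (volume.restrict (Ici 0))) (φ : 𝓓(spaceTime, R3)) :
    AEStronglyMeasurable (pressureDensity u φ) (volume.restrict (Ioi 0)) := by
  have hm' : AEStronglyMeasurable u (volume.restrict (Ioi 0)) :=
    hm.mono_measure (Measure.restrict_mono Ioi_subset_Ici_self le_rfl)
  have h : Continuous fun t => hatL 0 (slice t φ) := (hatL 0).continuous.comp (continuous_slice φ)
  exact hm'.inner
    (pressureForm.aestronglyMeasurable_comp₂ h.stronglyMeasurable.aestronglyMeasurable hm')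

theorem integrableOn_pressureDensity (hm : AEStronglyMeasurable u (volume.restrict (Ici 0)))
    (hu : ∀ t, 0 ≤ t → ‖u t‖ ≤ ρ) (φ : 𝓓(spaceTime, R3)) :
    IntegrableOn (pressureDensity u φ) (Ioi 0) := by
  obtain ⟨C, _, hC⟩ := exists_bound_slice φ
  obtain ⟨T, _, hT⟩ := exists_time_bound φ
  exact integrableOn_Ioi_of_bound (aestronglyMeasurable_pressureDensity hm φ)
    (fun t ht => abs_pressureDensity_le hu hC ht.le) fun t ht => pressureDensity_eq_zero (hT t ht)

theorem abs_integral_pressureDensity_le (hu : ∀ t, 0 ≤ t → ‖u t‖ ≤ ρ) {φ : 𝓓(spaceTime, R3)}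
    {C T : ℝ} (hT0 : 0 ≤ T) (hC : ∀ t, ‖slice t φ‖ ≤ C) (hT : ∀ t, T ≤ t → ∀ x, φ (t, x) = 0) :
    |∫ t in Ioi 0, pressureDensity u φ t| ≤ ρ * (‖pressureForm‖ * C * ρ) * T := by
  have h1 : ∫ t in Ioi 0, pressureDensity u φ t = ∫ t in Ioc 0 T, pressureDensity u φ t := by
    refine setIntegral_eq_of_subset_of_forall_sdiff_eq_zero measurableSet_Ioi
      Ioc_subset_Ioi_self fun t ht => pressureDensity_eq_zero (hT t ?_)
    by_contra! hlt
    exact ht.2 ⟨ht.1, hlt.le⟩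
  rw [h1, ← Real.norm_eq_abs]
  refine (norm_setIntegral_le_of_norm_le_const measure_Ioc_lt_top
    fun t ht => abs_pressureDensity_le hu hC ht.1.le).trans (le_of_eq ?_)
  simp [hT0]

/-- The functional `φ ↦ -∫ ⟨u, pressureForm (φ) u⟩ dt` on test functions. -/
def pressureFunctional (hm : AEStronglyMeasurable u (volume.restrict (Ici 0)))
    (hu : ∀ t, 0 ≤ t → ‖u t‖ ≤ ρ) : 𝓓(spaceTime, R3) →ₗ[ℝ] ℝ where
  toFun φ := -∫ t in Ioi 0, pressureDensity u φ t
  map_add' φ ψ := by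
    rw [← neg_add, ← integral_add (integrableOn_pressureDensity hm hu φ)
      (integrableOn_pressureDensity hm hu ψ)]
    simp [pressureDensity, inner_add_right]
  map_smul' c φ := by
    rw [RingHom.id_apply, smul_neg, smul_eq_mul, ← integral_const_mul]
    simp [pressureDensity, inner_smul_right]

/-- By the universal property of the topology on test functions it is enough to fix the support `K`.
There the spatial support and the time horizon are fixed, so the functional is bounded by a multiple
of the sup norm. -/
theorem continuous_pressureFunctional (hm : AEStronglyMeasurable u (volume.restrict (Ici 0)))
    (hu : ∀ t, 0 ≤ t → ‖u t‖ ≤ ρ) : Continuous (pressureFunctional hm hu) := by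
  rw [TestFunction.continuous_iff_continuous_comp]
  intro K hK
  obtain ⟨T₀, hT₀⟩ := (K.isCompact.image continuous_fst).bddAbove
  set K' : Set R3 := Prod.snd '' (K : Set (ℝ × R3))
  have hK' : IsCompact K' := K.isCompact.image continuous_snd
  let Φ : ContDiffMapSupportedIn (ℝ × R3) R3 ⊤ K →ₗ[ℝ] ℝ := pressureFunctional hm hu ∘ₗ
    (TestFunction.ofSupportedInCLM ℝ hK : _ →L[ℝ] 𝓓(spaceTime, R3)).toLinearMap
  let J : ContDiffMapSupportedIn (ℝ × R3) R3 ⊤ K →L[ℝ] BoundedContinuousFunction (ℝ × R3) R3 :=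
    ContDiffMapSupportedIn.toBoundedContinuousFunctionCLM ℝ
  have hbound : ∀ g, ‖Φ g‖ ≤
      ρ * (‖pressureForm‖ * (√(volume.real K') * ‖J g‖) * ρ) * max (T₀ + 1) 0 := fun g => by
    set φ := TestFunction.ofSupportedIn hK g with hφ
    have hsupp : tsupport φ ⊆ K := g.tsupport_subset
    have hΦ : Φ g = -∫ t in Ioi 0, pressureDensity u φ t := rfl
    rw [hΦ, norm_neg, Real.norm_eq_abs]
    refine abs_integral_pressureDensity_le hu (le_max_right _ _) ?_ fun t ht x => ?_
    · exact norm_slice_le hK' (image_mono hsupp) fun z => (J g).norm_coe_le_norm z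
    · refine image_eq_zero_of_notMem_tsupport fun h => ?_
      have h1 : t ≤ T₀ := hT₀ ⟨_, hsupp h, rfl⟩
      linarith [(le_max_left (T₀ + 1) 0).trans ht]
  change Continuous Φ
  refine continuous_of_continuousAt_zero Φ ?_
  rw [ContinuousAt, map_zero]
  refine squeeze_zero_norm hbound ?_
  have hJ : Continuous fun g =>
      ρ * (‖pressureForm‖ * (√(volume.real K') * ‖J g‖) * ρ) * max (T₀ + 1) 0 := by
    have := J.continuous
    fun_prop
  simpa using hJ.tendsto 0

/-- The pressure. -/
def pressure (hm : AEStronglyMeasurable u (volume.restrict (Ici 0)))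
    (hu : ∀ t, 0 ≤ t → ‖u t‖ ≤ ρ) : 𝓓'(spaceTime, ℝ) where
  toLinearMap := pressureFunctional hm hu ∘ₗ (smoothInv ∘L scalarTest).toLinearMap
  cont := (continuous_pressureFunctional hm hu).comp (smoothInv ∘L scalarTest).continuous

theorem pressure_spaceDiv (hm : AEStronglyMeasurable u (volume.restrict (Ici 0)))
    (hu : ∀ t, 0 ≤ t → ‖u t‖ ≤ ρ) (φ : 𝓓(spaceTime, R3)) :
    pressure hm hu (spaceDiv φ) =
      -∫ t in Ioi 0, pressureDensity u (smoothInv (scalarTest (spaceDiv φ))) t := rfl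

end Pressure

end

noncomputable section

/-! ### The equation with pressure and the energy inequality -/

section Equation

open Filter

/-- The projection on divergence-free fields. -/
def leray : L2Field →L[ℝ] solenoidal :=
  (ContinuousLinearMap.id ℝ L2Field - gradProj).codRestrict solenoidal fun v => by
    rw [mem_solenoidal, sub_apply, ContinuousLinearMap.id_apply, map_sub, gradProj_gradProj,
      sub_self]

theorem coe_leray (v : L2Field) : (leray v : L2Field) = v - gradProj v := rfl

theorem inner_gradProj_eq_zero {u : L2Field} (hu : u ∈ solenoidal) (v : L2Field) :
    inner ℝ u (gradProj v) = 0 := by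
  rw [← inner_gradProj, mem_solenoidal.1 hu, inner_zero_left]

/-- A scalar multiplier commutes with the projection on gradients, so the discarded part stays a
gradient and is orthogonal to `u`. -/
theorem inner_scalarMultiplier_leray (m : EvenSymbol) {u : L2Field} (hu : u ∈ solenoidal)
    (v : L2Field) :
    inner ℝ u (scalarMultiplier m (leray v : L2Field)) = inner ℝ u (scalarMultiplier m v) := by
  rw [coe_leray, map_sub, inner_sub_right, scalarMultiplier_comm, inner_gradProj_eq_zero hu,
    sub_zero]

/-- Both sides are the derivative of the same curve `s ↦ slice s φ`; this avoids commuting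
`smoothInv` with the time derivative on test functions. -/
theorem smoothing_slice_timeDeriv (t : ℝ) (φ : 𝓓(spaceTime, R3)) :
    smoothing (slice t (timeDeriv (smoothInv φ))) = slice t (timeDeriv φ) := by
  have h := smoothing.hasFDerivAt.comp_hasDerivAt t (hasDerivAt_slice (smoothInv φ) t)
  have h2 : (smoothing ∘ fun s => slice s (smoothInv φ)) = fun s => slice s φ :=
    funext fun s => smoothing_slice_smoothInv s φ
  rw [h2] at h
  exact h.unique (hasDerivAt_slice φ t)

variable {α ν β ρ : ℝ} {hα₀ : 0 < α} {hα₄ : α < 4} {f u₀ : L2Field} {u : ℝ → L2Field}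

theorem EnergyModel.IsSolution.mem_solenoidal
    (h : (navierStokesModel hα₀ hα₄).IsSolution ν β f u₀ ρ u) {t : ℝ} (ht : 0 ≤ t) :
    u t ∈ solenoidal := by
  have := h.mem_closure t ht
  rwa [closure_range_smoothing] at this

theorem EnergyModel.IsSolution.integral_slice
    (h : (navierStokesModel hα₀ hα₄).IsSolution ν β f u₀ ρ u) (φ : 𝓓(spaceTime, R3)) :
    ∫ t in Ioi 0, (inner ℝ (u t) ((navierStokesModel hα₀ hα₄).ι
      (leray (slice t (timeDeriv (smoothInv φ))))) +
      (navierStokesModel hα₀ hα₄).rhs ν β f (u t) (leray (slice t (smoothInv φ)))) = 0 := by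
  obtain ⟨C, hC0, hC⟩ := exists_bound_slice (timeDeriv (smoothInv φ))
  obtain ⟨T, hT0, hT⟩ := exists_time_bound (smoothInv φ)
  obtain ⟨T', hT0', hT'⟩ := exists_time_bound (timeDeriv (smoothInv φ))
  have hC' : ∀ t, ‖leray (slice t (timeDeriv (smoothInv φ)))‖ ≤ ‖leray‖ * C := fun t =>
    (leray.le_opNorm _).trans (mul_le_mul_of_nonneg_left (hC t) leray.opNorm_nonneg)
  have hd : ∀ t, HasDerivAt (fun t => leray (slice t (smoothInv φ)))
      (leray (slice t (timeDeriv (smoothInv φ)))) t := fun t =>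
    leray.hasFDerivAt.comp_hasDerivAt t (hasDerivAt_slice (smoothInv φ) t)
  have hc' : Continuous fun t => leray (slice t (timeDeriv (smoothInv φ))) :=
    leray.continuous.comp (continuous_slice _)
  refine h.integral_test (v := fun t => leray (slice t (smoothInv φ)))
    (v' := fun t => leray (slice t (timeDeriv (smoothInv φ)))) (C := ‖leray‖ * C) (T := max T T')
    (hT0.trans (le_max_left _ _)) (fun s t => ?_) (leray.continuous.comp (continuous_slice _))
    hC' hc' (fun y s t _ => ?_) ?_ (fun t ht => ?_) fun t ht => ?_
  · exact Convex.norm_image_sub_le_of_norm_hasDerivWithin_le (s := univ)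
      (fun r _ => (hd r).hasDerivWithinAt) (fun r _ => hC' r) convex_univ (mem_univ _) (mem_univ _)
  · have hd' : ∀ r, HasDerivAt
        (fun r => inner ℝ y ((navierStokesModel hα₀ hα₄).ι (leray (slice r (smoothInv φ)))))
        (inner ℝ y ((navierStokesModel hα₀ hα₄).ι
          (leray (slice r (timeDeriv (smoothInv φ)))))) r := fun r =>
      ((innerSL ℝ y) ∘L (navierStokesModel hα₀ hα₄).ι).hasFDerivAt.comp_hasDerivAt r (hd r)
    refine (intervalIntegral.integral_eq_sub_of_hasDerivAt (fun r _ => hd' r) ?_).symm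
    exact (continuous_const.inner
      ((navierStokesModel hα₀ hα₄).ι.continuous.comp hc')).intervalIntegrable _ _
  · rw [slice_eq_zero (testFunction_eq_zero_of_nonpos _ le_rfl), map_zero]
  · rw [slice_eq_zero (hT t ((le_max_left _ _).trans ht)), map_zero]
  · rw [slice_eq_zero (hT' t ((le_max_right _ _).trans ht)), map_zero]

/-- In every linear term the projection may be removed, because `u t` and `f` are divergence-free.
Only the convective term feels the gradient part of the test function, and the difference is the
pressure density. -/
theorem EnergyModel.IsSolution.integral_weak_formulation_eq
    (h : (navierStokesModel hα₀ hα₄).IsSolution ν β f u₀ ρ u) (hf : f ∈ solenoidal)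
    (φ : 𝓓(spaceTime, R3)) {t : ℝ} (ht : 0 ≤ t) :
    inner ℝ (u t) (slice t (timeDeriv φ)) -
        ν * inner ℝ (u t) (fracOp hα₀ hα₄ (slice t (smoothInv φ)))
        + inner ℝ (u t) (convection (slice t (smoothInv φ)) (u t)) + inner ℝ f (slice t φ)
        - β * inner ℝ (u t) (slice t φ) =
      (inner ℝ (u t) ((navierStokesModel hα₀ hα₄).ι
        (leray (slice t (timeDeriv (smoothInv φ))))) +
        (navierStokesModel hα₀ hα₄).rhs ν β f (u t) (leray (slice t (smoothInv φ)))) +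
      pressureDensity u (smoothInv (scalarTest (spaceDiv φ))) t := by
  have hu := h.mem_solenoidal ht
  have e1 : inner ℝ (u t) ((navierStokesModel hα₀ hα₄).ι
      (leray (slice t (timeDeriv (smoothInv φ))))) = inner ℝ (u t) (slice t (timeDeriv φ)) :=
    (inner_scalarMultiplier_leray smoothSymbol hu _).trans
      (congrArg (inner ℝ (u t)) (smoothing_slice_timeDeriv t φ))
  have e2 : inner ℝ (u t) ((navierStokesModel hα₀ hα₄).A (leray (slice t (smoothInv φ)))) =
      inner ℝ (u t) (fracOp hα₀ hα₄ (slice t (smoothInv φ))) :=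
    inner_scalarMultiplier_leray _ hu _
  have e3 : ∀ {v}, v ∈ solenoidal →
      inner ℝ v ((navierStokesModel hα₀ hα₄).ι (leray (slice t (smoothInv φ)))) =
        inner ℝ v (slice t φ) := fun hv =>
    (inner_scalarMultiplier_leray smoothSymbol hv _).trans
      (congrArg (inner ℝ _) (smoothing_slice_smoothInv t φ))
  have e4 : inner ℝ (u t) ((navierStokesModel hα₀ hα₄).M (leray (slice t (smoothInv φ))) (u t)) =
      inner ℝ (u t) (convection (slice t (smoothInv φ)) (u t)) -
        pressureDensity u (smoothInv (scalarTest (spaceDiv φ))) t := by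
    rw [pressureDensity, ← convection_gradProj_slice, ← inner_sub_right, ← sub_apply, ← map_sub]
    rfl
  rw [EnergyModel.rhs, e1, e2, e3 hf, e3 hu, e4]
  ring

theorem EnergyModel.IsSolution.satisfiesFracNS
    (h : (navierStokesModel hα₀ hα₄).IsSolution ν β f u₀ ρ u) (hf : f ∈ solenoidal) :
    SatisfiesFracNS ν α β f u (pressure h.aestronglyMeasurable h.norm_le) := by
  intro φ
  rw [pressure_spaceDiv, ← sub_eq_add_neg, sub_eq_zero]
  set 𝓜 := navierStokesModel hα₀ hα₄
  have hp := integrableOn_pressureDensity h.aestronglyMeasurable h.norm_le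
    (smoothInv (scalarTest (spaceDiv φ)))
  set N : ℝ → ℝ := fun t => inner ℝ (u t) (𝓜.ι (leray (slice t (timeDeriv (smoothInv φ))))) +
    𝓜.rhs ν β f (u t) (leray (slice t (smoothInv φ))) with hN
  have hNint : IntegrableOn N (Ioi 0) := by
    obtain ⟨C, hC0, hC⟩ := exists_bound_slice (timeDeriv (smoothInv φ))
    obtain ⟨C', hC0', hC'⟩ := exists_bound_slice (smoothInv φ)
    obtain ⟨T, hT0, hT⟩ := exists_time_bound (smoothInv φ)
    obtain ⟨T', hT0', hT'⟩ := exists_time_bound (timeDeriv (smoothInv φ))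
    have hρ : 0 ≤ ρ := (norm_nonneg _).trans (h.norm_le 0 le_rfl)
    have hm : AEStronglyMeasurable u (volume.restrict (Ioi 0)) :=
      h.aestronglyMeasurable.mono_measure (Measure.restrict_mono Ioi_subset_Ici_self le_rfl)
    have hsc : SecondCountableTopologyEither ℝ solenoidal := secondCountableTopologyEither_of_left _ _
    have hc : ∀ ψ, Continuous fun t => leray (slice t ψ) := fun ψ =>
      leray.continuous.comp (continuous_slice ψ)
    refine integrableOn_Ioi_of_bound (T := max T T')
      (C := ρ * (‖𝓜.ι‖ * (‖leray‖ * C)) + 𝓜.rhsBound ν β f ρ * (‖leray‖ * C')) ?_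
      (fun t ht => ?_) fun t ht => ?_
    · exact (hm.inner (𝓜.ι.continuous.comp (hc _)).stronglyMeasurable.aestronglyMeasurable).add
        (EnergyModel.aestronglyMeasurable_rhs hm (hc _).stronglyMeasurable.aestronglyMeasurable)
    · refine (abs_add_le _ _).trans (add_le_add ?_ ?_)
      · refine (abs_real_inner_le_norm _ _).trans (mul_le_mul (h.norm_le t ht.le) ?_
          (norm_nonneg _) hρ)
        refine (𝓜.ι.le_opNorm _).trans (mul_le_mul_of_nonneg_left ?_ 𝓜.ι.opNorm_nonneg)
        exact (leray.le_opNorm _).trans (mul_le_mul_of_nonneg_left (hC t) leray.opNorm_nonneg)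
      · refine (𝓜.abs_rhs_le ν β f (h.norm_le t ht.le) _).trans
          (mul_le_mul_of_nonneg_left ?_ (𝓜.rhsBound_nonneg ν β f hρ))
        exact (leray.le_opNorm _).trans (mul_le_mul_of_nonneg_left (hC' t) leray.opNorm_nonneg)
    · simp only [hN]
      rw [slice_eq_zero (hT t ((le_max_left _ _).trans ht)),
        slice_eq_zero (hT' t ((le_max_right _ _).trans ht))]
      simp [EnergyModel.rhs]
  have h1 : ∫ t in Ioi (0 : ℝ), ∫ x : R3,
      (inner ℝ (u t x) (deriv (fun s => φ (s, x)) t)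
        - ν * inner ℝ (u t x) (fracLaplacianVec α (fun y => φ (t, y)) x)
        + inner ℝ (u t x) (fderiv ℝ (fun y => φ (t, y)) x (u t x))
        + inner ℝ (f x) (φ (t, x))
        - β * inner ℝ (u t x) (φ (t, x))) =
      ∫ t in Ioi (0 : ℝ), (N t + pressureDensity u (smoothInv (scalarTest (spaceDiv φ))) t) := by
    refine setIntegral_congr_fun measurableSet_Ioi fun t ht => ?_
    rw [integral_weak_formulation hα₀ hα₄ ν β f (u t) φ t]
    exact h.integral_weak_formulation_eq hf φ (le_of_lt ht)
  rw [h1, integral_add hNint hp, h.integral_slice φ, zero_add]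

theorem EnergyModel.IsSolution.isWeakSolution
    (h : (navierStokesModel hα₀ hα₄).IsSolution ν β f u₀ ρ u) (hf : f ∈ solenoidal) :
    IsWeakSolution ν α β u₀ f u where
  memLinfty _ _ := memLp_top_of_bound
    (h.aestronglyMeasurable.mono_measure (Measure.restrict_mono Icc_subset_Ici_self le_rfl)) ρ
    ((ae_restrict_iff' measurableSet_Icc).2 (Eventually.of_forall fun t ht => h.norm_le t ht.1))
  memL2 T hT := ⟨h.aestronglyMeasurable.mono_measure
    (Measure.restrict_mono Icc_subset_Ici_self le_rfl), h.lintegral_q_lt_top T hT.le⟩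
  divFree _ ht := isDivFree_of_mem_solenoidal (h.mem_solenoidal ht)
  weakContinuous := h.weakContinuous
  initial := h.zero
  equation := ⟨_, h.satisfiesFracNS hf⟩

theorem EnergyModel.IsSolution.energyInequality
    (h : (navierStokesModel hα₀ hα₄).IsSolution ν β f u₀ ρ u) (hν : 0 < ν) (hβ : 0 < β) :
    EnergyInequality ν α β u₀ f u := by
  intro t ht
  have hm : AEStronglyMeasurable u (volume.restrict (Icc 0 t)) :=
    h.aestronglyMeasurable.mono_measure (Measure.restrict_mono Icc_subset_Ici_self le_rfl)
  have hInt : IntegrableOn (fun s => ‖u s‖ ^ 2) (Icc 0 t) := by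
    refine IntegrableOn.of_bound measure_Icc_lt_top (hm.norm.pow 2) (ρ ^ 2)
      ((ae_restrict_iff' measurableSet_Icc).2 (Eventually.of_forall fun s hs => ?_))
    rw [Real.norm_of_nonneg (by positivity)]
    exact pow_le_pow_left₀ (norm_nonneg _) (h.norm_le s hs.1) 2
  have hb : ∫ s in (0 : ℝ)..t, ‖u s‖ ^ 2 = ∫ s in Icc 0 t, ‖u s‖ ^ 2 := by
    rw [intervalIntegral.integral_of_le ht, integral_Icc_eq_integral_Ioc]
  have hlb : ∫⁻ s in Icc 0 t, ENNReal.ofReal (‖u s‖ ^ 2) =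
      ENNReal.ofReal (∫ s in Icc 0 t, ‖u s‖ ^ 2) :=
    (ofReal_integral_eq_lintegral_ofReal hInt
      (Eventually.of_forall fun s => by positivity)).symm
  have hb0 : 0 ≤ ∫ s in Icc 0 t, ‖u s‖ ^ 2 := integral_nonneg fun s => by positivity
  have hfu : ∀ s, ∫ x : R3, inner ℝ (f x) (u s x) = inner ℝ f (u s) := fun s =>
    (L2.inner_def f (u s)).symm
  have hQ : ∫⁻ s in Icc 0 t, homSobolevSq (α / 2) (u s) ≠ ∞ := (h.lintegral_q_lt_top t ht).ne
  have he := h.energy t ht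
  change ENNReal.ofReal (‖u t‖ ^ 2) + ENNReal.ofReal (2 * ν) *
    (∫⁻ s in Icc 0 t, homSobolevSq (α / 2) (u s)) + _ ≤ _ at he
  rw [hlb, ← ENNReal.ofReal_toReal hQ, ← ENNReal.ofReal_mul (by positivity),
    ← ENNReal.ofReal_mul (by positivity), ← ENNReal.ofReal_add (by positivity) (by positivity),
    ← ENNReal.ofReal_add (by positivity) (by positivity), ENNReal.ofReal_le_ofReal_iff'] at he
  simp only [hfu]
  rw [hb]
  set Q := (∫⁻ s in Icc 0 t, homSobolevSq (α / 2) (u s)).toReal with hQd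
  have hQ0 : 0 ≤ Q := ENNReal.toReal_nonneg
  have h1 : 0 ≤ 2 * ν * Q := by positivity
  have h2 : 0 ≤ 2 * β * ∫ s in Icc 0 t, ‖u s‖ ^ 2 := by positivity
  have h3 : 0 ≤ ‖u t‖ ^ 2 := by positivity
  rcases he with he | he
  · linarith
  -- The comparison in `ℝ≥0∞` loses information if the right-hand side is negative. In that case the
  -- left-hand side is zero, so, as `β > 0`, `u` vanishes at almost every time in `[0, t]` and the
  -- work of the force is zero.
  · have h4 : ∫ s in Icc 0 t, ‖u s‖ ^ 2 = 0 := by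
      have : 2 * β * ∫ s in Icc 0 t, ‖u s‖ ^ 2 = 0 := by linarith
      rcases mul_eq_zero.1 this with h' | h'
      · linarith
      · exact h'
    have h5 : ∫ s in (0 : ℝ)..t, inner ℝ f (u s) = 0 := by
      rw [intervalIntegral.integral_of_le ht, ← integral_Icc_eq_integral_Ioc]
      refine integral_eq_zero_of_ae ?_
      filter_upwards [(setIntegral_eq_zero_iff_of_nonneg_ae
        (Eventually.of_forall fun s => by positivity) hInt).1 h4] with s hs
      have : u s = 0 := by simpa using hs
      rw [this, inner_zero_right, Pi.zero_apply]
    rw [h5, h4]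
    have : 0 ≤ ‖u₀‖ ^ 2 := by positivity
    linarith

end Equation

end

theorem theorem7p1 (ν α β : ℝ) (hν : 0 < ν) (hα₀ : 0 < α) (hα₄ : α < 4) (hβ : 0 < β)
    (u₀ f : L2Field) (hu₀ : IsDivFree u₀) (hf : IsDivFree f) (hfH : MemHomSobolev (-(α / 2)) f) :
    ∃ u : ℝ → L2Field, IsWeakSolution ν α β u₀ f u ∧ EnergyInequality ν α β u₀ f u := by
  obtain ⟨ρ, u, h⟩ := exists_isSolution_navierStokes hα₀ hα₄ hν hβ f hu₀.mem_solenoidal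
  exact ⟨u, h.isWeakSolution hf.mem_solenoidal, h.energyInequality hν hβ⟩
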